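/- Let $\mathcal D$ be a set of closed disks of radius $1$ in $\mathbb R^2$. A space decomposition tree (SDT) for $\mathcal D$ with leaf constant $K$ is a finite rooted binary tree $T$ in which each node $v$ has a region $R_v\subseteq\mathbb R^2$ such that the root has region $\mathbb R^2$, each inner node $v$ carries a directed line $\ell_v$, its left and right child have the regions $R_v\cap \ell_v^+$ and $R_v\cap\ell_v^-$ (where $\ell_v^+$, $\ell_v^-$ are the closed halfplanes to the left and to the right of $\ell_v$), and each leaf region intersects at most $K$ disks of $\mathcal D$. Let $d_v$ be the number of disks of $\mathcal D$ that intersect $R_v$. The tree $T$ is an $(\alpha,\beta)$-SDT if for every inner node $v$ with children $u,w$: (i) $\ell_v$ intersects at most $d_v^{\beta}$ of the disks that intersect $R_v$; and (ii) $d_u,d_w\le\alpha d_v$. **Theorem.** For every $\varepsilon\in(0,1/2)$ there are constants $K$ and $C$ and a randomized algorithm with the following properties. Given any $n\ge 0$ and the list of the centers of $n$ pairwise disjoint closed unit disks in $\mathbb R^2$, forming the set $\mathcal D$, the algorithm has expected running time at most $C\,(n\log_2 n+1)$ (with $0\log_2 0=0$), that is, $O(n\log n)$. Whenever it halts (which it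 does with probability $1$), it outputs a $(1/2+\varepsilon,1/2+\varepsilon)$-SDT $T$ for $\mathcal D$ with leaf constant $K$ and, for each disk $D\in\mathcal D$, a list $T_D$ of (nondegenerate) triangles that cover the leaf regions of $T$ that intersect $D$, in the following sense. There is an axis-parallel bounding box $B$ that contains all disks of $\mathcal D$ and all bounded leaf regions of $T$, such that for each $D\in\mathcal D$: * each triangle of $T_D$ is contained in $R\cap B$ for some leaf region $R$ of $T$ that intersects $D$; * for each leaf region $R$ of $T$ that intersects $D$, the set $R\cap B$ is contained in the union of the triangles of $T_D$. Here an algorithm is one fixed finite program (depending only on $\varepsilon$) consisting of mutually recursive functions on real numbers and linked structures of two-field cells. Its elementary steps, each of cost one, are: access to a local variable, a rational constant, an operation $+,-,\times,/$ on reals, a comparison of two reals, the creation of a cell or of the empty cell, the test of a linked structure for emptiness with access to its fields, a local definition, a function call, and a fair coin toss. There is no rounding operation. Expectation is over the coin tosses only. -/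

import Mathlib

open MeasureTheory Set
open scoped ENNReal

noncomputable section

namespace OnionSDT

/-! ### Planar geometry -/

/-- The Euclidean plane. -/
abbrev Plane : Type := EuclideanSpace ℝ (Fin 2)

/-- The closed unit disk with the given center. -/
def unitDisk (p : Plane) : Set Plane := Metric.closedBall p 1

/-- A directed line, given by a point on it and a nonzero direction vector. -/
structure DirLine where
  point : Plane
  dir : Plane
  dir_ne : dir ≠ 0

namespace DirLine

/-- The cross product of the direction of `l` with `x - l.point`: positive to the left of `l`,
negative to the right of `l`, zero on `l`. -/
def side (l : DirLine) (x : Plane) : ℝ :=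
  l.dir 0 * (x 1 - l.point 1) - l.dir 1 * (x 0 - l.point 0)

/-- The points of the line. -/
def carrier (l : DirLine) : Set Plane := {x | l.side x = 0}

/-- The (closed) halfplane to the left of the line. -/
def left (l : DirLine) : Set Plane := {x | 0 ≤ l.side x}

/-- The (closed) halfplane to the right of the line. -/
def right (l : DirLine) : Set Plane := {x | l.side x ≤ 0}

end DirLine

/-- A nondegenerate triangle as a subset of the plane (the closed triangle). -/
def triangleSet (t : Affine.Triangle ℝ Plane) : Set Plane := convexHull ℝ (Set.range t.points)

/-- The axis-parallel rectangle with lower left corner `lo` and upper right corner `hi`. -/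
def box (lo hi : Plane) : Set Plane := {x | ∀ k, lo k ≤ x k ∧ x k ≤ hi k}

/-! ### Space decomposition trees -/

/-- A rooted binary tree whose inner nodes carry directed lines;
`node l u w` has left child `u` and right child `w`. -/
inductive LineTree : Type
  | leaf : LineTree
  | node (l : DirLine) (u w : LineTree) : LineTree

/-- `d_R`: the number of disks that intersect the region `R`. -/
def diskCount {n : ℕ} (c : Fin n → Plane) (R : Set Plane) : ℕ :=
  Set.ncard {i : Fin n | (unitDisk (c i) ∩ R).Nonempty}

/-- The number of disks that intersect the region `R` and that are intersected by the line `l`. -/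
def crossCount {n : ℕ} (c : Fin n → Plane) (R : Set Plane) (l : DirLine) : ℕ :=
  Set.ncard {i : Fin n | (unitDisk (c i) ∩ R).Nonempty ∧ (unitDisk (c i) ∩ l.carrier).Nonempty}

/-- The tree, with the region `R` at its root (and `R_v ∩ l_v.left`, `R_v ∩ l_v.right` at the left
and right child of a node with region `R_v` and line `l_v`), is an `(α, β)`-space decomposition
tree whose leaf regions intersect at most `K` disks each. -/
def IsSDTFrom {n : ℕ} (α β : ℝ) (K : ℕ) (c : Fin n → Plane) : LineTree → Set Plane → Prop
  | .leaf, R => diskCount c R ≤ K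
  | .node l u w, R =>
      (crossCount c R l : ℝ) ≤ (diskCount c R : ℝ) ^ β ∧
      (diskCount c (R ∩ l.left) : ℝ) ≤ α * diskCount c R ∧
      (diskCount c (R ∩ l.right) : ℝ) ≤ α * diskCount c R ∧
      IsSDTFrom α β K c u (R ∩ l.left) ∧
      IsSDTFrom α β K c w (R ∩ l.right)

/-- An `(α, β)`-space decomposition tree for the unit disks with centers `c`: the root corresponds
to the whole plane, and each leaf region intersects at most `K` disks. -/
def IsSDT {n : ℕ} (α β : ℝ) (K : ℕ) (c : Fin n → Plane) (T : LineTree) : Prop :=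
  IsSDTFrom α β K c T Set.univ

/-- The regions of the leaves, when the region of the root is `R`. -/
def leafRegionsFrom : LineTree → Set Plane → Set (Set Plane)
  | .leaf, R => {R}
  | .node l u w, R => leafRegionsFrom u (R ∩ l.left) ∪ leafRegionsFrom w (R ∩ l.right)

/-- The leaf regions of a tree whose root corresponds to the whole plane. -/
def leafRegions (T : LineTree) : Set (Set Plane) := leafRegionsFrom T Set.univ

/-- For each disk, `TD i` is a list of triangles covering the leaf regions of `T` that intersect
disk `i`. Some leaf regions are unbounded, so covering takes place inside a bounding box that
contains all disks and all bounded leaf regions. Each triangle of the list lies inside the box and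
inside a single leaf region that intersects the disk. -/
def IsTriangleCover {n : ℕ} (c : Fin n → Plane) (T : LineTree)
    (TD : Fin n → List (Affine.Triangle ℝ Plane)) : Prop :=
  ∃ lo hi : Plane,
    (∀ i, unitDisk (c i) ⊆ box lo hi) ∧
    (∀ R ∈ leafRegions T, Bornology.IsBounded R → R ⊆ box lo hi) ∧
    ∀ i,
      (∀ t ∈ TD i, ∃ R ∈ leafRegions T,
        (unitDisk (c i) ∩ R).Nonempty ∧ triangleSet t ⊆ R ∩ box lo hi) ∧
      (∀ R ∈ leafRegions T, (unitDisk (c i) ∩ R).Nonempty →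
        R ∩ box lo hi ⊆ ⋃ t ∈ TD i, triangleSet t)

/-! ### Randomized algorithms over the reals and their running time

Programs are finite systems of mutually recursive first-order functions. The data are real numbers
and linked structures built from an empty cell and immutable cells with two fields (a cell is
referenced, never copied). The elementary steps are: access to a local variable, a rational
constant, one of the four arithmetic operations on reals, one comparison of two reals, creation of
a cell, test for the empty cell / access to the two fields, local definition, function call, and
one fair coin toss. There is no rounding operation. Each elementary step has unit cost. As the
number of local variables is bounded by the size of the program, a real RAM carries out each
step in constant time. -/

/-- Data: a real number, the empty cell, or a cell with two fields. -/
inductive Val : Type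
  | num (x : ℝ) : Val
  | nil : Val
  | pair (a b : Val) : Val

/-- The arithmetic operations. -/
inductive ArithOp : Type
  | add | sub | mul | div

/-- The value of an arithmetic operation. -/
def ArithOp.app : ArithOp → ℝ → ℝ → ℝ
  | .add, x, y => x + y
  | .sub, x, y => x - y
  | .mul, x, y => x * y
  | .div, x, y => x / y

/-- Expressions. Local variables are addressed by their position in the list of values in scope,
the most recent one first. -/
inductive Expr : Type
  | var (k : ℕ) : Expr
  | const (q : ℚ) : Expr
  | arith (op : ArithOp) (e₁ e₂ : Expr) : Expr
  | ifLt (e₁ e₂ e₃ e₄ : Expr) : Expr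
  | nil : Expr
  | pair (e₁ e₂ : Expr) : Expr
  | split (e e₁ e₂ : Expr) : Expr
  | letIn (e₁ e₂ : Expr) : Expr
  | call (f : ℕ) (e : Expr) : Expr
  | flip (e₁ e₂ : Expr) : Expr

/-- A program is the finite list of its function bodies. Each function has one argument (the only
variable in scope in its body). Function `0` is the main function. -/
abbrev Program : Type := List Expr

/-- `Runs P ω env e s v s' t`: with the values `env` in scope, the expression `e` evaluates to `v`
in exactly `t` elementary steps, where `ω` is the sequence of results of the coin tosses, `s` tosses
were made before and `s'` tosses were made afterwards. A step that is not defined (such as a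
division by zero) has no evaluation. -/
inductive Runs (P : Program) (ω : ℕ → Bool) :
    List Val → Expr → ℕ → Val → ℕ → ℕ → Prop
  | var {env : List Val} {k s : ℕ} {v : Val} (h : env[k]? = some v) :
      Runs P ω env (.var k) s v s 1
  | const {env : List Val} {q : ℚ} {s : ℕ} :
      Runs P ω env (.const q) s (.num (q : ℝ)) s 1
  | arith {env : List Val} {op : ArithOp} {e₁ e₂ : Expr} {x y : ℝ} {s s₁ s₂ t₁ t₂ : ℕ}
      (h₁ : Runs P ω env e₁ s (.num x) s₁ t₁) (h₂ : Runs P ω env e₂ s₁ (.num y) s₂ t₂)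
      (hdiv : op = .div → y ≠ 0) :
      Runs P ω env (.arith op e₁ e₂) s (.num (op.app x y)) s₂ (t₁ + t₂ + 1)
  | ifLt_true {env : List Val} {e₁ e₂ e₃ e₄ : Expr} {x y : ℝ} {v : Val}
      {s s₁ s₂ s₃ t₁ t₂ t₃ : ℕ}
      (h₁ : Runs P ω env e₁ s (.num x) s₁ t₁) (h₂ : Runs P ω env e₂ s₁ (.num y) s₂ t₂)
      (hlt : x < y) (h₃ : Runs P ω env e₃ s₂ v s₃ t₃) :
      Runs P ω env (.ifLt e₁ e₂ e₃ e₄) s v s₃ (t₁ + t₂ + t₃ + 1)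
  | ifLt_false {env : List Val} {e₁ e₂ e₃ e₄ : Expr} {x y : ℝ} {v : Val}
      {s s₁ s₂ s₃ t₁ t₂ t₃ : ℕ}
      (h₁ : Runs P ω env e₁ s (.num x) s₁ t₁) (h₂ : Runs P ω env e₂ s₁ (.num y) s₂ t₂)
      (hle : y ≤ x) (h₃ : Runs P ω env e₄ s₂ v s₃ t₃) :
      Runs P ω env (.ifLt e₁ e₂ e₃ e₄) s v s₃ (t₁ + t₂ + t₃ + 1)
  | nil {env : List Val} {s : ℕ} :
      Runs P ω env .nil s .nil s 1
  | pair {env : List Val} {e₁ e₂ : Expr} {a b : Val} {s s₁ s₂ t₁ t₂ : ℕ}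
      (h₁ : Runs P ω env e₁ s a s₁ t₁) (h₂ : Runs P ω env e₂ s₁ b s₂ t₂) :
      Runs P ω env (.pair e₁ e₂) s (.pair a b) s₂ (t₁ + t₂ + 1)
  | split_nil {env : List Val} {e e₁ e₂ : Expr} {v : Val} {s s₁ s₂ t₁ t₂ : ℕ}
      (h₁ : Runs P ω env e s .nil s₁ t₁) (h₂ : Runs P ω env e₁ s₁ v s₂ t₂) :
      Runs P ω env (.split e e₁ e₂) s v s₂ (t₁ + t₂ + 1)
  | split_pair {env : List Val} {e e₁ e₂ : Expr} {a b v : Val} {s s₁ s₂ t₁ t₂ : ℕ}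
      (h₁ : Runs P ω env e s (.pair a b) s₁ t₁)
      (h₂ : Runs P ω (a :: b :: env) e₂ s₁ v s₂ t₂) :
      Runs P ω env (.split e e₁ e₂) s v s₂ (t₁ + t₂ + 1)
  | letIn {env : List Val} {e₁ e₂ : Expr} {a v : Val} {s s₁ s₂ t₁ t₂ : ℕ}
      (h₁ : Runs P ω env e₁ s a s₁ t₁) (h₂ : Runs P ω (a :: env) e₂ s₁ v s₂ t₂) :
      Runs P ω env (.letIn e₁ e₂) s v s₂ (t₁ + t₂ + 1)
  | call {env : List Val} {f : ℕ} {e body : Expr} {a v : Val} {s s₁ s₂ t₁ t₂ : ℕ}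
      (h₁ : Runs P ω env e s a s₁ t₁) (hf : P[f]? = some body)
      (h₂ : Runs P ω [a] body s₁ v s₂ t₂) :
      Runs P ω env (.call f e) s v s₂ (t₁ + t₂ + 1)
  | flip_true {env : List Val} {e₁ e₂ : Expr} {v : Val} {s s₁ t : ℕ}
      (hω : ω s = true) (h : Runs P ω env e₁ (s + 1) v s₁ t) :
      Runs P ω env (.flip e₁ e₂) s v s₁ (t + 1)
  | flip_false {env : List Val} {e₁ e₂ : Expr} {v : Val} {s s₁ t : ℕ}
      (hω : ω s = false) (h : Runs P ω env e₂ (s + 1) v s₁ t) :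
      Runs P ω env (.flip e₁ e₂) s v s₁ (t + 1)

/-- An evaluation has at most one outcome. -/
theorem Runs.unique {P : Program} {ω : ℕ → Bool} {env : List Val} {e : Expr} {s : ℕ}
    {v : Val} {s₁ t : ℕ} (h : Runs P ω env e s v s₁ t) :
    ∀ {v' : Val} {s₁' t' : ℕ}, Runs P ω env e s v' s₁' t' → v = v' ∧ s₁ = s₁' ∧ t = t' := by
  induction h with
  | var h => intro _ _ _ h'; cases h'; simp_all
  | const => intro _ _ _ h'; cases h'; simp
  | nil => intro _ _ _ h'; cases h'; simp
  | arith _ _ _ i₁ i₂ =>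
    intro _ _ _ h'; cases h' with
    | arith a b _ => 
      obtain ⟨e, rfl, rfl⟩ := i₁ a
      obtain ⟨e', rfl, rfl⟩ := i₂ b
      simp_all
  | ifLt_true _ _ hl _ i₁ i₂ i₃ =>
    intro _ _ _ h'; cases h' with
    | ifLt_true a b _ d =>
      obtain ⟨e, rfl, rfl⟩ := i₁ a
      obtain ⟨e', rfl, rfl⟩ := i₂ b
      obtain ⟨rfl, rfl, rfl⟩ := i₃ d
      simp
    | ifLt_false a b hle d =>
      obtain ⟨e, rfl, rfl⟩ := i₁ a
      obtain ⟨e', rfl, rfl⟩ := i₂ b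
      cases e; cases e'
      exact absurd hl (not_lt.2 hle)
  | ifLt_false _ _ hl _ i₁ i₂ i₃ =>
    intro _ _ _ h'; cases h' with
    | ifLt_false a b _ d =>
      obtain ⟨e, rfl, rfl⟩ := i₁ a
      obtain ⟨e', rfl, rfl⟩ := i₂ b
      obtain ⟨rfl, rfl, rfl⟩ := i₃ d
      simp
    | ifLt_true a b hlt d =>
      obtain ⟨e, rfl, rfl⟩ := i₁ a
      obtain ⟨e', rfl, rfl⟩ := i₂ b
      cases e; cases e'
      exact absurd hlt (not_lt.2 hl)
  | pair _ _ i₁ i₂ =>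
    intro _ _ _ h'; cases h' with
    | pair a b =>
      obtain ⟨rfl, rfl, rfl⟩ := i₁ a
      obtain ⟨rfl, rfl, rfl⟩ := i₂ b
      simp
  | split_nil _ _ i₁ i₂ =>
    intro _ _ _ h'; cases h' with
    | split_nil a b =>
      obtain ⟨_, rfl, rfl⟩ := i₁ a
      obtain ⟨rfl, rfl, rfl⟩ := i₂ b
      simp
    | split_pair a b => cases (i₁ a).1
  | split_pair _ _ i₁ i₂ =>
    intro _ _ _ h'; cases h' with
    | split_pair a b =>
      obtain ⟨e, rfl, rfl⟩ := i₁ a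
      cases e
      obtain ⟨rfl, rfl, rfl⟩ := i₂ b
      simp
    | split_nil a b => cases (i₁ a).1
  | letIn _ _ i₁ i₂ =>
    intro _ _ _ h'; cases h' with
    | letIn a b =>
      obtain ⟨rfl, rfl, rfl⟩ := i₁ a
      obtain ⟨rfl, rfl, rfl⟩ := i₂ b
      simp
  | call _ hf _ i₁ i₂ =>
    intro _ _ _ h'; cases h' with
    | call a hf' b =>
      obtain ⟨rfl, rfl, rfl⟩ := i₁ a
      rw [hf] at hf'
      cases hf'
      obtain ⟨rfl, rfl, rfl⟩ := i₂ b
      simp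
  | flip_true hω _ i =>
    intro _ _ _ h'; cases h' with
    | flip_true _ b =>
      obtain ⟨rfl, rfl, rfl⟩ := i b
      simp
    | flip_false hω' b => simp_all
  | flip_false hω _ i =>
    intro _ _ _ h'; cases h' with
    | flip_false _ b =>
      obtain ⟨rfl, rfl, rfl⟩ := i b
      simp
    | flip_true hω' b => simp_all

/-- Started on the input `x`, and with coin tosses `ω`, the program `P` halts with output `v` after
`t` steps. -/
def Halts (P : Program) (x : Val) (ω : ℕ → Bool) (v : Val) (t : ℕ) : Prop :=
  ∃ s : ℕ, Runs P ω [x] (.call 0 (.var 0)) 0 v s t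

/-- The running time of `P` on the input `x` with coin tosses `ω`; it is `∞` if `P` does not
halt. -/
def runTime (P : Program) (x : Val) (ω : ℕ → Bool) : ℝ≥0∞ :=
  ⨅ (v : Val) (t : ℕ) (_ : Halts P x ω v t), (t : ℝ≥0∞)

/-- The law of a sequence of independent fair coin tosses. -/
def coinMeasure : Measure (ℕ → Bool) :=
  Measure.infinitePi fun _ : ℕ => (PMF.uniformOfFintype Bool).toMeasure

/-- The expected running time of `P` on the input `x`. -/
def expectedTime (P : Program) (x : Val) : ℝ≥0∞ := ∫⁻ ω, runTime P x ω ∂coinMeasure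

/-! ### Representation of the input and of the output -/

/-- A linked list. -/
def encList : List Val → Val
  | [] => .nil
  | v :: l => .pair v (encList l)

/-- A point is given by its two coordinates. -/
def encPoint (p : Plane) : Val := .pair (.num (p 0)) (.num (p 1))

/-- A directed line is given by a point and a direction. -/
def encLine (l : DirLine) : Val := .pair (encPoint l.point) (encPoint l.dir)

/-- A tree is stored with its lines and its children. -/
def encTree : LineTree → Val
  | .leaf => .nil
  | .node l u w => .pair (encLine l) (.pair (encTree u) (encTree w))

/-- A triangle is given by its three vertices. -/
def encTriangle (t : Affine.Triangle ℝ Plane) : Val :=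
  .pair (encPoint (t.points 0)) (.pair (encPoint (t.points 1)) (encPoint (t.points 2)))

/-- The input: the list of the centers of the disks. -/
def encInput {n : ℕ} (c : Fin n → Plane) : Val :=
  encList (List.ofFn fun i => encPoint (c i))

/-- The output: the tree, together with the list that holds for each disk (in the order of the
input) its list of triangles. -/
def encOutput {n : ℕ} (T : LineTree) (TD : Fin n → List (Affine.Triangle ℝ Plane)) : Val :=
  .pair (encTree T) (encList (List.ofFn fun i => encList ((TD i).map encTriangle)))

end OnionSDT

end

/-! The program tosses no coins, so its expected time is a worst-case time. Fix `q ≥ 2` with `1/(2q)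
≤ ε`, and use only lines on which `x + j y` is constant, for the `k = 4q` slopes `j < k`. For each
slope the disks of a node are kept sorted by the key `x + j y` of their centers. At a node with `d`
disks let `m` be the integer part of `d^(1/2 + 1/(2q))`. Among the positions between `(1/2 - 1/(2q))
d` and `(1/2 + 1/(2q)) d` the program seeks two disks that are `m` positions apart and whose keys
differ by more than `2(1 + j)`. A unit disk extends at most `1 + j` to either side of its key, so
the line midway misses both disks, crosses at most `m - 1` others, and leaves at most `(1/2 +
1/(2q)) d` disks on each side (`IsState.counts`).

Such a gap exists for large `d` (`exists_isGap`). Otherwise every slope has a strip of width at most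
`2kB`, with `B` of order `d/(qm)`, that holds at least `d/(2q)` centers. Strips of different slopes
meet in a parallelogram, which has room for only `O(B²)` disjoint unit disks when `q` is fixed. The
`4q` strips count `2d` centers with multiplicity although there are only `d`, so the overlaps force
`d = O(B²)`. Since `Bm ≤ d`, this gives `m² = O(d)`, which is false for large `d`.

Inside a large square, the region of a node is an intersection of one band per slope. Clipping two
triangles of the square by these bands triangulates it with at most `2 · 64^k` triangles,
independently of the depth (`cover_regionTris`, `IsState.child`). The disks that meet a child are
found by testing them against its triangles; filtering preserves the sorted orders, so sorting
happens only once per slope.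

If the children have `x` and `y` disks, then `x, y ≤ α d` with `α = 1/2 + 1/(2q)`, and `x + y ≤ d +
m`. Hence a potential of order `d log d` drops by an amount linear in `d`, because `m log d` is
small against `d` above the leaf constant (`mul_log_add_mul_log_le`, `exists_isLeafBound`). This
pays for the construction (`fn_build`), and the same recurrence bounds the number of nodes that are
visited when each disk descends through the regions it meets to collect triangles.

A bounded leaf region is the closed convex hull of its extreme points. Each extreme point lies on
two tree lines of different slopes, and their offsets are bounded by the keys of the disks, so a
square of size computed beforehand contains all bounded leaf regions (`cutRegion_subset_square`). -/

noncomputable section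

namespace OnionSDT

/-! ### Deterministic evaluation with a bound on the number of steps -/

/-- `e` evaluates to `v` without coin tosses, in at most `t` steps. -/
def Ev (P : Program) (env : List Val) (e : Expr) (v : Val) (t : ℝ) : Prop :=
  -- The step number is chosen before the coin sequence and the toss counter; this is what later
  -- turns expected time into a single number of steps.
  ∃ t' : ℕ, (t' : ℝ) ≤ t ∧ ∀ ω s, Runs P ω env e s v s t'

/-- The function `f` of the program maps `a` to `v` in at most `t` steps. -/
def Fn (P : Program) (f : ℕ) (a v : Val) (t : ℝ) : Prop :=
  ∃ body, P[f]? = some body ∧ Ev P [a] body v t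

/-! ### Evaluation rules with step bounds. -/

section Rules

variable {P : Program} {env : List Val} {e e₁ e₂ e₃ e₄ : Expr} {v a b : Val} {x y t t₁ t₂ t₃ : ℝ}

theorem Ev.mono (h : Ev P env e v t₁) (ht : t₁ ≤ t) : Ev P env e v t := by
  obtain ⟨t', h1, h2⟩ := h
  exact ⟨t', h1.trans ht, h2⟩

theorem Fn.mono {f : ℕ} (h : Fn P f a v t₁) (ht : t₁ ≤ t) : Fn P f a v t := by
  obtain ⟨body, h1, h2⟩ := h
  exact ⟨body, h1, h2.mono ht⟩

theorem Ev.var {k : ℕ} (h : env[k]? = some v) : Ev P env (.var k) v 1 :=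
  ⟨1, by simp, fun _ _ => .var h⟩

theorem Ev.const {q : ℚ} : Ev P env (.const q) (.num q) 1 :=
  ⟨1, by simp, fun _ _ => .const⟩

theorem Ev.nil : Ev P env .nil .nil 1 :=
  ⟨1, by simp, fun _ _ => .nil⟩

theorem Ev.arith {op : ArithOp} (h₁ : Ev P env e₁ (.num x) t₁) (h₂ : Ev P env e₂ (.num y) t₂)
    (hdiv : op = .div → y ≠ 0) :
    Ev P env (.arith op e₁ e₂) (.num (op.app x y)) (t₁ + t₂ + 1) := by
  obtain ⟨a, ha, ha'⟩ := h₁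
  obtain ⟨b, hb, hb'⟩ := h₂
  exact ⟨a + b + 1, by push_cast; linarith, fun ω s => .arith (ha' ω s) (hb' ω s) hdiv⟩

theorem Ev.add (h₁ : Ev P env e₁ (.num x) t₁) (h₂ : Ev P env e₂ (.num y) t₂) :
    Ev P env (.arith .add e₁ e₂) (.num (x + y)) (t₁ + t₂ + 1) :=
  Ev.arith h₁ h₂ (by simp)

theorem Ev.mul (h₁ : Ev P env e₁ (.num x) t₁) (h₂ : Ev P env e₂ (.num y) t₂) :
    Ev P env (.arith .mul e₁ e₂) (.num (x * y)) (t₁ + t₂ + 1) :=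
  Ev.arith h₁ h₂ (by simp)

theorem Ev.pair (h₁ : Ev P env e₁ a t₁) (h₂ : Ev P env e₂ b t₂) :
    Ev P env (.pair e₁ e₂) (.pair a b) (t₁ + t₂ + 1) := by
  obtain ⟨a, ha, ha'⟩ := h₁
  obtain ⟨b, hb, hb'⟩ := h₂
  exact ⟨a + b + 1, by push_cast; linarith, fun ω s => .pair (ha' ω s) (hb' ω s)⟩

theorem Ev.letIn (h₁ : Ev P env e₁ a t₁) (h₂ : Ev P (a :: env) e₂ v t₂) :
    Ev P env (.letIn e₁ e₂) v (t₁ + t₂ + 1) := by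
  obtain ⟨a, ha, ha'⟩ := h₁
  obtain ⟨b, hb, hb'⟩ := h₂
  exact ⟨a + b + 1, by push_cast; linarith, fun ω s => .letIn (ha' ω s) (hb' ω s)⟩

theorem Ev.split_nil (h₁ : Ev P env e .nil t₁) (h₂ : Ev P env e₁ v t₂) :
    Ev P env (.split e e₁ e₂) v (t₁ + t₂ + 1) := by
  obtain ⟨a, ha, ha'⟩ := h₁
  obtain ⟨b, hb, hb'⟩ := h₂
  exact ⟨a + b + 1, by push_cast; linarith, fun ω s => .split_nil (ha' ω s) (hb' ω s)⟩

theorem Ev.split_pair (h₁ : Ev P env e (.pair a b) t₁) (h₂ : Ev P (a :: b :: env) e₂ v t₂) :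
    Ev P env (.split e e₁ e₂) v (t₁ + t₂ + 1) := by
  obtain ⟨a, ha, ha'⟩ := h₁
  obtain ⟨b, hb, hb'⟩ := h₂
  exact ⟨a + b + 1, by push_cast; linarith, fun ω s => .split_pair (ha' ω s) (hb' ω s)⟩

/-- Destructuring a variable that holds a cell. -/
theorem Ev.open {k : ℕ} (h : env[k]? = some (.pair a b)) (h₂ : Ev P (a :: b :: env) e₂ v t) :
    Ev P env (.split (.var k) e₁ e₂) v (t + 2) :=
  (Ev.split_pair (.var h) h₂).mono (by linarith)

/-- Destructuring a variable that holds the empty cell. -/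
theorem Ev.empty {k : ℕ} (h : env[k]? = some .nil) (h₂ : Ev P env e₁ v t) :
    Ev P env (.split (.var k) e₁ e₂) v (t + 2) :=
  (Ev.split_nil (.var h) h₂).mono (by linarith)

theorem Ev.ifLt_true (h₁ : Ev P env e₁ (.num x) t₁) (h₂ : Ev P env e₂ (.num y) t₂) (hlt : x < y)
    (h₃ : Ev P env e₃ v t₃) : Ev P env (.ifLt e₁ e₂ e₃ e₄) v (t₁ + t₂ + t₃ + 1) := by
  obtain ⟨a, ha, ha'⟩ := h₁
  obtain ⟨b, hb, hb'⟩ := h₂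
  obtain ⟨c, hc, hc'⟩ := h₃
  exact ⟨a + b + c + 1, by push_cast; linarith,
    fun ω s => .ifLt_true (ha' ω s) (hb' ω s) hlt (hc' ω s)⟩

theorem Ev.ifLt_false (h₁ : Ev P env e₁ (.num x) t₁) (h₂ : Ev P env e₂ (.num y) t₂) (hle : y ≤ x)
    (h₃ : Ev P env e₄ v t₃) : Ev P env (.ifLt e₁ e₂ e₃ e₄) v (t₁ + t₂ + t₃ + 1) := by
  obtain ⟨a, ha, ha'⟩ := h₁
  obtain ⟨b, hb, hb'⟩ := h₂
  obtain ⟨c, hc, hc'⟩ := h₃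
  exact ⟨a + b + c + 1, by push_cast; linarith,
    fun ω s => .ifLt_false (ha' ω s) (hb' ω s) hle (hc' ω s)⟩

/-- Both branches share one budget, so a conditional can be bounded before its outcome is known,
while each branch may use the comparison. -/
theorem Ev.ifLt (h₁ : Ev P env e₁ (.num x) t₁) (h₂ : Ev P env e₂ (.num y) t₂)
    (h₃ : x < y → Ev P env e₃ v t₃) (h₄ : y ≤ x → Ev P env e₄ v t₃) :
    Ev P env (.ifLt e₁ e₂ e₃ e₄) v (t₁ + t₂ + t₃ + 1) := by
  rcases lt_or_ge x y with h | h
  · exact Ev.ifLt_true h₁ h₂ h (h₃ h)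
  · exact Ev.ifLt_false h₁ h₂ h (h₄ h)

theorem Ev.call {f : ℕ} (h₁ : Ev P env e a t₁) (h₂ : Fn P f a v t₂) :
    Ev P env (.call f e) v (t₁ + t₂ + 1) := by
  obtain ⟨a, ha, ha'⟩ := h₁
  obtain ⟨body, hf, b, hb, hb'⟩ := h₂
  exact ⟨a + b + 1, by push_cast; linarith, fun ω s => .call (ha' ω s) hf (hb' ω s)⟩

end Rules

/-! ### Arithmetic expressions evaluated by computation. -/

/-- Evaluation of arithmetic expressions without divisions. -/
def arithEval (env : List Val) : Expr → Option ℝ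
  | .var k => match env[k]? with
    | some (.num x) => some x
    | _ => none
  | .const q => some q
  | .arith .add e₁ e₂ => match arithEval env e₁, arithEval env e₂ with
    | some x, some y => some (x + y)
    | _, _ => none
  | .arith .sub e₁ e₂ => match arithEval env e₁, arithEval env e₂ with
    | some x, some y => some (x - y)
    | _, _ => none
  | .arith .mul e₁ e₂ => match arithEval env e₁, arithEval env e₂ with
    | some x, some y => some (x * y)
    | _, _ => none
  | _ => none

/-- The number of steps for an arithmetic expression. -/
def arithCost : Expr → ℕ
  | .arith _ e₁ e₂ => arithCost e₁ + arithCost e₂ + 1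
  | _ => 1

/-- Reflection: on a concrete environment `arithEval` reduces definitionally, so arithmetic steps of
the program are mostly discharged by `.num _ rfl rfl`. -/
theorem Ev.of_arithEval {P : Program} {env : List Val} (e : Expr) :
    ∀ {x : ℝ}, arithEval env e = some x → Ev P env e (.num x) (arithCost e) := by
  induction e with
  | var k =>
    intro x h
    simp only [arithEval] at h
    split at h
    · rename_i h'
      cases h
      simpa [arithCost] using Ev.var h'
    · cases h
  | const q =>
    intro x h
    simp only [arithEval, Option.some.injEq] at h
    subst h
    simpa [arithCost] using Ev.const
  | arith op e₁ e₂ i₁ i₂ =>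
    intro x h
    cases op <;> simp only [arithEval] at h
    all_goals try cases h
    all_goals
      split at h
      · rename_i x' y' h1 h2
        cases h
        exact (Ev.arith (i₁ h1) (i₂ h2) (by simp)).mono (by simp [arithCost])
      · cases h
  | _ => intro x h; simp [arithEval] at h

/-- An arithmetic expression with a prescribed value and a numeric bound on its steps. -/
theorem Ev.num {P : Program} {env : List Val} {e : Expr} {x : ℝ} (y : ℝ)
    (h : arithEval env e = some y) (hxy : y = x) : Ev P env e (.num x) (arithCost e) :=
  hxy ▸ Ev.of_arithEval e h

/-- The expression for a power. -/
def powExpr (e : Expr) : ℕ → Expr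
  | 0 => .const 1
  | n + 1 => .arith .mul (powExpr e n) e

theorem Ev.pow {P : Program} {env : List Val} {e : Expr} {x t : ℝ} (h : Ev P env e (.num x) t) :
    ∀ n : ℕ, Ev P env (powExpr e n) (.num (x ^ n)) (n * (t + 1) + 1)
  | 0 => by simpa [powExpr] using (Ev.const (P := P) (env := env) (q := 1))
  | n + 1 => by
    have := Ev.mul (Ev.pow h n) h
    rw [← pow_succ] at this
    exact this.mono (by push_cast; linarith)


/-! ### The program -/

/-- A rational constant. -/
abbrev cst (q : ℚ) : Expr := .const q

abbrev Expr.add (a b : Expr) : Expr := .arith .add a b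
abbrev Expr.sub (a b : Expr) : Expr := .arith .sub a b
abbrev Expr.mul (a b : Expr) : Expr := .arith .mul a b
abbrev Expr.div (a b : Expr) : Expr := .arith .div a b

/-- The numbers are positions in the list `prog`; the `rfl` that opens each proof about a function
checks the agreement. -/
abbrev fMain := 0
abbrev fSplit := 1
abbrev fMerge := 2
abbrev fSort := 3
abbrev fKeys := 4
abbrev fSum := 5
abbrev fInit := 6
abbrev fLen := 7
abbrev fRoot := 8
abbrev fDrop := 9
abbrev fFind := 10
abbrev fChoose := 11
abbrev fSide := 12
abbrev fLerp := 13
abbrev fStage := 14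
abbrev fKeep := 15
abbrev fClip := 16
abbrev fRegion := 17
abbrev fCross := 18
abbrev fNear := 19
abbrev fTri := 20
abbrev fHit := 21
abbrev fFilter := 22
abbrev fFilterDirs := 23
abbrev fBox := 24
abbrev fChild := 25
abbrev fBuild := 26
abbrev fAppend := 27
abbrev fQuery := 28
abbrev fAnswers := 29

/-- Distributes a list alternately to two lists. -/
def bodySplit : Expr :=
  .split (.var 0) (.pair .nil .nil)
    (.split (.call fSplit (.var 1)) .nil (.pair (.pair (.var 2) (.var 1)) (.var 0)))

/-- Merges two lists that are sorted by the first fields of their elements. -/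
def bodyMerge : Expr :=
  .split (.var 0) .nil <| .split (.var 0) (.var 1) <| .split (.var 3) (.var 2) <|
    .split (.var 2) .nil <| .split (.var 2) .nil <|
      .ifLt (.var 0) (.var 2)
        (.pair (.var 4) (.call fMerge (.pair (.var 8) (.var 5))))
        (.pair (.var 6) (.call fMerge (.pair (.var 7) (.var 9))))

/-- Sorts a list by the first fields of its elements. -/
def bodySort : Expr :=
  .split (.var 0) .nil <| .split (.var 1) (.var 2) <|
    .split (.call fSplit (.var 4)) .nil <|
      .call fMerge (.pair (.call fSort (.var 0)) (.call fSort (.var 1)))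

/-- Attaches to each point `(x, y)` of a list the key `x + j * y`. -/
def bodyKeys : Expr :=
  .split (.var 0) .nil <| .split (.var 1) .nil <| .split (.var 0) .nil <|
    .pair (.pair (.add (.var 0) (.mul (.var 4) (.var 1))) (.var 2))
      (.call fKeys (.pair (.var 4) (.var 3)))

/-- One plus the sum of the squares of the coordinates of the points of a list. -/
def bodySum : Expr :=
  .split (.var 0) (cst 1) <| .split (.var 0) .nil <|
    .add (.add (.mul (.var 0) (.var 0)) (.mul (.var 1) (.var 1))) (.call fSum (.var 3))

/-- The initial bands: for each slope a trivial band and the sorted list of the disks. -/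
def bodyInit (k : ℕ) : Expr :=
  .split (.var 0) .nil <| .split (.var 1) .nil <|
    .ifLt (.var 2) (cst k)
      (.pair
        (.pair (.var 2) (.pair (.sub (cst 0) (.var 0)) (.pair (.var 0)
          (.call fSort (.call fKeys (.pair (.var 2) (.var 1)))))))
        (.call fInit (.pair (.add (.var 2) (cst 1)) (.pair (.var 0) (.var 1)))))
      .nil

def bodyLen : Expr :=
  .split (.var 0) (cst 0) (.add (cst 1) (.call fLen (.var 1)))

/-- The largest `r` with `r ^ (2 * q) ≤ d ^ (q + 1)`. -/
def bodyRoot (q : ℕ) : Expr :=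
  .split (.var 0) .nil <|
    .ifLt (powExpr (.var 0) (q + 1)) (powExpr (.add (.var 1) (cst 1)) (2 * q)) (.var 1)
      (.call fRoot (.pair (.var 0) (.add (.var 1) (cst 1))))

/-- Drops the first `⌈r⌉` elements of a list. -/
def bodyDrop : Expr :=
  .split (.var 0) .nil <|
    .ifLt (cst 0) (.var 0)
      (.split (.var 1) .nil (.call fDrop (.pair (.sub (.var 2) (cst 1)) (.var 1))))
      (.var 1)

/-- Walks simultaneously through two lists in search of keys whose difference exceeds `w`. -/
def bodyFind : Expr :=
  .split (.var 0) .nil <| .split (.var 1) .nil <| .split (.var 1) .nil <|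
    .ifLt (.var 2) (cst 0) .nil <|
      .split (.var 0) .nil <| .split (.var 3) .nil <|
      .split (.var 2) .nil <| .split (.var 2) .nil <|
        .ifLt (.var 12) (.sub (.var 0) (.var 2))
          (.pair (.mul (cst (1 / 2)) (.add (.var 0) (.var 2))) .nil)
          (.call fFind (.pair (.var 12) (.pair (.sub (.var 10) (cst 1)) (.pair (.var 7) (.var 5)))))

/-- Finds the splitting line and the bands of the two children. -/
def bodyChoose (q : ℕ) : Expr :=
  .split (.var 0) .nil <| .split (.var 1) .nil <| .split (.var 1) .nil <|
    .split (.var 0) .nil <| .split (.var 1) .nil <| .split (.var 1) .nil <|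
      -- Start of the middle range of positions; variable `10` holds the number of disks.
      .letIn (.call fDrop (.pair (.mul (cst (1 / 2 - 1 / (2 * q))) (.var 10)) (.var 1))) <|
      -- The threshold is twice the bound `1 + j` on the deviation of a disk from its key. Both
      -- lists that are walked are the remaining disks, the second shifted by `m`.
      .letIn (.call fFind (.pair (.mul (cst 2) (.add (cst 1) (.var 5)))
        (.pair (.sub (.sub (.mul (cst (1 / q)) (.var 11)) (.var 9)) (cst 1))
          (.pair (.var 0) (.call fDrop (.pair (.var 9) (.var 0))))))) <|
      .split (.var 0)
        (.split (.call fChoose (.pair (.var 12) (.pair (.var 10) (.var 9)))) .nil <|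
          .split (.var 1) .nil <|
            .pair (.var 2) (.pair (.pair (.var 12) (.var 0)) (.pair (.var 12) (.var 1))))
        (.pair (.pair (.pair (.var 0) (cst 0)) (.pair (.var 8) (cst (-1))))
          (.pair (.pair (.pair (.var 8) (.pair (.var 0) (.pair (.var 4) (.var 5)))) (.var 11))
            (.pair (.pair (.var 8) (.pair (.var 6) (.pair (.var 0) (.var 5)))) (.var 11))))

/-- The value at a point of an affine function with given coefficients. -/
def bodySide : Expr :=
  .split (.var 0) .nil <| .split (.var 0) .nil <| .split (.var 1) .nil <| .split (.var 5) .nil <|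
    .add (.add (.mul (.var 4) (.var 0)) (.mul (.var 2) (.var 1))) (.var 3)

/-- The affine combination `a + s * (b - a)`. -/
def bodyLerp : Expr :=
  .split (.var 0) .nil <| .split (.var 1) .nil <| .split (.var 0) .nil <| .split (.var 3) .nil <|
    .pair (.add (.var 2) (.mul (.var 6) (.sub (.var 0) (.var 2))))
      (.add (.var 3) (.mul (.var 6) (.sub (.var 1) (.var 3))))

/-- Cuts the first edge of each triangle and rotates the triangles. -/
def bodyStage : Expr :=
  .split (.var 0) .nil <| .split (.var 1) .nil <| .split (.var 0) .nil <| .split (.var 1) .nil <|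
    .letIn (.call fSide (.pair (.var 6) (.var 2))) <|
    .letIn (.call fSide (.pair (.var 7) (.var 1))) <|
    .letIn (.call fStage (.pair (.var 8) (.var 7))) <|
    .ifLt (.mul (.var 2) (.var 1)) (cst 0)
      (.letIn (.call fLerp (.pair (.div (.var 2) (.sub (.var 2) (.var 1)))
        (.pair (.var 5) (.var 3)))) <|
        .pair (.pair (.var 0) (.pair (.var 5) (.var 6)))
          (.pair (.pair (.var 4) (.pair (.var 5) (.var 0))) (.var 1)))
      (.pair (.pair (.var 3) (.pair (.var 4) (.var 5))) (.var 0))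

/-- Keeps the triangles at whose vertices an affine function is nonnegative. -/
def bodyKeep : Expr :=
  .split (.var 0) .nil <| .split (.var 1) .nil <| .split (.var 0) .nil <| .split (.var 1) .nil <|
    .letIn (.call fKeep (.pair (.var 6) (.var 5))) <|
    .ifLt (.call fSide (.pair (.var 7) (.var 3))) (cst 0) (.var 0) <|
    .ifLt (.call fSide (.pair (.var 7) (.var 1))) (cst 0) (.var 0) <|
    .ifLt (.call fSide (.pair (.var 7) (.var 2))) (cst 0) (.var 0) <|
    .pair (.var 5) (.var 0)

/-- Clips triangles by a halfplane. -/
def bodyClip : Expr :=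
  .split (.var 0) .nil <|
    .call fKeep (.pair (.var 0) (.call fStage (.pair (.var 0) (.call fStage (.pair (.var 0)
      (.call fStage (.pair (.var 0) (.var 1))))))))

/-- Clips triangles by bands. -/
def bodyRegion : Expr :=
  .split (.var 0) .nil <| .split (.var 0) (.var 1) <|
    .split (.var 0) .nil <| .split (.var 1) .nil <| .split (.var 1) .nil <|
      .call fRegion (.pair (.var 7)
        (.call fClip (.pair (.pair (cst (-1)) (.pair (.sub (cst 0) (.var 4)) (.var 0)))
          (.call fClip (.pair (.pair (cst 1) (.pair (.var 4) (.sub (cst 0) (.var 2)))) (.var 9))))))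

/-- Twice the signed area of a triangle. -/
def bodyCross : Expr :=
  .split (.var 0) .nil <| .split (.var 1) .nil <| .split (.var 0) .nil <| .split (.var 3) .nil <|
    .split (.var 6) .nil <|
      .sub (.mul (.sub (.var 2) (.var 0)) (.sub (.var 5) (.var 1)))
        (.mul (.sub (.var 3) (.var 1)) (.sub (.var 4) (.var 0)))

/-- Decides whether the distance from a point to a segment is at most one. -/
def bodyNear : Expr :=
  .split (.var 0) .nil <| .split (.var 1) .nil <| .split (.var 0) .nil <| .split (.var 3) .nil <|
    .split (.var 6) .nil <|
    .letIn (.add (.mul (.sub (.var 0) (.var 4)) (.sub (.var 2) (.var 4)))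
      (.mul (.sub (.var 1) (.var 5)) (.sub (.var 3) (.var 5)))) <|
    .letIn (.add (.mul (.sub (.var 3) (.var 5)) (.sub (.var 3) (.var 5)))
      (.mul (.sub (.var 4) (.var 6)) (.sub (.var 4) (.var 6)))) <|
    .ifLt (.var 1) (cst 0)
      (.ifLt (cst 1) (.add (.mul (.sub (.var 2) (.var 6)) (.sub (.var 2) (.var 6)))
        (.mul (.sub (.var 3) (.var 7)) (.sub (.var 3) (.var 7)))) (cst 0) (cst 1)) <|
    .ifLt (.var 0) (.var 1)
      (.ifLt (cst 1) (.add (.mul (.sub (.var 2) (.var 4)) (.sub (.var 2) (.var 4)))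
        (.mul (.sub (.var 3) (.var 5)) (.sub (.var 3) (.var 5)))) (cst 0) (cst 1)) <|
    .letIn (.sub (.mul (.sub (.var 4) (.var 6)) (.sub (.var 3) (.var 7)))
      (.mul (.sub (.var 5) (.var 7)) (.sub (.var 2) (.var 6)))) <|
    .ifLt (.var 1) (.mul (.var 0) (.var 0)) (cst 0) (cst 1)

/-- Decides whether the unit disk around a point meets a triangle. -/
def bodyTri : Expr :=
  .split (.var 0) .nil <| .split (.var 1) .nil <| .split (.var 1) .nil <|
    .ifLt (cst 0) (.call fNear (.pair (.var 4) (.pair (.var 2) (.var 0)))) (cst 1) <|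
    .ifLt (cst 0) (.call fNear (.pair (.var 4) (.pair (.var 0) (.var 1)))) (cst 1) <|
    .ifLt (cst 0) (.call fNear (.pair (.var 4) (.pair (.var 1) (.var 2)))) (cst 1) <|
    .letIn (.call fCross (.pair (.var 4) (.pair (.var 2) (.var 0)))) <|
    .letIn (.call fCross (.pair (.var 5) (.pair (.var 1) (.var 2)))) <|
    .letIn (.call fCross (.pair (.var 6) (.pair (.var 3) (.var 4)))) <|
    .ifLt (.mul (.var 2) (.var 1)) (cst 0) (cst 0) <|
    .ifLt (.mul (.var 1) (.var 0)) (cst 0) (cst 0) <|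
    .ifLt (.mul (.var 0) (.var 2)) (cst 0) (cst 0) (cst 1)

/-- Decides whether the unit disk around a point meets one of the triangles of a list. -/
def bodyHit : Expr :=
  .split (.var 0) .nil <| .split (.var 1) (cst 0) <|
    .ifLt (cst 0) (.call fTri (.pair (.var 2) (.var 0))) (cst 1)
      (.call fHit (.pair (.var 2) (.var 1)))

/-- Keeps the disks of a list that meet one of the triangles of another list. -/
def bodyFilter : Expr :=
  .split (.var 0) .nil <| .split (.var 1) .nil <|
    .letIn (.call fFilter (.pair (.var 2) (.var 1))) <|
    .split (.var 1) .nil <|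
      .ifLt (cst 0) (.call fHit (.pair (.var 1) (.var 5))) (.pair (.var 3) (.var 2)) (.var 2)

/-- Keeps in each band the disks that meet one of the triangles of a list. -/
def bodyFilterDirs : Expr :=
  .split (.var 0) .nil <| .split (.var 1) .nil <|
    .split (.var 0) .nil <| .split (.var 1) .nil <| .split (.var 1) .nil <|
      .pair (.pair (.var 4) (.pair (.var 2) (.pair (.var 0)
        (.call fFilter (.pair (.var 8) (.var 1))))))
        (.call fFilterDirs (.pair (.var 8) (.var 7)))

/-- Two triangles that form a square with center at the origin. -/
def bodyBox : Expr :=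
  .letIn (.sub (cst 0) (.var 0)) <|
    .pair (.pair (.pair (.var 0) (.var 0))
      (.pair (.pair (.var 1) (.var 0)) (.pair (.var 1) (.var 1)))) <|
    .pair (.pair (.pair (.var 0) (.var 0))
      (.pair (.pair (.var 1) (.var 1)) (.pair (.var 0) (.var 1)))) .nil

/-- Builds the tree of a child from the bands of the child and the disks of the parent. -/
def bodyChild : Expr :=
  .split (.var 0) .nil <|
    .letIn (.call fRegion (.pair (.var 1) (.call fBox (.var 0)))) <|
    .call fBuild (.pair (.var 1) (.pair (.var 0) (.call fFilterDirs (.pair (.var 0) (.var 2)))))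

/-- Builds the tree, together with a copy that holds the triangles of the regions. -/
def bodyBuild (K : ℕ) : Expr :=
  .split (.var 0) .nil <| .split (.var 1) .nil <| .split (.var 1) .nil <|
    .split (.var 0) .nil <| .split (.var 1) .nil <| .split (.var 1) .nil <|
      .letIn (.call fLen (.var 1)) <|
      .ifLt (.var 0) (cst (K + 1)) (.pair .nil (.pair (.var 9) .nil)) <|
      .split (.call fChoose (.pair (.var 0) (.pair
        (.call fRoot (.pair (.var 0) (cst 0))) (.var 10)))) .nil <|
      .split (.var 1) .nil <|
      .split (.call fChild (.pair (.var 15) (.var 0))) .nil <|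
      .split (.call fChild (.pair (.var 17) (.var 3))) .nil <|
        .pair (.pair (.var 6) (.pair (.var 2) (.var 0))) (.pair (.var 17) (.pair (.var 3) (.var 1)))

def bodyAppend : Expr :=
  .split (.var 0) .nil <| .split (.var 0) (.var 1) <|
    .pair (.var 0) (.call fAppend (.pair (.var 1) (.var 3)))

/-- The triangles of the leaf regions that meet a disk. -/
def bodyQuery : Expr :=
  .split (.var 0) .nil <| .split (.var 1) .nil <| .split (.var 0) .nil <|
    .ifLt (cst 0) (.call fHit (.pair (.var 4) (.var 0)))
      (.split (.var 1) (.call fAppend (.pair (.var 0) (.var 3)))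
        (.call fQuery (.pair (.var 6) (.pair (.var 0)
          (.call fQuery (.pair (.var 6) (.pair (.var 1) (.var 5))))))))
      (.var 3)

def bodyAnswers : Expr :=
  .split (.var 0) .nil <| .split (.var 1) .nil <|
    .pair (.call fQuery (.pair (.var 0) (.pair (.var 2) .nil)))
      (.call fAnswers (.pair (.var 2) (.var 1)))

def bodyMain (k : ℕ) : Expr :=
  .letIn (.mul (cst (4 * (k + 1) ^ 2)) (.call fSum (.var 0))) <|
  .letIn (.call fBuild (.pair (.var 0) (.pair (.call fBox (.var 0))
    (.call fInit (.pair (cst 0) (.pair (.mul (cst (k + 1)) (.var 0)) (.var 1))))))) <|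
  .split (.var 0) .nil <| .pair (.var 0) (.call fAnswers (.pair (.var 1) (.var 4)))

/-- The program, for exponent `1 / 2 + 1 / (2 * q)`, slopes `0, …, k - 1`, and leaf constant `K`. -/
def prog (q k K : ℕ) : Program :=
  [bodyMain k, bodySplit, bodyMerge, bodySort, bodyKeys, bodySum, bodyInit k, bodyLen, bodyRoot q,
    bodyDrop, bodyFind, bodyChoose q, bodySide, bodyLerp, bodyStage, bodyKeep, bodyClip,
    bodyRegion, bodyCross, bodyNear, bodyTri, bodyHit, bodyFilter, bodyFilterDirs, bodyBox,
    bodyChild, bodyBuild K, bodyAppend, bodyQuery, bodyAnswers]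


/-! ### Lists -/

section Lists

variable {q k K : ℕ} {ι : Type*}

theorem fn_split (e : ι → Val) (L : List ι) :
    ∃ X Y : List ι, (X ++ Y).Perm L ∧ X.length = (L.length + 1) / 2 ∧ Y.length = L.length / 2 ∧
      Fn (prog q k K) fSplit (encList (L.map e))
        (.pair (encList (X.map e)) (encList (Y.map e))) (20 * L.length + 5) := by
  induction L with
  | nil => exact ⟨[], [], .rfl, by simp, by simp, _, rfl,
      Ev.mono (Ev.empty rfl (Ev.pair .nil .nil)) (by norm_num)⟩
  | cons a L ih =>
    obtain ⟨X, Y, hp, hx, hy, h⟩ := ih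
    -- Exchanging the two lists at each element keeps their lengths balanced.
    refine ⟨a :: Y, X, ?_, ?_, ?_, _, rfl, Ev.mono (Ev.open rfl <|
      Ev.split_pair (.call (.var rfl) h) <| .pair (.pair (.var rfl) (.var rfl)) (.var rfl)) ?_⟩
    · exact (List.perm_append_comm.trans hp).cons a
    · simp only [List.length_cons]; omega
    · simp only [List.length_cons]; omega
    · push_cast [List.length_cons]; linarith

/-- The code of a list whose elements carry keys. -/
def encKeyed (key : ι → ℝ) (e : ι → Val) (L : List ι) : Val :=
  encList (L.map fun i => .pair (.num (key i)) (e i))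

theorem fn_merge (key : ι → ℝ) (e : ι → Val) (X Y : List ι) :
      Fn (prog q k K) fMerge (.pair (encKeyed key e X) (encKeyed key e Y))
        (encKeyed key e (List.merge X Y fun a b => key a ≤ key b))
        (30 * (X.length + Y.length) + 10) := by
  induction X generalizing Y with
  | nil => exact ⟨_, rfl, Ev.mono (Ev.open rfl <| Ev.empty rfl <| .var (by simp)) (by
      push_cast [List.length_nil]; linarith [Nat.cast_nonneg (α := ℝ) Y.length])⟩
  | cons a X ihX =>
    induction Y with
    | nil => exact ⟨_, rfl, Ev.mono (Ev.open rfl <| Ev.open rfl <| Ev.empty rfl <| .var (by simp)) (by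
        push_cast [List.length_nil]; linarith [Nat.cast_nonneg (α := ℝ) (a :: X).length])⟩
    | cons b Y ihY =>
      refine ⟨_, rfl, Ev.mono (Ev.open rfl <| Ev.open rfl <| Ev.open rfl <| Ev.open rfl <|
        Ev.open rfl <| Ev.ifLt (.var rfl) (.var rfl) (t₃ := 30 * (X.length + Y.length + 1) + 20)
          (fun h => ?_) (fun h => ?_)) ?_⟩
      · rw [List.cons_merge_cons, if_neg (by simpa using h)]
        exact Ev.mono (Ev.pair (.var rfl) (.call (.pair (.var rfl) (.var rfl)) ihY)) (by
          push_cast [List.length_cons]; linarith)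
      · rw [List.cons_merge_cons, if_pos (by simpa using h)]
        exact Ev.mono (Ev.pair (.var rfl) (.call (.pair (.var rfl) (.var rfl)) (ihX (b :: Y)))) (by
          push_cast [List.length_cons]; linarith)
      · push_cast [List.length_cons]; linarith

theorem fn_keys (j : ℝ) (p : ι → Plane) (L : List ι) :
    Fn (prog q k K) fKeys (.pair (.num j) (encList (L.map fun i => encPoint (p i))))
      (encKeyed (fun i => p i 0 + j * p i 1) (fun i => encPoint (p i)) L)
      (30 * L.length + 10) := by
  induction L with
  | nil => exact ⟨_, rfl, Ev.mono (Ev.open rfl <| Ev.empty rfl .nil) (by norm_num)⟩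
  | cons a L ih =>
    exact ⟨_, rfl, Ev.mono (Ev.open rfl <| Ev.open rfl <| Ev.open rfl <|
      .pair (.pair (.num _ rfl rfl) (.var rfl)) (.call (.pair (.var rfl) (.var rfl)) ih)) (by
        norm_num [arithCost]; linarith)⟩

theorem fn_sum (p : ι → Plane) (L : List ι) :
    Fn (prog q k K) fSum (encList (L.map fun i => encPoint (p i)))
      (.num ((L.map fun i => p i 0 * p i 0 + p i 1 * p i 1).sum + 1)) (30 * L.length + 10) := by
  induction L with
  | nil => exact ⟨_, rfl, Ev.mono (Ev.empty rfl (.num _ rfl (by simp))) (by norm_num [arithCost])⟩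
  | cons a L ih =>
    refine ⟨_, rfl, Ev.mono (Ev.open rfl <| Ev.open rfl <| ?_)
      (t₁ := 30 * L.length + 30 + 2 + 2) (by norm_num; linarith)⟩
    have hs : ((a :: L).map fun i => p i 0 * p i 0 + p i 1 * p i 1).sum + 1 =
        (p a 0 * p a 0 + p a 1 * p a 1) +
          ((L.map fun i => p i 0 * p i 0 + p i 1 * p i 1).sum + 1) := by
      rw [List.map_cons, List.sum_cons, add_assoc]
    rw [hs]
    exact Ev.mono (.add (.num _ rfl rfl) (.call (.var rfl) ih)) (by norm_num [arithCost]; linarith)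

theorem fn_len (L : List Val) :
    Fn (prog q k K) fLen (encList L) (.num L.length) (20 * L.length + 10) := by
  induction L with
  | nil => exact ⟨_, rfl, Ev.mono (Ev.empty rfl (.num _ rfl (by simp))) (by norm_num [arithCost])⟩
  | cons a L ih =>
    refine ⟨_, rfl, Ev.mono (Ev.open rfl ?_) (t₁ := 20 * L.length + 20 + 2)
      (by push_cast [List.length_cons]; linarith)⟩
    rw [List.length_cons, Nat.cast_add, Nat.cast_one, add_comm]
    exact Ev.mono (.add (.num _ rfl (by simp)) (.call (.var rfl) ih)) (by
      norm_num [arithCost]; linarith)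

theorem fn_drop (L : List Val) (r : ℝ) :
    Fn (prog q k K) fDrop (.pair (.num r) (encList L)) (encList (L.drop ⌈r⌉₊))
      (30 * L.length + 20) := by
  induction L generalizing r with
  | nil =>
    refine ⟨_, rfl, Ev.mono (Ev.open rfl <| Ev.ifLt (.num _ rfl rfl) (.var rfl) (t₃ := 3)
      (fun h => ?_) (fun h => ?_)) ?_⟩
    · exact Ev.mono (Ev.empty rfl (by rw [List.drop_nil]; exact Ev.nil)) (by norm_num)
    · exact Ev.mono (Ev.var (by simp)) (by norm_num)
    · norm_num [arithCost]
  | cons a L ih =>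
    refine ⟨_, rfl, Ev.mono (Ev.open rfl <| Ev.ifLt (.num _ rfl rfl) (.var rfl)
      (t₃ := 30 * L.length + 40) (fun h => ?_) (fun h => ?_)) ?_⟩
    · have hr : ⌈r⌉₊ = ⌈r - 1⌉₊ + 1 := by
        rw [Nat.ceil_eq_iff (by omega)]
        simp only [Rat.cast_zero] at h
        rw [Nat.add_sub_cancel]
        refine ⟨?_, by rw [Nat.cast_add_one]; linarith [Nat.le_ceil (r - 1)]⟩
        rcases le_or_gt r 1 with h1 | h1
        · rw [Nat.ceil_eq_zero.2 (by linarith)]; simpa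
        · have := Nat.ceil_lt_add_one (a := r - 1) (by linarith)
          linarith
      rw [hr, List.drop_succ_cons]
      exact Ev.mono (Ev.open rfl (.call (.pair (.num _ rfl (by simp)) (.var rfl)) (ih (r - 1))))
        (by norm_num [arithCost]; linarith)
    · simp only [Rat.cast_zero] at h
      rw [Nat.ceil_eq_zero.2 h]
      exact Ev.mono (Ev.var rfl) (by linarith [Nat.cast_nonneg (α := ℝ) L.length])
    · norm_num [arithCost]; linarith

theorem fn_append (X Y : List Val) :
    Fn (prog q k K) fAppend (.pair (encList X) (encList Y)) (encList (X ++ Y))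
      (20 * X.length + 10) := by
  induction X with
  | nil => exact ⟨_, rfl, Ev.mono (Ev.open rfl <| Ev.empty rfl (.var rfl)) (by norm_num)⟩
  | cons a L ih =>
    exact ⟨_, rfl, Ev.mono (Ev.open rfl <| Ev.open rfl <|
      .pair (.var rfl) (.call (.pair (.var rfl) (.var rfl)) ih)) (by norm_num; linarith)⟩

/-- The walk through two lists finds keys that differ by more than `w` if they exist in the range
that is searched. -/
theorem fn_find (key : ι → ℝ) (e : ι → Val) (w : ℝ) (L M : List ι) (r : ℝ) :
    ∃ o, Fn (prog q k K) fFind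
        (.pair (.num w) (.pair (.num r) (.pair (encKeyed key e L) (encKeyed key e M)))) o
        (50 * L.length + 40) ∧
      ((o = .nil ∧ ∀ (s : ℕ) a b, (s : ℝ) ≤ r → L[s]? = some a → M[s]? = some b →
          key b - key a ≤ w) ∨
        ∃ (s : ℕ) (a b : ι), (s : ℝ) ≤ r ∧ L[s]? = some a ∧ M[s]? = some b ∧ w < key b - key a ∧
          o = .pair (.num (1 / 2 * (key a + key b))) .nil) := by
  induction L generalizing M r with
  | nil =>
    refine ⟨.nil, ⟨_, rfl, Ev.mono (Ev.open rfl <| Ev.open rfl <| Ev.open rfl <|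
      Ev.ifLt (.var rfl) (.num _ rfl rfl) (t₃ := 3) (fun h => ?_) (fun h => ?_)) ?_⟩,
      Or.inl ⟨rfl, by simp⟩⟩
    · exact Ev.mono Ev.nil (by norm_num)
    · exact Ev.mono (Ev.empty rfl Ev.nil) (by norm_num)
    · norm_num [arithCost]
  | cons a L ih =>
    rcases lt_or_ge r 0 with hr | hr
    · refine ⟨.nil, ⟨_, rfl, Ev.mono (Ev.open rfl <| Ev.open rfl <| Ev.open rfl <|
        Ev.ifLt_true (.var rfl) (.num _ rfl rfl) (by simpa using hr) .nil) ?_⟩,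
        Or.inl ⟨rfl, fun s _ _ hs => by linarith [Nat.cast_nonneg (α := ℝ) s]⟩⟩
      norm_num [arithCost]; linarith
    cases M with
    | nil =>
      refine ⟨.nil, ⟨_, rfl, Ev.mono (Ev.open rfl <| Ev.open rfl <| Ev.open rfl <|
        Ev.ifLt_false (.var rfl) (.num _ rfl rfl) (by simpa using hr) <| Ev.open rfl <|
        Ev.empty rfl .nil) ?_⟩, Or.inl ⟨rfl, by simp⟩⟩
      norm_num [arithCost]; linarith
    | cons b M =>
      rcases lt_or_ge w (key b - key a) with hw | hw
      · refine ⟨_, ⟨_, rfl, Ev.mono (Ev.open rfl <| Ev.open rfl <| Ev.open rfl <|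
          Ev.ifLt_false (.var rfl) (.num _ rfl rfl) (by simpa using hr) <| Ev.open rfl <|
          Ev.open rfl <| Ev.open rfl <| Ev.open rfl <|
          Ev.ifLt_true (.var rfl) (.num _ rfl rfl) hw <| .pair (.num _ rfl rfl) .nil) ?_⟩,
          Or.inr ⟨0, a, b, by simpa using hr, rfl, rfl, hw, ?_⟩⟩
        · norm_num [arithCost]; linarith
        · norm_num; ring
      · obtain ⟨o, ho, h⟩ := ih M (r - 1)
        refine ⟨o, ⟨_, rfl, Ev.mono (Ev.open rfl <| Ev.open rfl <| Ev.open rfl <|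
          Ev.ifLt_false (.var rfl) (.num _ rfl rfl) (by simpa using hr) <| Ev.open rfl <|
          Ev.open rfl <| Ev.open rfl <| Ev.open rfl <|
          Ev.ifLt_false (.var rfl) (.num _ rfl rfl) hw <| .call (.pair (.var rfl) (.pair
            (.num _ rfl (by simp)) (.pair (.var rfl) (.var rfl)))) ho) ?_⟩, ?_⟩
        · norm_num [arithCost]; linarith
        · rcases h with ⟨h1, h2⟩ | ⟨s, x, y, h1, h2, h3, h4, h5⟩
          · refine Or.inl ⟨h1, fun s x y hs hx hy => ?_⟩
            cases s with
            | zero =>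
              simp only [List.getElem?_cons_zero, Option.some.injEq] at hx hy
              rwa [← hx, ← hy]
            | succ s =>
              exact h2 s x y (by push_cast at hs; linarith) (by simpa using hx) (by simpa using hy)
          · exact Or.inr ⟨s + 1, x, y, by push_cast; linarith, by simpa using h2,
              by simpa using h3, h4, h5⟩

/-- The number `m` is the integer part of `d^((q+1)/(2q))`, characterized by integer powers because
the machine has neither roots nor rounding. Linear search from zero is affordable: `m ≤ d`, and a
node with `d` disks may spend time linear in `d`. -/
theorem fn_root (hq : 2 ≤ q) (d : ℕ) :
    ∃ m : ℕ, m ^ (2 * q) ≤ d ^ (q + 1) ∧ d ^ (q + 1) < (m + 1) ^ (2 * q) ∧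
      Fn (prog q k K) fRoot (.pair (.num d) (.num 0)) (.num m) ((100 * q + 100) * (d + 1)) := by
  classical
  have hex : ∃ m : ℕ, d ^ (q + 1) < (m + 1) ^ (2 * q) := by
    refine ⟨d, ?_⟩
    calc d ^ (q + 1) < (d + 1) ^ (q + 1) := Nat.pow_lt_pow_left (by omega) (by omega)
      _ ≤ _ := Nat.pow_le_pow_right (by omega) (by omega)
  set m := Nat.find hex with hm
  have h2 := Nat.find_spec hex
  have h1 : ∀ r < m, (r + 1) ^ (2 * q) ≤ d ^ (q + 1) := fun r hr => not_lt.1 (Nat.find_min hex hr)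
  have hmd : m ≤ d := by
    refine Nat.find_min' hex ?_
    calc d ^ (q + 1) < (d + 1) ^ (q + 1) := Nat.pow_lt_pow_left (by omega) (by omega)
      _ ≤ _ := Nat.pow_le_pow_right (by omega) (by omega)
  refine ⟨m, ?_, h2, ?_⟩
  · rcases Nat.eq_zero_or_pos m with h | h
    · rw [h, zero_pow (by omega)]; exact Nat.zero_le _
    · have := h1 (m - 1) (by omega)
      rwa [Nat.sub_add_cancel h] at this
  -- Induction on the distance `r` that remains to the answer.
  have key : ∀ r ≤ m, Fn (prog q k K) fRoot (.pair (.num d) (.num ((m - r : ℕ) : ℝ))) (.num m)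
      ((100 * q + 100) * (r + 1)) := by
    intro r
    induction r with
    | zero =>
      intro _
      refine ⟨_, rfl, Ev.mono (Ev.open rfl <| Ev.ifLt_true (.pow (.var rfl) _)
        (.pow (.num _ rfl rfl) _) ?_ (.var rfl)) ?_⟩
      · have := h2; simp only [Nat.sub_zero, Rat.cast_one]; exact_mod_cast this
      · norm_num [arithCost]; linarith [Nat.cast_nonneg (α := ℝ) q]
    | succ r ih =>
      intro hr
      have hmr : ((m - r : ℕ) : ℝ) = ((m - (r + 1) : ℕ) : ℝ) + 1 := by
        rw [← Nat.cast_add_one]; congr 1; omega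
      refine ⟨_, rfl, Ev.mono (Ev.open rfl <| Ev.ifLt_false (.pow (.var rfl) _)
        (.pow (.num _ rfl rfl) _) ?_ (.call (.pair (.var rfl) (.num _ rfl ?_)) (ih (by omega)))) ?_⟩
      · have := h1 (m - (r + 1)) (by omega)
        simp only [Rat.cast_one]; exact_mod_cast this
      · rw [hmr]; simp
      · norm_num [arithCost]; nlinarith [Nat.cast_nonneg (α := ℝ) q, Nat.cast_nonneg (α := ℝ) r]
  have := key m le_rfl
  rw [Nat.sub_self, Nat.cast_zero] at this
  refine this.mono ?_
  have : (m : ℝ) ≤ d := by exact_mod_cast hmd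
  gcongr

end Lists


/-! ### Sorting -/

/-- The induction step of a divide-and-conquer recurrence with overlap `m`. Replacing both
logarithms by `log (α d)` gains `d · log α⁻¹`; half of it absorbs the overlap term `m log d`, and
the other half is left for linear work. -/
theorem mul_log_add_mul_log_le {α x y d m : ℝ} (hα : α < 1) (hd : 1 ≤ α * d) (hd0 : 0 < d)
    (hx : 0 ≤ x) (hy : 0 ≤ y) (hm : 0 ≤ m) (hxd : x ≤ α * d) (hyd : y ≤ α * d)
    (hxy : x + y ≤ d + m) (hmd : m * Real.log d ≤ Real.log α⁻¹ / 2 * d) :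
    x * Real.log x + y * Real.log y + Real.log α⁻¹ / 2 * d ≤ d * Real.log d := by
  have hα0 : 0 < α := by
    by_contra h
    nlinarith
  have key : ∀ z : ℝ, 0 ≤ z → z ≤ α * d → z * Real.log z ≤ z * Real.log (α * d) := by
    intro z hz hzd
    rcases hz.eq_or_lt with rfl | hz'
    · simp
    · exact mul_le_mul_of_nonneg_left (Real.log_le_log hz' hzd) hz
  have h1 := key x hx hxd
  have h2 := key y hy hyd
  have h3 : (x + y) * Real.log (α * d) ≤ (d + m) * Real.log (α * d) :=
    mul_le_mul_of_nonneg_right hxy (Real.log_nonneg hd)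
  rw [Real.log_mul hα0.ne' hd0.ne'] at *
  have h4 : Real.log α ≤ 0 := Real.log_nonpos hα0.le hα.le
  rw [Real.log_inv] at *
  nlinarith

/-- The factor of `n * log n` in the running time of sorting. -/
def sortConst : ℝ := 300 / Real.log (3 / 2)

theorem sortConst_nonneg : 0 ≤ sortConst :=
  div_nonneg (by norm_num) (Real.log_nonneg (by norm_num))

/-- Merge sort. For `n ≥ 2` both halves have at most `2n/3` elements, with equality at `n = 3`, so
the recurrence applies with `α = 2/3` and no overlap. The gain `sortConst · log (3/2) / 2 · n = 150
n` covers splitting and merging. -/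
theorem fn_sort {q k K : ℕ} {ι : Type*} (key : ι → ℝ) (e : ι → Val) (n : ℕ) :
    ∀ L : List ι, L.length = n → ∃ S : List ι, S.Perm L ∧
      S.Pairwise (fun a b => key a ≤ key b) ∧
      Fn (prog q k K) fSort (encKeyed key e L) (encKeyed key e S)
        (sortConst * (n * Real.log n) + 20) := by
  induction n using Nat.strong_induction_on with
  | _ n ih =>
    intro L hL
    match L, hL with
    | [], hL =>
      exact ⟨[], .rfl, .nil, _, rfl, Ev.mono (Ev.empty rfl .nil) (by subst hL; norm_num)⟩
    | [a], hL =>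
      exact ⟨[a], .rfl, by simp, _, rfl, Ev.mono (Ev.open rfl <| Ev.empty rfl <| .var rfl)
        (by subst hL; norm_num)⟩
    | a :: b :: L', hL =>
      set L := a :: b :: L' with hLdef
      have hn : 2 ≤ n := by rw [← hL, hLdef]; simp
      obtain ⟨X, Y, hp, hx, hy, h⟩ := fn_split (q := q) (k := k) (K := K)
        (fun i => Val.pair (.num (key i)) (e i)) L
      rw [hL] at hx hy h
      obtain ⟨X', hX1, hX2, hX3⟩ := ih X.length (by omega) X rfl
      obtain ⟨Y', hY1, hY2, hY3⟩ := ih Y.length (by omega) Y rfl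
      refine ⟨List.merge X' Y' fun a b => key a ≤ key b,
        (List.merge_perm_append _).trans ((hX1.append hY1).trans hp), ?_, _, rfl,
        Ev.mono (Ev.open rfl <| Ev.open rfl <| Ev.split_pair (.call (.var rfl) h) <|
          .call (.pair (.call (.var rfl) hX3) (.call (.var rfl) hY3)) (fn_merge key e X' Y')) ?_⟩
      · have := List.pairwise_merge (le := fun a b => decide (key a ≤ key b))
          (by simpa using fun a b c => le_trans) (by simpa using fun a b => le_total _ _) X' Y'
          (by simpa using hX2) (by simpa using hY2)
        simpa using this
      · have hn' : (2 : ℝ) ≤ n := by exact_mod_cast hn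
        have hxy : (X.length : ℝ) + Y.length = n := by
          have : X.length + Y.length = n := by omega
          exact_mod_cast this
        have hx3 : (X.length : ℝ) ≤ 2 / 3 * n := by
          have : 3 * X.length ≤ 2 * n := by omega
          have : (3 : ℝ) * X.length ≤ 2 * n := by exact_mod_cast this
          linarith
        have hy3 : (Y.length : ℝ) ≤ 2 / 3 * n := by
          have : 3 * Y.length ≤ 2 * n := by omega
          have : (3 : ℝ) * Y.length ≤ 2 * n := by exact_mod_cast this
          linarith
        have hl : 0 < Real.log (3 / 2) := Real.log_pos (by norm_num)
        have hinv : ((2 : ℝ) / 3)⁻¹ = 3 / 2 := by norm_num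
        have := mul_log_add_mul_log_le (α := 2 / 3) (d := n) (x := X.length) (y := Y.length)
          (m := 0) (by norm_num) (by linarith) (by linarith) (by positivity) (by positivity) le_rfl
          hx3 hy3 (by linarith) (by rw [hinv, zero_mul]; positivity)
        have h2 := mul_le_mul_of_nonneg_left this sortConst_nonneg
        rw [hinv] at h2
        have h3 : sortConst * Real.log (3 / 2) = 300 := by
          rw [sortConst]; field_simp
        have hXl : (X'.length : ℝ) = X.length := by rw [hX1.length_eq]
        have hYl : (Y'.length : ℝ) = Y.length := by rw [hY1.length_eq]
        rw [hXl, hYl]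
        nlinarith


/-! ### Triangles -/

/-- A triangle, given by its vertices. -/
abbrev Tri : Type := Plane × Plane × Plane

/-- The set of the points of a triangle. -/
def triSet (t : Tri) : Set Plane :=
  {p | ∃ u v w : ℝ, 0 ≤ u ∧ 0 ≤ v ∧ 0 ≤ w ∧ u + v + w = 1 ∧
    p = u • t.1 + v • t.2.1 + w • t.2.2}

/-- Twice the signed area of the triangle `a c b`. -/
def cross (a b c : Plane) : ℝ :=
  (c 0 - a 0) * (b 1 - a 1) - (c 1 - a 1) * (b 0 - a 0)

/-- The triangle is not degenerate. -/
def Tri.Proper (t : Tri) : Prop := cross t.1 t.2.1 t.2.2 ≠ 0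

def encTri (t : Tri) : Val := .pair (encPoint t.1) (.pair (encPoint t.2.1) (encPoint t.2.2))

theorem plane_ext {p r : Plane} (h0 : p 0 = r 0) (h1 : p 1 = r 1) : p = r := by
  ext i; fin_cases i <;> assumption

/-- Cramer's rule for the vectors `b - a` and `c - a`. -/
theorem affineIndependent_of_cross_ne_zero {a b c : Plane} (h : cross a b c ≠ 0) :
    AffineIndependent ℝ ![a, b, c] := by
  rw [affineIndependent_iff_of_fintype]
  intro w hw hs
  rw [Finset.univ.weightedVSub_eq_linear_combination hw] at hs
  have h0 := congrArg (fun p : Plane => p 0) hs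
  have h1 := congrArg (fun p : Plane => p 1) hs
  simp only [Fin.sum_univ_three, Matrix.cons_val_zero, Matrix.cons_val_one, Matrix.cons_val,
    PiLp.add_apply, PiLp.smul_apply, smul_eq_mul, PiLp.zero_apply] at h0 h1
  rw [Fin.sum_univ_three] at hw
  have hw0 : w 0 = -w 1 - w 2 := by linarith
  have e1 : w 1 * cross a b c = 0 := by
    rw [hw0] at h0 h1
    simp only [cross]
    linear_combination (c 0 - a 0) * h1 - (c 1 - a 1) * h0
  have e2 : w 2 * cross a b c = 0 := by
    rw [hw0] at h0 h1
    simp only [cross]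
    linear_combination (b 1 - a 1) * h0 - (b 0 - a 0) * h1
  have f1 : w 1 = 0 := (mul_eq_zero.1 e1).resolve_right h
  have f2 : w 2 = 0 := (mul_eq_zero.1 e2).resolve_right h
  intro i
  fin_cases i
  · show w 0 = 0
    rw [hw0, f1, f2]; ring
  · exact f1
  · exact f2

/-- A nondegenerate triangle as an affine simplex. -/
def Tri.toTriangle (t : Tri) (h : t.Proper) : Affine.Triangle ℝ Plane :=
  ⟨![t.1, t.2.1, t.2.2], affineIndependent_of_cross_ne_zero h⟩

theorem encTriangle_toTriangle (t : Tri) (h : t.Proper) :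
    encTriangle (t.toTriangle h) = encTri t := rfl

theorem convex_triSet (t : Tri) : Convex ℝ (triSet t) := by
  rintro p ⟨u, v, w, hu, hv, hw, hs, rfl⟩ r ⟨u', v', w', hu', hv', hw', hs', rfl⟩ x y hx hy hxy
  refine ⟨x * u + y * u', x * v + y * v', x * w + y * w', by positivity, by positivity,
    by positivity, ?_, ?_⟩
  · linear_combination x * hs + y * hs' + hxy
  · module

theorem triangleSet_toTriangle (t : Tri) (h : t.Proper) :
    triangleSet (t.toTriangle h) = triSet t := by
  have hr : Set.range (t.toTriangle h).points = {t.1, t.2.1, t.2.2} := by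
    show Set.range ![t.1, t.2.1, t.2.2] = _
    simp [Matrix.range_cons]
    grind
  rw [triangleSet, hr]
  apply Set.Subset.antisymm
  · refine convexHull_min ?_ (convex_triSet t)
    rintro p (rfl | rfl | rfl)
    · exact ⟨1, 0, 0, by norm_num, by norm_num, by norm_num, by norm_num, by module⟩
    · exact ⟨0, 1, 0, by norm_num, by norm_num, by norm_num, by norm_num, by module⟩
    · exact ⟨0, 0, 1, by norm_num, by norm_num, by norm_num, by norm_num, by module⟩
  · rintro p ⟨u, v, w, hu, hv, hw, hs, rfl⟩
    have hc := convex_convexHull ℝ ({t.1, t.2.1, t.2.2} : Set Plane)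
    have := hc.sum_mem (t := Finset.univ) (w := ![u, v, w]) (z := ![t.1, t.2.1, t.2.2])
      (by intro i _; fin_cases i <;> assumption) (by rw [Fin.sum_univ_three]; exact hs)
      (by intro i _; fin_cases i <;> exact subset_convexHull ℝ _ (by simp))
    rw [Fin.sum_univ_three] at this
    exact this

theorem isClosed_triSet (t : Tri) (h : t.Proper) : IsClosed (triSet t) := by
  rw [← triangleSet_toTriangle t h, triangleSet]
  exact ((Set.finite_range _).isCompact_convexHull (𝕜 := ℝ)).isClosed

/-- The union of the triangles of a list. -/
def cover (ts : List Tri) : Set Plane := {p | ∃ t ∈ ts, p ∈ triSet t}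

theorem isClosed_cover (ts : List Tri) (h : ∀ t ∈ ts, t.Proper) : IsClosed (cover ts) := by
  have : cover ts = ⋃ t ∈ {t | t ∈ ts}, triSet t := by
    ext; simp [cover]
  rw [this]
  exact (List.finite_toSet ts).isClosed_biUnion fun t ht => isClosed_triSet t (h t ht)

/-! ### Clipping -/

/-- The affine function with the given coefficients. -/
def sideOf (h : ℝ × ℝ × ℝ) (p : Plane) : ℝ := h.1 * p 0 + h.2.1 * p 1 + h.2.2

def lerp (s : ℝ) (a b : Plane) : Plane := a + s • (b - a)

theorem sideOf_lerp (h : ℝ × ℝ × ℝ) (s : ℝ) (a b : Plane) :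
    sideOf h (lerp s a b) = (1 - s) * sideOf h a + s * sideOf h b := by
  simp [sideOf, lerp]; ring

theorem sideOf_comb (h : ℝ × ℝ × ℝ) {u v w : ℝ} (hs : u + v + w = 1) (a b c : Plane) :
    sideOf h (u • a + v • b + w • c) = u * sideOf h a + v * sideOf h b + w * sideOf h c := by
  simp only [sideOf, PiLp.add_apply, PiLp.smul_apply, smul_eq_mul]
  linear_combination (-h.2.2) * hs

open Classical in
/-- Cuts the edge `a b` of the triangle `a b c` where the affine function changes its sign; in the
resulting triangles this edge comes last. -/
def cutTri (h : ℝ × ℝ × ℝ) (t : Tri) : List Tri :=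
  if sideOf h t.1 * sideOf h t.2.1 < 0 then
    [(lerp (sideOf h t.1 / (sideOf h t.1 - sideOf h t.2.1)) t.1 t.2.1, t.2.2, t.1),
      (t.2.1, t.2.2, lerp (sideOf h t.1 / (sideOf h t.1 - sideOf h t.2.1)) t.1 t.2.1)]
  else [(t.2.1, t.2.2, t.1)]

def cutTris (h : ℝ × ℝ × ℝ) (ts : List Tri) : List Tri := ts.flatMap (cutTri h)

theorem cut_param {x y : ℝ} (h : x * y < 0) : 0 < x / (x - y) ∧ x / (x - y) < 1 ∧ x - y ≠ 0 := by
  rcases mul_neg_iff.1 h with ⟨h1, h2⟩ | ⟨h1, h2⟩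
  · refine ⟨div_pos h1 (by linarith), (div_lt_one (by linarith)).2 (by linarith), by linarith⟩
  · refine ⟨div_pos_of_neg_of_neg h1 (by linarith), ?_, by linarith⟩
    rw [div_lt_one_of_neg (by linarith)]; linarith

theorem sideOf_cut {h : ℝ × ℝ × ℝ} {a b : Plane} (hab : sideOf h a * sideOf h b < 0) :
    sideOf h (lerp (sideOf h a / (sideOf h a - sideOf h b)) a b) = 0 := by
  have := (cut_param hab).2.2
  rw [sideOf_lerp]
  field_simp
  ring

theorem triSet_rotate (a b c : Plane) : triSet (b, c, a) = triSet (a, b, c) := by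
  ext p
  constructor
  · rintro ⟨u, v, w, hu, hv, hw, hs, rfl⟩
    exact ⟨w, u, v, hw, hu, hv, by linarith, by simp only; module⟩
  · rintro ⟨u, v, w, hu, hv, hw, hs, rfl⟩
    exact ⟨v, w, u, hv, hw, hu, by linarith, by simp only; module⟩

/-- The segment from `c` to the cut point divides the triangle; which half contains a point is read
off its barycentric coordinates. -/
theorem triSet_lerp {s : ℝ} (h0 : 0 < s) (h1 : s < 1) (a b c : Plane) :
    triSet (lerp s a b, c, a) ∪ triSet (b, c, lerp s a b) = triSet (a, b, c) := by
  ext p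
  constructor
  · rintro (⟨u, v, w, hu, hv, hw, hs, rfl⟩ | ⟨u, v, w, hu, hv, hw, hs, rfl⟩)
    · refine ⟨w + (1 - s) * u, s * u, v, ?_, by positivity, hv, by linarith, ?_⟩
      · have : 0 ≤ 1 - s := by linarith
        positivity
      · simp only [lerp]; module
    · refine ⟨(1 - s) * w, u + s * w, v, ?_, by positivity, hv, by linarith, ?_⟩
      · exact mul_nonneg (by linarith) hw
      · simp only [lerp]; module
  · rintro ⟨u, v, w, hu, hv, hw, hs, rfl⟩
    have h1' : (1 - s) ≠ 0 := by linarith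
    have h1'' : 0 ≤ (1 - s) := by linarith
    -- Equality describes the line through `c` and the cut point.
    rcases le_total (v * (1 - s)) (s * u) with h | h
    · left
      refine ⟨v / s, w, u - v * (1 - s) / s, by positivity, hw, ?_, ?_, ?_⟩
      · rw [sub_nonneg, div_le_iff₀ h0]; linarith
      · field_simp
        linear_combination s * hs
      · simp only [lerp]
        match_scalars <;> (field_simp; try ring)
    · right
      refine ⟨v - s * u / (1 - s), w, u / (1 - s), ?_, hw, by positivity, ?_, ?_⟩
      · rw [sub_nonneg, div_le_iff₀ (by linarith)]; linarith
      · field_simp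
        linear_combination (1 - s) * hs
      · simp only [lerp]
        match_scalars <;> (field_simp; try ring)

theorem cover_cutTri (h : ℝ × ℝ × ℝ) (t : Tri) : cover (cutTri h t) = triSet t := by
  obtain ⟨a, b, c⟩ := t
  unfold cutTri
  split_ifs with hc
  · have := cut_param hc
    rw [← triSet_lerp this.1 this.2.1 a b c]
    ext p; simp [cover]
  · rw [← triSet_rotate a b c]
    ext p; simp [cover]

theorem cover_cutTris (h : ℝ × ℝ × ℝ) (ts : List Tri) : cover (cutTris h ts) = cover ts := by
  ext p
  constructor
  · rintro ⟨t, ht, hp⟩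
    obtain ⟨t', ht', ht⟩ := List.mem_flatMap.1 ht
    refine ⟨t', ht', ?_⟩
    rw [← cover_cutTri h t']
    exact ⟨t, ht, hp⟩
  · rintro ⟨t, ht, hp⟩
    rw [← cover_cutTri h t] at hp
    obtain ⟨t', ht', hp⟩ := hp
    exact ⟨t', List.mem_flatMap.2 ⟨t, ht, ht'⟩, hp⟩

/-- The two pieces have `s` and `1 - s` times the signed area of the triangle, and `0 < s < 1`. -/
theorem proper_cutTri {h : ℝ × ℝ × ℝ} {t t' : Tri} (ht : t.Proper) (h' : t' ∈ cutTri h t) :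
    t'.Proper := by
  obtain ⟨a, b, c⟩ := t
  unfold cutTri at h'
  split_ifs at h' with hc
  · obtain ⟨h0, h1, -⟩ := cut_param hc
    set s := sideOf h a / (sideOf h a - sideOf h b) with hs
    simp only [List.mem_cons, List.not_mem_nil, or_false] at h'
    rcases h' with rfl | rfl
    · have : cross (lerp s a b) c a = s * cross a b c := by
        simp [cross, lerp]; ring
      show cross _ _ _ ≠ 0
      rw [this]
      exact mul_ne_zero h0.ne' ht
    · have : cross b c (lerp s a b) = (1 - s) * cross a b c := by
        simp [cross, lerp]; ring
      show cross _ _ _ ≠ 0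
      rw [this]
      exact mul_ne_zero (by linarith) ht
  · simp only [List.mem_cons, List.not_mem_nil, or_false] at h'
    subst h'
    have : cross b c a = cross a b c := by simp only [cross]; ring
    show cross _ _ _ ≠ 0
    rw [this]
    exact ht

theorem length_cutTris_le (h : ℝ × ℝ × ℝ) (ts : List Tri) :
    (cutTris h ts).length ≤ 2 * ts.length := by
  rw [cutTris, List.length_flatMap]
  induction ts with
  | nil => simp
  | cons t ts ih =>
    simp only [List.map_cons, List.sum_cons, List.length_cons]
    have : (cutTri h t).length ≤ 2 := by
      unfold cutTri; split_ifs <;> simp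
    omega

/-- This and the next two lemmas follow one property, that an edge has no sign change, through the
rounds. A round creates it at the last edge, and later rounds carry it to the second and to the
first edge by rotation, with cuts not destroying it. After three rounds all edges have it. -/
theorem cutTri_last {h : ℝ × ℝ × ℝ} {t t' : Tri} (h' : t' ∈ cutTri h t) :
    0 ≤ sideOf h t'.2.2 * sideOf h t'.1 := by
  obtain ⟨a, b, c⟩ := t
  unfold cutTri at h'
  split_ifs at h' with hc <;> simp only [List.mem_cons, List.not_mem_nil, or_false] at h'
  · rcases h' with rfl | rfl <;> simp [sideOf_cut hc]
  · subst h'; exact not_lt.1 hc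

theorem cutTri_second {h : ℝ × ℝ × ℝ} {t t' : Tri} (h' : t' ∈ cutTri h t)
    (ht : 0 ≤ sideOf h t.2.2 * sideOf h t.1) : 0 ≤ sideOf h t'.2.1 * sideOf h t'.2.2 := by
  obtain ⟨a, b, c⟩ := t
  unfold cutTri at h'
  split_ifs at h' with hc <;> simp only [List.mem_cons, List.not_mem_nil, or_false] at h'
  · rcases h' with rfl | rfl
    · exact ht
    · simp [sideOf_cut hc]
  · subst h'; exact ht

theorem cutTri_first {h : ℝ × ℝ × ℝ} {t t' : Tri} (h' : t' ∈ cutTri h t)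
    (ht : 0 ≤ sideOf h t.2.1 * sideOf h t.2.2) : 0 ≤ sideOf h t'.1 * sideOf h t'.2.1 := by
  obtain ⟨a, b, c⟩ := t
  unfold cutTri at h'
  split_ifs at h' with hc <;> simp only [List.mem_cons, List.not_mem_nil, or_false] at h'
  · rcases h' with rfl | rfl
    · simp [sideOf_cut hc]
    · exact ht
  · subst h'; exact ht

open Classical in
def keepTris (h : ℝ × ℝ × ℝ) (ts : List Tri) : List Tri :=
  ts.filter fun t => 0 ≤ sideOf h t.1 ∧ 0 ≤ sideOf h t.2.1 ∧ 0 ≤ sideOf h t.2.2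

/-- The parts of the triangles on which the affine function is nonnegative. -/
def clipTris (h : ℝ × ℝ × ℝ) (ts : List Tri) : List Tri :=
  keepTris h (cutTris h (cutTris h (cutTris h ts)))

theorem length_clipTris_le (h : ℝ × ℝ × ℝ) (ts : List Tri) :
    (clipTris h ts).length ≤ 8 * ts.length := by
  have h1 := length_cutTris_le h ts
  have h2 := length_cutTris_le h (cutTris h ts)
  have h3 := length_cutTris_le h (cutTris h (cutTris h ts))
  have h4 : (clipTris h ts).length ≤ _ := List.length_filter_le _ _
  omega

theorem proper_cutTris {h : ℝ × ℝ × ℝ} {ts : List Tri} (ht : ∀ t ∈ ts, t.Proper) :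
    ∀ t ∈ cutTris h ts, t.Proper := by
  intro t h'
  obtain ⟨t', ht', h'⟩ := List.mem_flatMap.1 h'
  exact proper_cutTri (ht t' ht') h'

theorem proper_clipTris {h : ℝ × ℝ × ℝ} {ts : List Tri} (ht : ∀ t ∈ ts, t.Proper) :
    ∀ t ∈ clipTris h ts, t.Proper := fun _ h' =>
  proper_cutTris (proper_cutTris (proper_cutTris ht)) _ (List.mem_of_mem_filter h')

theorem cover_clipTris_subset (h : ℝ × ℝ × ℝ) (ts : List Tri) :
    cover (clipTris h ts) ⊆ cover ts ∩ {p | 0 ≤ sideOf h p} := by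
  rintro p ⟨t, ht, hp⟩
  have ht' := List.mem_filter.1 ht
  constructor
  · rw [← cover_cutTris h ts, ← cover_cutTris h (cutTris h ts), ← cover_cutTris h]
    exact ⟨t, ht'.1, hp⟩
  · obtain ⟨h1, h2, h3⟩ := of_decide_eq_true ht'.2
    obtain ⟨u, v, w, hu, hv, hw, hs, rfl⟩ := hp
    rw [Set.mem_ofPred_eq, sideOf_comb h hs]
    positivity

/-- After three rounds no edge joins opposite strict signs. A triangle containing a point of
positive value has a positive vertex, hence no negative one, and is kept. Strictness is essential: a
triangle that touches the zero line from the negative side is dropped, so zeros are recovered only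
by a closure argument in `cover_regionTris`. -/
theorem subset_cover_clipTris (h : ℝ × ℝ × ℝ) (ts : List Tri) :
    cover ts ∩ {p | 0 < sideOf h p} ⊆ cover (clipTris h ts) := by
  rintro p ⟨hp, hpos⟩
  rw [← cover_cutTris h ts, ← cover_cutTris h (cutTris h ts), ← cover_cutTris h] at hp
  obtain ⟨t, ht, hp⟩ := hp
  refine ⟨t, List.mem_filter.2 ⟨ht, decide_eq_true ?_⟩, hp⟩
  obtain ⟨t₂, ht₂, h₃⟩ := List.mem_flatMap.1 ht
  obtain ⟨t₁, ht₁, h₂⟩ := List.mem_flatMap.1 ht₂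
  obtain ⟨t₀, -, h₁⟩ := List.mem_flatMap.1 ht₁
  have e1 := cutTri_last h₃
  have e2 := cutTri_second h₃ (cutTri_last h₂)
  have e3 := cutTri_first h₃ (cutTri_second h₂ (cutTri_last h₁))
  obtain ⟨u, v, w, hu, hv, hw, hs, rfl⟩ := hp
  rw [Set.mem_ofPred_eq, sideOf_comb h hs] at hpos
  have pos_left : ∀ {x y : ℝ}, 0 < x → 0 ≤ x * y → 0 ≤ y := fun hx hxy =>
    nonneg_of_mul_nonneg_right hxy hx
  have pos_right : ∀ {x y : ℝ}, 0 < x → 0 ≤ y * x → 0 ≤ y := fun hx hxy =>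
    nonneg_of_mul_nonneg_left hxy hx
  by_cases c1 : 0 < sideOf h t.1
  · exact ⟨c1.le, pos_left c1 e3, pos_right c1 e1⟩
  by_cases c2 : 0 < sideOf h t.2.1
  · exact ⟨pos_right c2 e3, c2.le, pos_left c2 e2⟩
  by_cases c3 : 0 < sideOf h t.2.2
  · exact ⟨pos_left c3 e1, pos_right c3 e2, c3.le⟩
  have := mul_nonpos_of_nonneg_of_nonpos hu (not_lt.1 c1)
  have := mul_nonpos_of_nonneg_of_nonpos hv (not_lt.1 c2)
  have := mul_nonpos_of_nonneg_of_nonpos hw (not_lt.1 c3)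
  linarith


/-! ### Disks and triangles -/

theorem mem_unitDisk {p r : Plane} :
    r ∈ unitDisk p ↔ (r 0 - p 0) ^ 2 + (r 1 - p 1) ^ 2 ≤ 1 := by
  rw [unitDisk, Metric.mem_closedBall, EuclideanSpace.dist_eq, Fin.sum_univ_two, Real.dist_eq,
    Real.dist_eq, sq_abs, sq_abs, Real.sqrt_le_one]

/-- The unit disk meets a segment. -/
def NearSegment (p a b : Plane) : Prop := ∃ s : ℝ, 0 ≤ s ∧ s ≤ 1 ∧ lerp s a b ∈ unitDisk p

/-- The inner product of `p - a` and `b - a`. -/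
def dotAt (p a b : Plane) : ℝ := (p 0 - a 0) * (b 0 - a 0) + (p 1 - a 1) * (b 1 - a 1)

/-- The squared distance from `p` along the segment is a quadratic polynomial in the parameter. -/
theorem lerp_mem_unitDisk {s : ℝ} {p a b : Plane} : lerp s a b ∈ unitDisk p ↔
    dotAt p a p - 2 * s * dotAt p a b + s ^ 2 * dotAt b a b ≤ 1 := by
  rw [mem_unitDisk]
  have : (lerp s a b 0 - p 0) ^ 2 + (lerp s a b 1 - p 1) ^ 2 =
      dotAt p a p - 2 * s * dotAt p a b + s ^ 2 * dotAt b a b := by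
    simp [lerp, dotAt]; ring
  rw [this]

theorem dotAt_self_pos {a b : Plane} (hab : a ≠ b) : 0 < dotAt b a b := by
  by_contra h
  apply hab
  have h0 : 0 ≤ (b 0 - a 0) * (b 0 - a 0) := mul_self_nonneg _
  have h1 : 0 ≤ (b 1 - a 1) * (b 1 - a 1) := mul_self_nonneg _
  rw [dotAt] at h
  have e0 : b 0 - a 0 = 0 := mul_self_eq_zero.1 (by linarith)
  have e1 : b 1 - a 1 = 0 := mul_self_eq_zero.1 (by linarith)
  exact plane_ext (by linarith) (by linarith)

/-- The foot of the perpendicular from `p` falls before `a`, so `a` is the nearest point of the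
segment. -/
theorem nearSegment_iff_of_neg {p a b : Plane} (hab : a ≠ b) (h : dotAt p a b < 0) :
    NearSegment p a b ↔ dotAt p a p ≤ 1 := by
  have := dotAt_self_pos hab
  constructor
  · rintro ⟨s, h0, -, hs⟩
    rw [lerp_mem_unitDisk] at hs
    have h2 : 0 ≤ s ^ 2 * dotAt b a b := by positivity
    nlinarith
  · intro h'
    exact ⟨0, le_rfl, zero_le_one, by rw [lerp_mem_unitDisk]; linarith⟩

/-- The foot of the perpendicular falls beyond `b`, so `b` is the nearest point. -/
theorem nearSegment_iff_of_lt {p a b : Plane} (hab : a ≠ b) (h : dotAt b a b < dotAt p a b) :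
    NearSegment p a b ↔ dotAt p b p ≤ 1 := by
  have := dotAt_self_pos hab
  have e : dotAt p b p = dotAt p a p - 2 * dotAt p a b + dotAt b a b := by
    simp only [dotAt]; ring
  constructor
  · rintro ⟨s, h0, h1, hs⟩
    rw [lerp_mem_unitDisk] at hs
    nlinarith [mul_nonneg (mul_nonneg (sub_nonneg.2 h1) (sub_nonneg.2 h1)) this.le,
      mul_nonneg (sub_nonneg.2 h1) (sub_nonneg.2 h.le)]
  · intro h'
    exact ⟨1, zero_le_one, le_rfl, by rw [lerp_mem_unitDisk]; linarith⟩

/-- The foot lies on the segment, and the squared distance to the line is the squared cross product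
over the squared length. Clearing the denominator leaves a test without division or root. -/
theorem nearSegment_iff_of_mid {p a b : Plane} (hab : a ≠ b) (h0 : 0 ≤ dotAt p a b)
    (h1 : dotAt p a b ≤ dotAt b a b) :
    NearSegment p a b ↔
      ((b 0 - a 0) * (p 1 - a 1) - (b 1 - a 1) * (p 0 - a 0)) *
        ((b 0 - a 0) * (p 1 - a 1) - (b 1 - a 1) * (p 0 - a 0)) ≤ dotAt b a b := by
  have hu := dotAt_self_pos hab
  have e : ((b 0 - a 0) * (p 1 - a 1) - (b 1 - a 1) * (p 0 - a 0)) *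
        ((b 0 - a 0) * (p 1 - a 1) - (b 1 - a 1) * (p 0 - a 0)) =
      dotAt b a b * dotAt p a p - dotAt p a b ^ 2 := by
    simp only [dotAt]; ring
  rw [e]
  constructor
  · rintro ⟨s, -, -, hs⟩
    rw [lerp_mem_unitDisk] at hs
    have := mul_le_mul_of_nonneg_left hs hu.le
    nlinarith [sq_nonneg (dotAt p a b - s * dotAt b a b)]
  · intro h'
    -- The parameter of the foot of the perpendicular.
    refine ⟨dotAt p a b / dotAt b a b, by positivity, (div_le_one hu).2 h1, ?_⟩
    rw [lerp_mem_unitDisk]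
    have : dotAt p a p - 2 * (dotAt p a b / dotAt b a b) * dotAt p a b +
        (dotAt p a b / dotAt b a b) ^ 2 * dotAt b a b =
        (dotAt b a b * dotAt p a p - dotAt p a b ^ 2) / dotAt b a b := by
      field_simp; ring
    rw [this, div_le_one hu]
    exact h'

theorem segment_subset_triSet {a b c : Plane} {s : ℝ} (h0 : 0 ≤ s) (h1 : s ≤ 1) :
    lerp s a b ∈ triSet (a, b, c) :=
  ⟨1 - s, s, 0, by linarith, h0, le_rfl, by ring, by simp only [lerp]; module⟩

/-- Barycentric coordinates. -/
theorem eq_barycentric {a b c : Plane} (h : cross a b c ≠ 0) (p : Plane) :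
    cross p b c / cross a b c + cross p c a / cross a b c + cross p a b / cross a b c = 1 ∧
      p = (cross p b c / cross a b c) • a + (cross p c a / cross a b c) • b +
        (cross p a b / cross a b c) • c := by
  constructor
  · field_simp
    simp only [cross]; ring
  · apply plane_ext <;>
    · simp only [PiLp.add_apply, PiLp.smul_apply, smul_eq_mul]
      field_simp
      simp only [cross]; ring

/-- A disk that meets a triangle meets one of its edges or has its center in the triangle. -/
theorem disk_meets_triSet_iff {p a b c : Plane} (h : cross a b c ≠ 0) :
    (unitDisk p ∩ triSet (a, b, c)).Nonempty ↔
      NearSegment p a b ∨ NearSegment p b c ∨ NearSegment p c a ∨ p ∈ triSet (a, b, c) := by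
  constructor
  · rintro ⟨r, hr, u, v, w, hu, hv, hw, hs, hrr⟩
    by_cases hp : p ∈ triSet (a, b, c)
    · exact Or.inr (Or.inr (Or.inr hp))
    obtain ⟨hs', hpp⟩ := eq_barycentric h p
    set u' := cross p b c / cross a b c
    set v' := cross p c a / cross a b c
    set w' := cross p a b / cross a b c
    -- The least barycentric coordinate along the segment from `p` to `r`. It is nonpositive at `p`,
    -- which is outside the triangle, and nonnegative at `r`. A zero gives a point on an edge that
    -- is no farther from `p` than `r` is.
    let f : ℝ → ℝ := fun s =>
      min (u' + s * (u - u')) (min (v' + s * (v - v')) (w' + s * (w - w')))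
    have hf : Continuous f := by fun_prop
    have hf0 : f 0 ≤ 0 := by
      by_contra hc
      simp only [f, zero_mul, add_zero, not_le, lt_min_iff] at hc
      exact hp ⟨u', v', w', hc.1.le, hc.2.1.le, hc.2.2.le, hs', hpp⟩
    have hf1 : 0 ≤ f 1 := by
      simp only [f, one_mul, add_sub_cancel, le_min_iff]
      exact ⟨hu, hv, hw⟩
    obtain ⟨s, ⟨h0, h1⟩, hfs⟩ := intermediate_value_Icc zero_le_one hf.continuousOn ⟨hf0, hf1⟩
    set x := u' + s * (u - u') with hx
    set y := v' + s * (v - v') with hy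
    set z := w' + s * (w - w') with hz
    have hmin : min x (min y z) = 0 := hfs
    have hx0 : 0 ≤ x := hmin ▸ min_le_left _ _
    have hy0 : 0 ≤ y := hmin ▸ (min_le_right _ _).trans (min_le_left _ _)
    have hz0 : 0 ≤ z := hmin ▸ (min_le_right _ _).trans (min_le_right _ _)
    have hxyz : x + y + z = 1 := by
      rw [hx, hy, hz]; linear_combination (1 - s) * hs' + s * hs
    have hmem : lerp s p r ∈ unitDisk p := by
      rw [mem_unitDisk] at hr ⊢
      have e : (lerp s p r 0 - p 0) ^ 2 + (lerp s p r 1 - p 1) ^ 2 =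
          s ^ 2 * ((r 0 - p 0) ^ 2 + (r 1 - p 1) ^ 2) := by
        simp [lerp]; ring
      rw [e]
      exact mul_le_one₀ (pow_le_one₀ h0 h1) (by positivity) hr
    have heq : lerp s p r = x • a + y • b + z • c := by
      have : lerp s p r = (1 - s) • p + s • r := by simp only [lerp]; module
      rw [this, hx, hy, hz, hrr]
      nth_rw 1 [hpp]
      module
    rw [heq] at hmem
    rcases min_choice x (min y z) with hc | hc
    · rw [hmin] at hc
      refine Or.inr (Or.inl ⟨z, hz0, by linarith, ?_⟩)
      convert hmem using 1
      rw [← hc, show y = 1 - z by linarith, lerp]; module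
    · rw [hmin] at hc
      rcases min_choice y z with hc' | hc' <;> rw [← hc] at hc'
      · refine Or.inr (Or.inr (Or.inl ⟨x, hx0, by linarith, ?_⟩))
        convert hmem using 1
        rw [← hc', show z = 1 - x by linarith, lerp]; module
      · refine Or.inl ⟨y, hy0, by linarith, ?_⟩
        convert hmem using 1
        rw [← hc', show x = 1 - y by linarith, lerp]; module
  · rintro (⟨s, h0, h1, hs⟩ | ⟨s, h0, h1, hs⟩ | ⟨s, h0, h1, hs⟩ | hp)
    · exact ⟨_, hs, segment_subset_triSet h0 h1⟩
    · exact ⟨_, hs, triSet_rotate a b c ▸ segment_subset_triSet h0 h1⟩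
    · exact ⟨_, hs, triSet_rotate a b c ▸ triSet_rotate b c a ▸ segment_subset_triSet h0 h1⟩
    · exact ⟨p, by simp [unitDisk], hp⟩

/-- Nonnegative pairwise products mean that the three signed areas have a common sign, whatever the
orientation. Their sum is the signed area of the whole triangle, so the quotients are nonnegative
barycentric coordinates. -/
theorem mem_triSet_iff {p a b c : Plane} (h : cross a b c ≠ 0) :
    p ∈ triSet (a, b, c) ↔ 0 ≤ cross p a b * cross p b c ∧ 0 ≤ cross p b c * cross p c a ∧
      0 ≤ cross p c a * cross p a b := by
  obtain ⟨hs', hpp⟩ := eq_barycentric h p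
  have hsum : cross p b c + cross p c a + cross p a b = cross a b c := by
    simp only [cross]; ring
  constructor
  · rintro ⟨u, v, w, hu, hv, hw, hs, rfl⟩
    have hw' : w = 1 - u - v := by linarith
    have e1 : cross (u • a + v • b + w • c) a b = w * cross a b c := by
      subst hw'; simp [cross]; ring
    have e2 : cross (u • a + v • b + w • c) b c = u * cross a b c := by
      subst hw'; simp [cross]; ring
    have e3 : cross (u • a + v • b + w • c) c a = v * cross a b c := by
      subst hw'; simp [cross]; ring
    simp only
    rw [e1, e2, e3]
    have : 0 ≤ cross a b c * cross a b c := mul_self_nonneg _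
    refine ⟨?_, ?_, ?_⟩
    · calc (0 : ℝ) ≤ (w * u) * (cross a b c * cross a b c) := by positivity
        _ = _ := by ring
    · calc (0 : ℝ) ≤ (u * v) * (cross a b c * cross a b c) := by positivity
        _ = _ := by ring
    · calc (0 : ℝ) ≤ (v * w) * (cross a b c * cross a b c) := by positivity
        _ = _ := by ring
  · rintro ⟨h1, h2, h3⟩
    have key : ∀ x : ℝ, 0 ≤ x * cross a b c → 0 ≤ x / cross a b c := by
      intro x hx
      have : x / cross a b c = x * cross a b c / (cross a b c) ^ 2 := by field_simp
      rw [this]; positivity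
    refine ⟨_, _, _, key _ ?_, key _ ?_, key _ ?_, hs', hpp⟩ <;> rw [← hsum]
    · nlinarith [mul_self_nonneg (cross p b c)]
    · nlinarith [mul_self_nonneg (cross p c a)]
    · nlinarith [mul_self_nonneg (cross p a b)]


/-! ### Geometric functions of the program -/

section GeometricFunctions

variable {q k K : ℕ}

def encCoeffs (h : ℝ × ℝ × ℝ) : Val := .pair (.num h.1) (.pair (.num h.2.1) (.num h.2.2))

def encTris (ts : List Tri) : Val := encList (ts.map encTri)

theorem fn_side (h : ℝ × ℝ × ℝ) (p : Plane) :
    Fn (prog q k K) fSide (.pair (encCoeffs h) (encPoint p)) (.num (sideOf h p)) 20 :=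
  ⟨_, rfl, Ev.mono (Ev.open rfl <| Ev.open rfl <| Ev.open rfl <| Ev.open rfl <| .num _ rfl rfl)
    (by norm_num [arithCost])⟩

theorem fn_lerp (s : ℝ) (a b : Plane) :
    Fn (prog q k K) fLerp (.pair (.num s) (.pair (encPoint a) (encPoint b)))
      (encPoint (lerp s a b)) 30 :=
  ⟨_, rfl, Ev.mono (Ev.open rfl <| Ev.open rfl <| Ev.open rfl <| Ev.open rfl <|
    .pair (.num _ rfl rfl) (.num _ rfl rfl)) (by norm_num [arithCost])⟩

theorem fn_cross (a b c : Plane) :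
    Fn (prog q k K) fCross (.pair (encPoint a) (.pair (encPoint b) (encPoint c)))
      (.num (cross a b c)) 30 :=
  ⟨_, rfl, Ev.mono (Ev.open rfl <| Ev.open rfl <| Ev.open rfl <| Ev.open rfl <| Ev.open rfl <|
    .num _ rfl rfl) (by norm_num [arithCost])⟩

theorem fn_stage (h : ℝ × ℝ × ℝ) (ts : List Tri) :
    Fn (prog q k K) fStage (.pair (encCoeffs h) (encTris ts)) (encTris (cutTris h ts))
      (200 * ts.length + 10) := by
  induction ts with
  | nil => exact ⟨_, rfl, Ev.mono (Ev.open rfl <| Ev.empty rfl .nil) (by norm_num)⟩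
  | cons t ts ih =>
    obtain ⟨a, b, c⟩ := t
    refine ⟨_, rfl, Ev.mono (Ev.open rfl <| Ev.open rfl <| Ev.open rfl <| Ev.open rfl <|
      Ev.letIn (.call (.pair (.var rfl) (.var rfl)) (fn_side h a)) <|
      Ev.letIn (.call (.pair (.var rfl) (.var rfl)) (fn_side h b)) <|
      Ev.letIn (.call (.pair (.var rfl) (.var rfl)) ih) <|
      Ev.ifLt (.num _ rfl rfl) (.num _ rfl rfl) (t₃ := 80) (fun hc => ?_) (fun hc => ?_)) ?_⟩
    · simp only [Rat.cast_zero] at hc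
      have e : cutTris h ((a, b, c) :: ts) =
          [(lerp (sideOf h a / (sideOf h a - sideOf h b)) a b, c, a),
            (b, c, lerp (sideOf h a / (sideOf h a - sideOf h b)) a b)] ++ cutTris h ts := by
        rw [cutTris, List.flatMap_cons, cutTri, if_pos hc]
        rfl
      rw [e]
      exact Ev.mono (Ev.letIn (.call (.pair (Ev.arith (.var rfl) (.num _ rfl rfl)
        (fun _ => (cut_param hc).2.2)) (.pair (.var rfl) (.var rfl))) (fn_lerp _ a b)) <|
        .pair (.pair (.var rfl) (.pair (.var rfl) (.var rfl)))
          (.pair (.pair (.var rfl) (.pair (.var rfl) (.var rfl))) (.var rfl)))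
        (by norm_num [arithCost])
    · simp only [Rat.cast_zero] at hc
      have e : cutTris h ((a, b, c) :: ts) = (b, c, a) :: cutTris h ts := by
        rw [cutTris, List.flatMap_cons, cutTri, if_neg (not_lt.2 hc)]
        rfl
      rw [e]
      exact Ev.mono (Ev.pair (.pair (.var rfl) (.pair (.var rfl) (.var rfl))) (.var rfl))
        (by norm_num)
    · norm_num [arithCost]; linarith

theorem fn_keep (h : ℝ × ℝ × ℝ) (ts : List Tri) :
    Fn (prog q k K) fKeep (.pair (encCoeffs h) (encTris ts)) (encTris (keepTris h ts))
      (150 * ts.length + 10) := by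
  induction ts with
  | nil => exact ⟨_, rfl, Ev.mono (Ev.open rfl <| Ev.empty rfl .nil) (by norm_num)⟩
  | cons t ts ih =>
    obtain ⟨a, b, c⟩ := t
    have hc : keepTris h ((a, b, c) :: ts) =
        if 0 ≤ sideOf h a ∧ 0 ≤ sideOf h b ∧ 0 ≤ sideOf h c then (a, b, c) :: keepTris h ts
        else keepTris h ts := by
      simp only [keepTris, List.filter_cons, decide_eq_true_eq]
    refine ⟨_, rfl, Ev.mono (Ev.open rfl <| Ev.open rfl <| Ev.open rfl <| Ev.open rfl <|
      Ev.letIn (.call (.pair (.var rfl) (.var rfl)) ih) <|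
      Ev.ifLt (.call (.pair (.var rfl) (.var rfl)) (fn_side h a)) (.num _ rfl rfl) (t₃ := 75)
        (fun h1 => ?_) (fun h1 => ?_)) (by norm_num [arithCost]; linarith)⟩ <;>
      simp only [Rat.cast_zero] at h1
    · rw [hc, if_neg (by grind)]
      exact Ev.mono (.var rfl) (by norm_num)
    refine Ev.mono (Ev.ifLt (.call (.pair (.var rfl) (.var rfl)) (fn_side h b)) (.num _ rfl rfl)
      (t₃ := 40) (fun h2 => ?_) (fun h2 => ?_)) (by norm_num [arithCost]) <;>
      simp only [Rat.cast_zero] at h2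
    · rw [hc, if_neg (by grind)]
      exact Ev.mono (.var rfl) (by norm_num)
    refine Ev.mono (Ev.ifLt (.call (.pair (.var rfl) (.var rfl)) (fn_side h c)) (.num _ rfl rfl)
      (t₃ := 4) (fun h3 => ?_) (fun h3 => ?_)) (by norm_num [arithCost]) <;>
      simp only [Rat.cast_zero] at h3
    · rw [hc, if_neg (by grind)]
      exact Ev.mono (.var rfl) (by norm_num)
    · rw [hc, if_pos ⟨h1, h2, h3⟩]
      exact Ev.mono (.pair (.var rfl) (.var rfl)) (by norm_num)

theorem fn_clip (h : ℝ × ℝ × ℝ) (ts : List Tri) :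
    Fn (prog q k K) fClip (.pair (encCoeffs h) (encTris ts)) (encTris (clipTris h ts))
      (2600 * ts.length + 80) := by
  refine ⟨_, rfl, Ev.mono (Ev.open rfl <| .call (.pair (.var rfl) <| .call (.pair (.var rfl) <|
    .call (.pair (.var rfl) <| .call (.pair (.var rfl) (.var rfl)) (fn_stage h _)) (fn_stage h _))
    (fn_stage h _)) (fn_keep h _)) ?_⟩
  have h1 := length_cutTris_le h ts
  have h2 := length_cutTris_le h (cutTris h ts)
  have h3 := length_cutTris_le h (cutTris h (cutTris h ts))
  have h1' : ((cutTris h ts).length : ℝ) ≤ 2 * ts.length := by exact_mod_cast h1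
  have h2' : ((cutTris h (cutTris h ts)).length : ℝ) ≤ 4 * ts.length := by
    have : (cutTris h (cutTris h ts)).length ≤ 4 * ts.length := by omega
    exact_mod_cast this
  have h3' : ((cutTris h (cutTris h (cutTris h ts))).length : ℝ) ≤ 8 * ts.length := by
    have : (cutTris h (cutTris h (cutTris h ts))).length ≤ 8 * ts.length := by omega
    exact_mod_cast this
  linarith

theorem fn_near (p : Plane) {a b : Plane} (hab : a ≠ b) :
    ∃ x : ℝ, Fn (prog q k K) fNear (.pair (encPoint p) (.pair (encPoint a) (encPoint b)))
      (.num x) 80 ∧ (0 < x ↔ NearSegment p a b) := by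
  classical
  have test : ∀ {env : List Val} {e₁ e₂ : Expr} {x y t₁ t₂ : ℝ},
      Ev (prog q k K) env e₁ (.num x) t₁ → Ev (prog q k K) env e₂ (.num y) t₂ →
      Ev (prog q k K) env (.ifLt e₁ e₂ (cst 0) (cst 1)) (.num (if y ≤ x then 1 else 0))
        (t₁ + t₂ + 2) := by
    intro env e₁ e₂ x y t₁ t₂ h1 h2
    refine Ev.mono (Ev.ifLt h1 h2 (t₃ := 1) (fun h => ?_) (fun h => ?_)) (by linarith)
    · rw [if_neg (not_le.2 h)]; simpa using Ev.const (q := 0)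
    · rw [if_pos h]; simpa using Ev.const (q := 1)
  have hpos : ∀ {Q : Prop} [Decidable Q], 0 < (if Q then (1 : ℝ) else 0) ↔ Q := by
    intro Q _; split_ifs with h <;> simp [h]
  rcases lt_or_ge (dotAt p a b) 0 with h0 | h0
  · refine ⟨if dotAt p a p ≤ 1 then 1 else 0, ⟨_, rfl, Ev.mono (Ev.open rfl <| Ev.open rfl <|
      Ev.open rfl <| Ev.open rfl <| Ev.open rfl <| Ev.letIn (.num (x := dotAt p a b) _ rfl rfl) <|
      Ev.letIn (.num (x := dotAt b a b) _ rfl rfl) <|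
      Ev.ifLt_true (.var rfl) (.num _ rfl rfl) (by simpa using h0) <|
      test (.num 1 (by simp [arithEval]) rfl) (.num _ rfl rfl)) (by norm_num [arithCost])⟩, ?_⟩
    rw [hpos, nearSegment_iff_of_neg hab h0]
  rcases lt_or_ge (dotAt b a b) (dotAt p a b) with h1 | h1
  · refine ⟨if dotAt p b p ≤ 1 then 1 else 0, ⟨_, rfl, Ev.mono (Ev.open rfl <| Ev.open rfl <|
      Ev.open rfl <| Ev.open rfl <| Ev.open rfl <| Ev.letIn (.num (x := dotAt p a b) _ rfl rfl) <|
      Ev.letIn (.num (x := dotAt b a b) _ rfl rfl) <|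
      Ev.ifLt_false (.var rfl) (.num _ rfl rfl) (by simpa using h0) <|
      Ev.ifLt_true (.var rfl) (.var rfl) h1 <|
      test (.num 1 (by simp [arithEval]) rfl) (.num _ rfl rfl)) (by norm_num [arithCost])⟩, ?_⟩
    rw [hpos, nearSegment_iff_of_lt hab h1]
  · refine ⟨_, ⟨_, rfl, Ev.mono (Ev.open rfl <| Ev.open rfl <|
      Ev.open rfl <| Ev.open rfl <| Ev.open rfl <| Ev.letIn (.num (x := dotAt p a b) _ rfl rfl) <|
      Ev.letIn (.num (x := dotAt b a b) _ rfl rfl) <|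
      Ev.ifLt_false (.var rfl) (.num _ rfl rfl) (by simpa using h0) <|
      Ev.ifLt_false (.var rfl) (.var rfl) h1 <| Ev.letIn (.num _ rfl rfl) <|
      test (.var rfl) (.num _ rfl rfl)) (by norm_num [arithCost])⟩, ?_⟩
    rw [hpos, nearSegment_iff_of_mid hab h0 h1]

theorem ne_of_cross_ne_zero {a b c : Plane} (h : cross a b c ≠ 0) : a ≠ b := by
  rintro rfl; simp [cross] at h

theorem fn_tri (p : Plane) (t : Tri) (ht : t.Proper) :
    ∃ x : ℝ, Fn (prog q k K) fTri (.pair (encPoint p) (encTri t)) (.num x) 450 ∧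
      (0 < x ↔ (unitDisk p ∩ triSet t).Nonempty) := by
  obtain ⟨a, b, c⟩ := t
  have hbc : cross b c a = cross a b c := by simp only [cross]; ring
  have hca : cross c a b = cross a b c := by simp only [cross]; ring
  have h : cross a b c ≠ 0 := ht
  obtain ⟨x₁, f₁, e₁⟩ := fn_near (q := q) (k := k) (K := K) p (ne_of_cross_ne_zero h)
  obtain ⟨x₂, f₂, e₂⟩ := fn_near (q := q) (k := k) (K := K) p (ne_of_cross_ne_zero (hbc ▸ h))
  obtain ⟨x₃, f₃, e₃⟩ := fn_near (q := q) (k := k) (K := K) p (ne_of_cross_ne_zero (hca ▸ h))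
  rw [disk_meets_triSet_iff h, mem_triSet_iff h, ← e₁, ← e₂, ← e₃]
  have c1 : ∀ {env : List Val}, Ev (prog q k K) env (cst 1) (.num 1) 1 := by
    intro env; simpa using Ev.const (q := 1)
  have c0 : ∀ {env : List Val}, Ev (prog q k K) env (cst 0) (.num 0) 1 := by
    intro env; simpa using Ev.const (q := 0)
  rcases lt_or_ge 0 x₁ with h1 | h1
  · refine ⟨1, ⟨_, rfl, Ev.mono (Ev.open rfl <| Ev.open rfl <| Ev.open rfl <|
      Ev.ifLt_true c0 (.call (.pair (.var rfl) (.pair (.var rfl) (.var rfl))) f₁) h1 c1)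
      (by norm_num)⟩, by simp [h1]⟩
  rcases lt_or_ge 0 x₂ with h2 | h2
  · refine ⟨1, ⟨_, rfl, Ev.mono (Ev.open rfl <| Ev.open rfl <| Ev.open rfl <|
      Ev.ifLt_false c0 (.call (.pair (.var rfl) (.pair (.var rfl) (.var rfl))) f₁) h1 <|
      Ev.ifLt_true c0 (.call (.pair (.var rfl) (.pair (.var rfl) (.var rfl))) f₂) h2 c1)
      (by norm_num)⟩, by simp [h2]⟩
  rcases lt_or_ge 0 x₃ with h3 | h3
  · refine ⟨1, ⟨_, rfl, Ev.mono (Ev.open rfl <| Ev.open rfl <| Ev.open rfl <|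
      Ev.ifLt_false c0 (.call (.pair (.var rfl) (.pair (.var rfl) (.var rfl))) f₁) h1 <|
      Ev.ifLt_false c0 (.call (.pair (.var rfl) (.pair (.var rfl) (.var rfl))) f₂) h2 <|
      Ev.ifLt_true c0 (.call (.pair (.var rfl) (.pair (.var rfl) (.var rfl))) f₃) h3 c1)
      (by norm_num)⟩, by simp [h3]⟩
  have main : ∃ x : ℝ, (0 < x ↔ 0 ≤ cross p a b * cross p b c ∧
      0 ≤ cross p b c * cross p c a ∧ 0 ≤ cross p c a * cross p a b) ∧
      ∀ env, Ev (prog q k K) (.num (cross p c a) :: .num (cross p b c) :: .num (cross p a b) :: env)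
        (.ifLt (.mul (.var 2) (.var 1)) (cst 0) (cst 0) <|
          .ifLt (.mul (.var 1) (.var 0)) (cst 0) (cst 0) <|
          .ifLt (.mul (.var 0) (.var 2)) (cst 0) (cst 0) (cst 1)) (.num x) 17 := by
    rcases lt_or_ge (cross p a b * cross p b c) 0 with g1 | g1
    · exact ⟨0, by grind, fun env => Ev.mono (Ev.ifLt_true (.num _ rfl rfl) c0 g1 c0)
        (by norm_num [arithCost])⟩
    rcases lt_or_ge (cross p b c * cross p c a) 0 with g2 | g2
    · exact ⟨0, by grind, fun env => Ev.mono (Ev.ifLt_false (.num _ rfl rfl) c0 g1 <|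
        Ev.ifLt_true (.num _ rfl rfl) c0 g2 c0) (by norm_num [arithCost])⟩
    rcases lt_or_ge (cross p c a * cross p a b) 0 with g3 | g3
    · exact ⟨0, by grind, fun env => Ev.mono (Ev.ifLt_false (.num _ rfl rfl) c0 g1 <|
        Ev.ifLt_false (.num _ rfl rfl) c0 g2 <|
        Ev.ifLt_true (.num _ rfl rfl) c0 g3 c0) (by norm_num [arithCost])⟩
    · exact ⟨1, by grind, fun env => Ev.mono (Ev.ifLt_false (.num _ rfl rfl) c0 g1 <|
        Ev.ifLt_false (.num _ rfl rfl) c0 g2 <|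
        Ev.ifLt_false (.num _ rfl rfl) c0 g3 c1) (by norm_num [arithCost])⟩
  obtain ⟨x, hx, hev⟩ := main
  refine ⟨x, ⟨_, rfl, Ev.mono (Ev.open rfl <| Ev.open rfl <| Ev.open rfl <|
      Ev.ifLt_false c0 (.call (.pair (.var rfl) (.pair (.var rfl) (.var rfl))) f₁) h1 <|
      Ev.ifLt_false c0 (.call (.pair (.var rfl) (.pair (.var rfl) (.var rfl))) f₂) h2 <|
      Ev.ifLt_false c0 (.call (.pair (.var rfl) (.pair (.var rfl) (.var rfl))) f₃) h3 <|
      Ev.letIn (.call (.pair (.var rfl) (.pair (.var rfl) (.var rfl))) (fn_cross p a b)) <|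
      Ev.letIn (.call (.pair (.var rfl) (.pair (.var rfl) (.var rfl))) (fn_cross p b c)) <|
      Ev.letIn (.call (.pair (.var rfl) (.pair (.var rfl) (.var rfl))) (fn_cross p c a)) <|
      hev _) (by norm_num)⟩, ?_⟩
  rw [hx]
  simp [not_lt.2 h1, not_lt.2 h2, not_lt.2 h3]

theorem fn_hit (p : Plane) (ts : List Tri) (hts : ∀ t ∈ ts, t.Proper) :
    ∃ x : ℝ, Fn (prog q k K) fHit (.pair (encPoint p) (encTris ts)) (.num x)
      (500 * ts.length + 10) ∧ (0 < x ↔ (unitDisk p ∩ cover ts).Nonempty) := by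
  induction ts with
  | nil => exact ⟨0, ⟨_, rfl, Ev.mono (Ev.open rfl <| Ev.empty rfl (.num _ rfl (by simp)))
      (by norm_num [arithCost])⟩, by simp [cover]⟩
  | cons t ts ih =>
    obtain ⟨y, hy, hy'⟩ := ih fun t ht => hts t (List.mem_cons_of_mem _ ht)
    obtain ⟨x, hx, hx'⟩ := fn_tri (q := q) (k := k) (K := K) p t (hts t List.mem_cons_self)
    have hcov : (unitDisk p ∩ cover (t :: ts)).Nonempty ↔
        (unitDisk p ∩ triSet t).Nonempty ∨ (unitDisk p ∩ cover ts).Nonempty := by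
      rw [← Set.union_nonempty, ← Set.inter_union_distrib_left]
      have : cover (t :: ts) = triSet t ∪ cover ts := by
        ext r; simp [cover]
      rw [this]
    rw [hcov, ← hx', ← hy']
    rcases lt_or_ge 0 x with h | h
    · exact ⟨1, ⟨_, rfl, Ev.mono (Ev.open rfl <| Ev.open rfl <| Ev.ifLt_true (.num _ rfl rfl)
        (.call (.pair (.var rfl) (.var rfl)) hx) (by simpa using h) (.num _ rfl (by simp)))
        (by norm_num [arithCost]; linarith)⟩, by simp [h]⟩
    · exact ⟨y, ⟨_, rfl, Ev.mono (Ev.open rfl <| Ev.open rfl <| Ev.ifLt_false (.num _ rfl rfl)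
        (.call (.pair (.var rfl) (.var rfl)) hx) (by simpa using h)
        (.call (.pair (.var rfl) (.var rfl)) hy))
        (by norm_num [arithCost]; linarith)⟩, by simp [not_lt.2 h]⟩

-- Filtering keeps the order of the list, so below the root nothing is sorted again.
open Classical in
theorem fn_filter {ι : Type*} (key : ι → ℝ) (c : ι → Plane) (ts : List Tri)
    (hts : ∀ t ∈ ts, t.Proper) (L : List ι) :
    Fn (prog q k K) fFilter
      (.pair (encTris ts) (encKeyed key (fun i => encPoint (c i)) L))
      (encKeyed key (fun i => encPoint (c i))
        (L.filter fun i => (unitDisk (c i) ∩ cover ts).Nonempty))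
      ((500 * ts.length + 50) * L.length + 10) := by
  induction L with
  | nil => exact ⟨_, rfl, Ev.mono (Ev.open rfl <| Ev.empty rfl .nil) (by norm_num)⟩
  | cons i L ih =>
    obtain ⟨x, hx, hx'⟩ := fn_hit (q := q) (k := k) (K := K) (c i) ts hts
    rw [List.filter_cons]
    simp only [decide_eq_true_eq, ← hx']
    refine ⟨_, rfl, Ev.mono (Ev.open rfl <| Ev.open rfl <|
      Ev.letIn (.call (.pair (.var rfl) (.var rfl)) ih) <| Ev.open rfl <|
      Ev.ifLt (.num _ rfl rfl) (.call (.pair (.var rfl) (.var rfl)) hx) (t₃ := 3)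
        (fun h => ?_) (fun h => ?_)) ?_⟩
    · rw [if_pos (by simpa using h)]
      exact Ev.mono (.pair (.var rfl) (.var rfl)) (by norm_num)
    · rw [if_neg (by simpa using h)]
      exact Ev.mono (.var rfl) (by norm_num)
    · norm_num [arithCost]; linarith

end GeometricFunctions


/-! ### Bands -/

/-- The affine functions that define the directions of the lines. -/
def proj (j : ℕ) (p : Plane) : ℝ := p 0 + j * p 1

/-- A strip, together with a list of disks. -/
structure Band (ι : Type*) where
  slope : ℕ
  lo : ℝ
  hi : ℝ
  disks : List ι

def mkPoint (x y : ℝ) : Plane := !₂[x, y]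

@[simp] theorem mkPoint_zero (x y : ℝ) : mkPoint x y 0 = x := by simp [mkPoint]

@[simp] theorem mkPoint_one (x y : ℝ) : mkPoint x y 1 = y := by simp [mkPoint]

theorem proj_add_le {j : ℕ} {p : Plane} {M : ℝ} (h0 : |p 0| ≤ M) (h1 : |p 1| ≤ M) :
    |proj j p| ≤ (j + 1) * M := by
  calc |proj j p| ≤ |p 0| + |(j : ℝ) * p 1| := abs_add_le _ _
    _ = |p 0| + j * |p 1| := by rw [abs_mul, Nat.abs_cast]
    _ ≤ M + j * M := by gcongr
    _ = _ := by ring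

theorem proj_lerp (j : ℕ) (s : ℝ) (a b : Plane) :
    proj j (lerp s a b) = (1 - s) * proj j a + s * proj j b := by
  simp [proj, lerp]; ring

/-- The line on which `proj j` has the value `t`. -/
def bandLine (j : ℕ) (t : ℝ) : DirLine where
  point := mkPoint t 0
  dir := mkPoint j (-1)
  dir_ne h := by simpa using congrArg (fun p : Plane => p 1) h

theorem side_bandLine (j : ℕ) (t : ℝ) (p : Plane) : (bandLine j t).side p = proj j p - t := by
  simp [bandLine, DirLine.side, proj]; ring

def square (M : ℝ) : Set Plane := {p | |p 0| ≤ M ∧ |p 1| ≤ M}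

/-- Used to state that the part of a region inside the square has an interior point. -/
def openSquare (M : ℝ) : Set Plane := {p | |p 0| < M ∧ |p 1| < M}

section BandLists

variable {q k K : ℕ} {ι : Type*} {c : ι → Plane}

def bandSet (bands : List (Band ι)) : Set Plane :=
  {p | ∀ b ∈ bands, b.lo ≤ proj b.slope p ∧ proj b.slope p ≤ b.hi}

def openBandSet (bands : List (Band ι)) : Set Plane :=
  {p | ∀ b ∈ bands, b.lo < proj b.slope p ∧ proj b.slope p < b.hi}

/-- The subtraction from `0` mirrors the expression in `bodyRegion`, as the machine has no negation.
-/
def Band.loCoeffs (b : Band ι) : ℝ × ℝ × ℝ := (1, b.slope, 0 - b.lo)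

def Band.hiCoeffs (b : Band ι) : ℝ × ℝ × ℝ := (-1, 0 - b.slope, b.hi)

theorem sideOf_loCoeffs (b : Band ι) (p : Plane) :
    sideOf b.loCoeffs p = proj b.slope p - b.lo := by
  simp [sideOf, Band.loCoeffs, proj]; ring

theorem sideOf_hiCoeffs (b : Band ι) (p : Plane) :
    sideOf b.hiCoeffs p = b.hi - proj b.slope p := by
  simp [sideOf, Band.hiCoeffs, proj]; ring

/-- The parts of triangles inside all bands. -/
def regionTris : List (Band ι) → List Tri → List Tri
  | [], ts => ts
  | b :: bands, ts => regionTris bands (clipTris b.hiCoeffs (clipTris b.loCoeffs ts))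

/-- Each band is two clips, and a clip multiplies the number of triangles by at most `8`. -/
theorem length_regionTris_le (bands : List (Band ι)) (ts : List Tri) :
    (regionTris bands ts).length ≤ 64 ^ bands.length * ts.length := by
  induction bands generalizing ts with
  | nil => simp [regionTris]
  | cons b bands ih =>
    have h1 := length_clipTris_le b.loCoeffs ts
    have h2 := length_clipTris_le b.hiCoeffs (clipTris b.loCoeffs ts)
    calc (regionTris (b :: bands) ts).length ≤ 64 ^ bands.length * _ := ih _
      _ ≤ 64 ^ bands.length * (64 * ts.length) := Nat.mul_le_mul_left _ (by omega)
      _ = _ := by rw [List.length_cons, pow_succ, mul_assoc]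

theorem proper_regionTris (bands : List (Band ι)) (ts : List Tri) (h : ∀ t ∈ ts, t.Proper) :
    ∀ t ∈ regionTris bands ts, t.Proper := by
  induction bands generalizing ts with
  | nil => exact h
  | cons b bands ih => exact ih _ (proper_clipTris (proper_clipTris h))

theorem cover_regionTris_subset (bands : List (Band ι)) (ts : List Tri) :
    cover (regionTris bands ts) ⊆ cover ts ∩ bandSet bands := by
  induction bands generalizing ts with
  | nil => intro p hp; exact ⟨hp, by simp [bandSet]⟩
  | cons b bands ih =>
    intro p hp
    obtain ⟨h1, h2⟩ := ih _ hp
    obtain ⟨h3, h4⟩ := cover_clipTris_subset _ _ h1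
    obtain ⟨h5, h6⟩ := cover_clipTris_subset _ _ h3
    refine ⟨h5, fun b' hb' => ?_⟩
    rcases List.mem_cons.1 hb' with rfl | hb'
    · rw [Set.mem_ofPred_eq, sideOf_hiCoeffs] at h4
      rw [Set.mem_ofPred_eq, sideOf_loCoeffs] at h6
      constructor <;> linarith
    · exact h2 b' hb'

theorem subset_cover_regionTris (bands : List (Band ι)) (ts : List Tri) :
    cover ts ∩ openBandSet bands ⊆ cover (regionTris bands ts) := by
  induction bands generalizing ts with
  | nil => rintro p ⟨hp, -⟩; exact hp
  | cons b bands ih =>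
    rintro p ⟨hp, hb⟩
    have hb' := hb b List.mem_cons_self
    refine ih _ ⟨subset_cover_clipTris _ _ ⟨subset_cover_clipTris _ _ ⟨hp, ?_⟩, ?_⟩,
      fun b' h' => hb b' (List.mem_cons_of_mem _ h')⟩
    · rw [Set.mem_ofPred_eq, sideOf_loCoeffs]; linarith
    · rw [Set.mem_ofPred_eq, sideOf_hiCoeffs]; linarith

/-- Two triangles that form a square. -/
def squareTris (M : ℝ) : List Tri :=
  [(mkPoint (0 - M) (0 - M), mkPoint M (0 - M), mkPoint M M),
    (mkPoint (0 - M) (0 - M), mkPoint M M, mkPoint (0 - M) M)]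

theorem proper_squareTris {M : ℝ} (hM : 0 < M) : ∀ t ∈ squareTris M, t.Proper := by
  intro t ht
  simp only [squareTris, List.mem_cons, List.not_mem_nil, or_false] at ht
  rcases ht with rfl | rfl <;> simp only [Tri.Proper, cross, mkPoint_zero, mkPoint_one] <;> nlinarith

theorem cover_squareTris {M : ℝ} (hM : 0 < M) : cover (squareTris M) = square M := by
  have hM' := hM.ne'
  ext p
  simp only [cover, squareTris, List.mem_cons, List.not_mem_nil, or_false, exists_eq_or_imp,
    exists_eq_left, square, abs_le]
  constructor
  · rintro (⟨u, v, w, hu, hv, hw, hs, rfl⟩ | ⟨u, v, w, hu, hv, hw, hs, rfl⟩) <;>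
    · simp only [Set.mem_ofPred_eq, PiLp.add_apply, PiLp.smul_apply, smul_eq_mul, mkPoint_zero,
        mkPoint_one]
      have hu' : u = 1 - v - w := by linarith
      subst hu'
      refine ⟨⟨?_, ?_⟩, ?_, ?_⟩ <;> nlinarith [mul_nonneg hu hM.le, mul_nonneg hv hM.le,
        mul_nonneg hw hM.le]
  · rintro ⟨⟨h1, h2⟩, h3, h4⟩
    rcases le_total (p 1) (p 0) with h | h
    · refine Or.inl ⟨(M - p 0) / (2 * M), (p 0 - p 1) / (2 * M), (p 1 + M) / (2 * M),
        div_nonneg (by linarith) (by linarith), div_nonneg (by linarith) (by linarith),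
        div_nonneg (by linarith) (by linarith), by field_simp; ring, ?_⟩
      apply plane_ext <;>
      · simp only [PiLp.add_apply, PiLp.smul_apply, smul_eq_mul, mkPoint_zero, mkPoint_one]
        field_simp; ring
    · refine Or.inr ⟨(M - p 1) / (2 * M), (p 0 + M) / (2 * M), (p 1 - p 0) / (2 * M),
        div_nonneg (by linarith) (by linarith), div_nonneg (by linarith) (by linarith),
        div_nonneg (by linarith) (by linarith), by field_simp; ring, ?_⟩
      apply plane_ext <;>
      · simp only [PiLp.add_apply, PiLp.smul_apply, smul_eq_mul, mkPoint_zero, mkPoint_one]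
        field_simp; ring

theorem comb_lt {s x y z : ℝ} (h0 : 0 < s) (h1 : s ≤ 1) (hx : x ≤ z) (hy : y < z) :
    (1 - s) * x + s * y < z := by
  nlinarith [mul_nonneg (sub_nonneg.2 h1) (sub_nonneg.2 hx), mul_pos h0 (sub_pos.2 hy)]

theorem lt_comb {s x y z : ℝ} (h0 : 0 < s) (h1 : s ≤ 1) (hx : z ≤ x) (hy : z < y) :
    z < (1 - s) * x + s * y := by
  nlinarith [mul_nonneg (sub_nonneg.2 h1) (sub_nonneg.2 hx), mul_pos h0 (sub_pos.2 hy)]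

/-- Convexity: a segment from a point of the closed region to an interior point is interior except
possibly at its start. -/
theorem lerp_mem_open {M s : ℝ} {bands : List (Band ι)} {p z : Plane}
    (hp : p ∈ square M ∩ bandSet bands) (hz : z ∈ openSquare M ∩ openBandSet bands)
    (h0 : 0 < s) (h1 : s ≤ 1) : lerp s p z ∈ openSquare M ∩ openBandSet bands := by
  have e0 : lerp s p z 0 = (1 - s) * p 0 + s * z 0 := by simp [lerp]; ring
  have e1 : lerp s p z 1 = (1 - s) * p 1 + s * z 1 := by simp [lerp]; ring
  obtain ⟨⟨p0, p1⟩, pb⟩ := hp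
  obtain ⟨⟨z0, z1⟩, zb⟩ := hz
  rw [abs_le] at p0 p1
  rw [abs_lt] at z0 z1
  refine ⟨⟨?_, ?_⟩, fun b hb => ?_⟩
  · rw [e0, abs_lt]
    exact ⟨lt_comb h0 h1 p0.1 z0.1, comb_lt h0 h1 p0.2 z0.2⟩
  · rw [e1, abs_lt]
    exact ⟨lt_comb h0 h1 p1.1 z1.1, comb_lt h0 h1 p1.2 z1.2⟩
  · rw [proj_lerp]
    exact ⟨lt_comb h0 h1 (pb b hb).1 (zb b hb).1, comb_lt h0 h1 (pb b hb).2 (zb b hb).2⟩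

/-- Clipping surely retains only points strictly inside the bands. For an arbitrary point `p` of the
closed region, the half-open segment towards an interior point `z` is retained, and the cover is
closed, so `p` belongs to it too. -/
theorem cover_regionTris {M : ℝ} (hM : 0 < M) (bands : List (Band ι))
    (h : (openSquare M ∩ openBandSet bands).Nonempty) :
    cover (regionTris bands (squareTris M)) = square M ∩ bandSet bands := by
  apply Set.Subset.antisymm
  · rw [← cover_squareTris hM]
    exact cover_regionTris_subset _ _
  · intro p hp
    obtain ⟨z, hz⟩ := h
    have hcl : IsClosed ((fun s : ℝ => lerp s p z) ⁻¹'
        cover (regionTris bands (squareTris M))) := by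
      refine (isClosed_cover _ (proper_regionTris _ _ (proper_squareTris hM))).preimage ?_
      unfold lerp
      fun_prop
    have hsub : Set.Ioc (0 : ℝ) 1 ⊆ (fun s : ℝ => lerp s p z) ⁻¹'
        cover (regionTris bands (squareTris M)) := by
      rintro s ⟨h0, h1⟩
      obtain ⟨⟨a0, a1⟩, a2⟩ := lerp_mem_open hp hz h0 h1
      exact subset_cover_regionTris _ _ ⟨by rw [cover_squareTris hM]; exact ⟨a0.le, a1.le⟩, a2⟩
    have := hcl.closure_subset_iff.2 hsub
    rw [closure_Ioc (by norm_num)] at this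
    simpa [lerp] using this ⟨le_rfl, zero_le_one⟩

/-! ### Operations on bands in the program. -/

/-- The code of a band. -/
def encBand (c : ι → Plane) (b : Band ι) : Val :=
  .pair (.num b.slope) (.pair (.num b.lo) (.pair (.num b.hi)
    (encKeyed (fun i => proj b.slope (c i)) (fun i => encPoint (c i)) b.disks)))

def encBands (c : ι → Plane) (bands : List (Band ι)) : Val := encList (bands.map (encBand c))

/-- The bound is exponential in the number of bands, which is a constant, the number of slopes. -/
theorem fn_region (bands : List (Band ι)) (ts : List Tri) :
    Fn (prog q k K) fRegion (.pair (encBands c bands) (encTris ts))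
      (encTris (regionTris bands ts))
      (30000 * (bands.length + 1) * 64 ^ bands.length * (ts.length + 1)) := by
  induction bands generalizing ts with
  | nil =>
    refine ⟨_, rfl, Ev.mono (Ev.open rfl <| Ev.empty rfl <| .var rfl) ?_⟩
    norm_num; linarith [Nat.cast_nonneg (α := ℝ) ts.length]
  | cons b bands ih =>
    refine ⟨_, rfl, Ev.mono (Ev.open rfl <| Ev.open rfl <| Ev.open rfl <| Ev.open rfl <|
      Ev.open rfl <| .call (.pair (.var rfl) (.call (.pair
        (.pair (.num _ rfl (by simp [Band.hiCoeffs]))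
          (.pair (.num _ rfl (by simp [Band.hiCoeffs])) (.var rfl)))
        (.call (.pair (.pair (.num _ rfl (by simp [Band.loCoeffs]))
          (.pair (.var rfl) (.num _ rfl (by simp [Band.loCoeffs])))) (.var rfl))
          (fn_clip b.loCoeffs ts))) (fn_clip b.hiCoeffs _))) (ih _)) ?_⟩
    have h1 := length_clipTris_le b.loCoeffs ts
    have h2 := length_clipTris_le b.hiCoeffs (clipTris b.loCoeffs ts)
    set X := clipTris b.loCoeffs ts
    set Y := clipTris b.hiCoeffs X
    have h1' : (X.length : ℝ) ≤ 8 * ts.length := by exact_mod_cast h1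
    have h2' : (Y.length : ℝ) ≤ 64 * ts.length := by
      have : Y.length ≤ 64 * ts.length := by omega
      exact_mod_cast this
    have h3 : (1 : ℝ) ≤ 64 ^ bands.length := one_le_pow₀ (by norm_num)
    have h4 : (0 : ℝ) ≤ ts.length := Nat.cast_nonneg _
    have h5 : (30000 : ℝ) * (bands.length + 1) * 64 ^ bands.length * (Y.length + 1) ≤
        30000 * (bands.length + 1) * 64 ^ bands.length * (64 * (ts.length + 1)) := by
      gcongr; linarith
    have h6 : (30000 : ℝ) * (ts.length + 1) ≤
        30000 * (64 * 64 ^ bands.length) * (ts.length + 1) := by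
      gcongr; linarith
    norm_num [arithCost]
    rw [pow_succ]
    linarith

theorem fn_box (M : ℝ) :
    Fn (prog q k K) fBox (.num M) (encTris (squareTris M)) 40 := by
  refine ⟨_, rfl, Ev.mono (Ev.letIn (.num (x := 0 - M) _ rfl (by simp)) ?_) (t₁ := 3 + 35 + 1)
    (by norm_num)⟩
  · have e : encTris (squareTris M) = .pair (.pair (.pair (.num (0 - M)) (.num (0 - M)))
        (.pair (.pair (.num M) (.num (0 - M))) (.pair (.num M) (.num M))))
        (.pair (.pair (.pair (.num (0 - M)) (.num (0 - M)))
        (.pair (.pair (.num M) (.num M)) (.pair (.num (0 - M)) (.num M)))) .nil) := by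
      simp [encTris, squareTris, encTri, encPoint, encList]
    rw [e]
    refine Ev.mono (.pair (.pair (.pair (.var rfl) (.var rfl)) (.pair (.pair (.var rfl) (.var rfl))
      (.pair (.var rfl) (.var rfl)))) (.pair (.pair (.pair (.var rfl) (.var rfl))
      (.pair (.pair (.var rfl) (.var rfl)) (.pair (.var rfl) (.var rfl)))) .nil)) (by norm_num)

open Classical in
/-- The band with the disks that meet one of the triangles of a list. -/
def Band.restrict (c : ι → Plane) (ts : List Tri) (b : Band ι) : Band ι :=
  { b with disks := b.disks.filter fun i => (unitDisk (c i) ∩ cover ts).Nonempty }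

theorem fn_filterDirs (ts : List Tri) (hts : ∀ t ∈ ts, t.Proper) (d : ℕ) (bands : List (Band ι))
    (hd : ∀ b ∈ bands, b.disks.length = d) :
    Fn (prog q k K) fFilterDirs (.pair (encTris ts) (encBands c bands))
      (encBands c (bands.map (Band.restrict c ts)))
      (((500 * ts.length + 50) * d + 50) * bands.length + 10) := by
  induction bands with
  | nil => exact ⟨_, rfl, Ev.mono (Ev.open rfl <| Ev.empty rfl .nil) (by norm_num)⟩
  | cons b bands ih =>
    have := fn_filter (q := q) (k := k) (K := K) (fun i => proj b.slope (c i)) c ts hts b.disks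
    rw [hd b List.mem_cons_self] at this
    refine ⟨_, rfl, Ev.mono (Ev.open rfl <| Ev.open rfl <| Ev.open rfl <| Ev.open rfl <|
      Ev.open rfl <| .pair (.pair (.var rfl) (.pair (.var rfl) (.pair (.var rfl)
        (.call (.pair (.var rfl) (.var rfl)) this)))) (.call (.pair (.var rfl) (.var rfl))
          (ih fun b hb => hd b (List.mem_cons_of_mem _ hb)))) ?_⟩
    norm_num; linarith

/-- Induction on the number `r` of slopes still to be treated. All sorting of the algorithm is done
here, once for each slope. -/
theorem fn_init (B : ℝ) (L : List ι) (r : ℕ) :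
    ∀ j : ℕ, j + r = k → ∃ bands : List (Band ι), bands.map Band.slope = List.range' j r ∧
      (∀ b ∈ bands, b.lo = -B ∧ b.hi = B ∧ b.disks.Perm L ∧
        b.disks.Pairwise fun i i' => proj b.slope (c i) ≤ proj b.slope (c i')) ∧
      Fn (prog q k K) fInit
        (.pair (.num j) (.pair (.num B) (encList (L.map fun i => encPoint (c i)))))
        (encBands c bands)
        ((sortConst * (L.length * Real.log L.length) + 30 * L.length + 70) * r + 20) := by
  induction r with
  | zero =>
    intro j hj
    refine ⟨[], rfl, by simp, _, rfl, Ev.mono (Ev.open rfl <| Ev.open rfl <|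
      Ev.ifLt_false (.var rfl) (.num _ rfl rfl) ?_ .nil) (by norm_num [arithCost])⟩
    rw [Rat.cast_natCast]; exact_mod_cast (by omega : k ≤ j)
  | succ r ih =>
    intro j hj
    obtain ⟨bands, h1, h2, h3⟩ := ih (j + 1) (by omega)
    obtain ⟨S, hS, hS', hS''⟩ := fn_sort (q := q) (k := k) (K := K) (fun i => proj j (c i))
      (fun i => encPoint (c i)) L.length L rfl
    refine ⟨⟨j, -B, B, S⟩ :: bands, by simp [h1, List.range'_succ], ?_, _, rfl,
      Ev.mono (Ev.open rfl <| Ev.open rfl <| Ev.ifLt_true (.var rfl) (.num _ rfl rfl) ?_ <|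
        .pair (.pair (.var rfl) (.pair (.num _ rfl (by simp)) (.pair (.var rfl)
          (.call (.call (.pair (.var rfl) (.var rfl)) (fn_keys j c L)) hS''))))
        (.call (.pair (.num _ rfl (by simp)) (.pair (.var rfl) (.var rfl))) h3)) ?_⟩
    · intro b hb
      rcases List.mem_cons.1 hb with rfl | hb
      · exact ⟨rfl, rfl, hS, hS'⟩
      · exact h2 b hb
    · rw [Rat.cast_natCast]; exact_mod_cast (by omega : j < k)
    · norm_num [arithCost]; linarith

/-- In a sorted list, two keys at the distance `m`, in the given range of positions, differ by more
than the width of a disk. -/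
def IsGap (q : ℕ) (c : ι → Plane) (d m : ℕ) (b : Band ι) (s : ℕ) (i i' : ι) : Prop :=
  -- The `-1` compensates for rounding up the start of the range, so that the upper position does
  -- not exceed `(1/2 + 1/(2q)) d`.
  (s : ℝ) ≤ 1 / q * d - m - 1 ∧ b.disks[⌈(1 / 2 - 1 / (2 * q) : ℝ) * d⌉₊ + s]? = some i ∧
    b.disks[⌈(1 / 2 - 1 / (2 * q) : ℝ) * d⌉₊ + m + s]? = some i' ∧
    2 * (1 + b.slope) < proj b.slope (c i') - proj b.slope (c i)

theorem fn_choose (d m : ℕ) (bands : List (Band ι)) (hd : ∀ b ∈ bands, b.disks.length = d) :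
    ∃ o, Fn (prog q k K) fChoose (.pair (.num d) (.pair (.num m) (encBands c bands))) o
        ((110 * d + 200) * bands.length + 10) ∧
      ((o = .nil ∧ ∀ b ∈ bands, ∀ s i i', ¬ IsGap q c d m b s i i') ∨
      ∃ pre b post s i i' t, bands = pre ++ b :: post ∧ IsGap q c d m b s i i' ∧
        t = 1 / 2 * (proj b.slope (c i) + proj b.slope (c i')) ∧
        o = .pair (encLine (bandLine b.slope t))
          (.pair (encBands c (pre ++ { b with lo := t } :: post))
            (encBands c (pre ++ { b with hi := t } :: post)))) := by
  induction bands with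
  | nil => exact ⟨.nil, ⟨_, rfl, Ev.mono (Ev.open rfl <| Ev.open rfl <| Ev.empty rfl .nil)
      (by norm_num)⟩, by simp⟩
  | cons b bands ih =>
    obtain ⟨o', ho', h'⟩ := ih fun b hb => hd b (List.mem_cons_of_mem _ hb)
    set i0 := ⌈(1 / 2 - 1 / (2 * q) : ℝ) * d⌉₊ with hi0
    have hbd := hd b List.mem_cons_self
    obtain ⟨o, ho, h⟩ := fn_find (q := q) (k := k) (K := K) (fun i => proj b.slope (c i))
      (fun i => encPoint (c i)) (2 * (1 + b.slope)) (b.disks.drop i0) ((b.disks.drop i0).drop m)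
      (1 / q * d - m - 1)
    have hd1 := fn_drop (q := q) (k := k) (K := K)
      (b.disks.map fun i => .pair (.num (proj b.slope (c i))) (encPoint (c i)))
      ((1 / 2 - 1 / (2 * q) : ℝ) * d)
    have hd2 := fn_drop (q := q) (k := k) (K := K)
      ((b.disks.drop i0).map fun i => .pair (.num (proj b.slope (c i))) (encPoint (c i))) m
    rw [← hi0, ← List.map_drop] at hd1
    rw [Nat.ceil_natCast, ← List.map_drop] at hd2
    have hlen : ((b.disks.drop i0).length : ℝ) ≤ d := by
      rw [List.length_drop, hbd]; exact_mod_cast Nat.sub_le _ _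
    rw [List.length_map, hbd] at hd1
    -- The part of the run up to the result `o` of the search, shared by all cases; `e₁` and `e₂`
    -- stand for the two continuations in the code.
    have start : ∀ {v : Val} {t : ℝ} {e₁ e₂ : Expr},
        Ev (prog q k K) [o, encKeyed (fun i => proj b.slope (c i)) (fun i => encPoint (c i))
            (b.disks.drop i0), .num b.hi,
          encKeyed (fun i => proj b.slope (c i)) (fun i => encPoint (c i)) b.disks, .num b.lo,
          .pair (.num b.hi)
            (encKeyed (fun i => proj b.slope (c i)) (fun i => encPoint (c i)) b.disks),
          .num b.slope,
          .pair (.num b.lo) (.pair (.num b.hi)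
            (encKeyed (fun i => proj b.slope (c i)) (fun i => encPoint (c i)) b.disks)),
          encBand c b, encBands c bands, .num m, encBands c (b :: bands), .num d,
          .pair (.num m) (encBands c (b :: bands)),
          .pair (.num d) (.pair (.num m) (encBands c (b :: bands)))]
          (.split (.var 0) e₁ e₂) v t →
        bodyChoose q = (.split (.var 0) .nil <| .split (.var 1) .nil <| .split (.var 1) .nil <|
          .split (.var 0) .nil <| .split (.var 1) .nil <| .split (.var 1) .nil <|
          .letIn (.call fDrop (.pair (.mul (cst (1 / 2 - 1 / (2 * q))) (.var 10)) (.var 1))) <|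
          .letIn (.call fFind (.pair (.mul (cst 2) (.add (cst 1) (.var 5)))
            (.pair (.sub (.sub (.mul (cst (1 / q)) (.var 11)) (.var 9)) (cst 1))
            (.pair (.var 0) (.call fDrop (.pair (.var 9) (.var 0))))))) <|
          .split (.var 0) e₁ e₂) →
        Fn (prog q k K) fChoose (.pair (.num d) (.pair (.num m) (encBands c (b :: bands)))) v
          (t + 110 * d + 150) := by
      intro v t e₁ e₂ hev hbody
      refine ⟨_, congrArg some hbody, Ev.mono (Ev.open rfl <| Ev.open rfl <| Ev.open rfl <|
        Ev.open rfl <| Ev.open rfl <| Ev.open rfl <|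
        Ev.letIn (.call (.pair (.num _ rfl (by simp)) (.var rfl)) hd1) <|
        Ev.letIn (.call (.pair (.num _ rfl (by simp)) (.pair (.num _ rfl (by simp))
          (.pair (.var rfl) (.call (.pair (.var rfl) (.var rfl)) hd2)))) ho) hev) ?_⟩
      rw [List.length_map]
      norm_num [arithCost, -List.length_drop]; linarith
    have gap_of : ∀ {s : ℕ} {i i' : ι}, (b.disks.drop i0)[s]? = some i →
        ((b.disks.drop i0).drop m)[s]? = some i' →
        b.disks[i0 + s]? = some i ∧ b.disks[i0 + m + s]? = some i' := by
      intro s i i' h1 h2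
      rw [List.drop_drop] at h2
      rw [List.getElem?_drop] at h1 h2
      exact ⟨h1, h2⟩
    rcases h with ⟨rfl, h⟩ | ⟨s, i, i', hs, hi, hi', hw, rfl⟩
    · have hno : ∀ s i i', ¬ IsGap q c d m b s i i' := by
        rintro s i i' ⟨g1, g2, g3, g4⟩
        have := h s i i' g1 (by rwa [List.getElem?_drop])
          (by rwa [List.drop_drop, List.getElem?_drop])
        linarith
      rcases h' with ⟨rfl, h'⟩ | ⟨pre, b', post, s, i, i', t, rfl, hg, ht, rfl⟩
      · refine ⟨.nil, (start (Ev.empty rfl <| Ev.split_nil (.call (.pair (.var rfl)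
          (.pair (.var rfl) (.var rfl))) ho') .nil) rfl).mono ?_, Or.inl ⟨rfl, ?_⟩⟩
        · norm_num; linarith
        · intro b' hb'
          rcases List.mem_cons.1 hb' with rfl | hb'
          · exact hno
          · exact h' b' hb'
      · refine ⟨_, (start (Ev.empty rfl <| Ev.split_pair (.call (.pair (.var rfl)
          (.pair (.var rfl) (.var rfl))) ho') <| Ev.open rfl <|
            .pair (.var rfl) (.pair (.pair (.var rfl) (.var rfl)) (.pair (.var rfl) (.var rfl))))
              rfl).mono ?_,
          Or.inr ⟨b :: pre, b', post, s, i, i', t, rfl, hg, ht, rfl⟩⟩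
        norm_num; linarith
    · obtain ⟨g2, g3⟩ := gap_of hi hi'
      refine ⟨_, (start (Ev.open rfl <| .pair (.pair (.pair (.var rfl) (.num _ rfl rfl))
          (.pair (.var rfl) (.num _ rfl rfl)))
          (.pair (.pair (.pair (.var rfl) (.pair (.var rfl) (.pair (.var rfl) (.var rfl))))
            (.var rfl)) (.pair (.pair (.var rfl) (.pair (.var rfl)
              (.pair (.var rfl) (.var rfl)))) (.var rfl)))) rfl).mono ?_,
        Or.inr ⟨[], b, bands, s, i, i', _, rfl, ⟨hs, g2, g3, hw⟩, rfl, ?_⟩⟩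
      · have : (0 : ℝ) ≤ (110 * d + 200) * bands.length := by positivity
        norm_num [arithCost]; linarith
      · simp [encLine, bandLine, encPoint, encBands, encBand, encList]

end BandLists


/-! ### Sorted lists and gaps -/

section Sorted

variable {ι : Type*} {key : ι → ℝ} {L : List ι}

theorem key_mono (hL : L.Pairwise fun a b => key a ≤ key b) {p p' : ℕ} {i i' : ι} (h : p ≤ p')
    (hi : L[p]? = some i) (hi' : L[p']? = some i') : key i ≤ key i' := by
  obtain ⟨h1, rfl⟩ := List.getElem?_eq_some_iff.1 hi
  obtain ⟨h2, rfl⟩ := List.getElem?_eq_some_iff.1 hi'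
  rcases h.eq_or_lt with rfl | h
  · exact le_rfl
  · exact List.pairwise_iff_getElem.1 hL p p' h1 h2 h

theorem length_filter_lt_le (hL : L.Pairwise fun a b => key a ≤ key b) {p : ℕ} {i : ι}
    (hi : L[p]? = some i) (Q : ι → Bool) (hQ : ∀ x, Q x → key x < key i) :
    (L.filter Q).length ≤ p := by
  conv_lhs => rw [← List.take_append_drop p L]
  rw [List.filter_append, List.length_append]
  have h1 : (L.drop p).filter Q = [] := by
    rw [List.filter_eq_nil_iff]
    intro x hx hQx
    obtain ⟨r, hr⟩ := List.mem_iff_getElem?.1 hx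
    rw [List.getElem?_drop] at hr
    exact absurd (hQ x hQx) (not_lt.2 (key_mono hL (Nat.le_add_right p r) hi hr))
  rw [h1, List.length_nil, add_zero]
  exact (List.length_filter_le _ _).trans (List.length_take_le _ _)

theorem length_filter_gt_le (hL : L.Pairwise fun a b => key a ≤ key b) {p : ℕ} {i : ι}
    (hi : L[p]? = some i) (Q : ι → Bool) (hQ : ∀ x, Q x → key i < key x) :
    (L.filter Q).length ≤ L.length - (p + 1) ∧ L.filter Q = (L.drop (p + 1)).filter Q := by
  have h1 : (L.take (p + 1)).filter Q = [] := by
    rw [List.filter_eq_nil_iff]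
    intro x hx hQx
    obtain ⟨r, hr⟩ := List.mem_iff_getElem?.1 hx
    rw [List.getElem?_take] at hr
    split_ifs at hr with h
    exact absurd (hQ x hQx) (not_lt.2 (key_mono hL (by omega) hr hi))
  have h2 : L.filter Q = (L.drop (p + 1)).filter Q := by
    conv_lhs => rw [← List.take_append_drop (p + 1) L]
    rw [List.filter_append, h1, List.nil_append]
  refine ⟨?_, h2⟩
  rw [h2]
  exact (List.length_filter_le _ _).trans (by rw [List.length_drop])

theorem length_filter_between_le (hL : L.Pairwise fun a b => key a ≤ key b) {p p' : ℕ} {i i' : ι}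
    (hi : L[p]? = some i) (hi' : L[p']? = some i') (h : p < p') (Q : ι → Bool)
    (hQ : ∀ x, Q x → key i < key x ∧ key x < key i') :
    (L.filter Q).length ≤ p' - (p + 1) := by
  rw [(length_filter_gt_le hL hi Q fun x hx => (hQ x hx).1).2]
  refine length_filter_lt_le (hL.sublist (List.drop_sublist _ _)) (i := i') ?_ Q
    fun x hx => (hQ x hx).2
  rw [List.getElem?_drop, ← hi']
  congr 1
  omega

end Sorted

/-- Bounding each coordinate separately gives `1 + j` instead of the sharp `√(1 + j²)`; this weaker
bound can be computed by the program. -/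
theorem dist_proj_le {j : ℕ} {p r : Plane} (h : r ∈ unitDisk p) :
    |proj j r - proj j p| ≤ 1 + j := by
  rw [mem_unitDisk] at h
  have h0 : |r 0 - p 0| ≤ 1 := abs_le_one_iff_mul_self_le_one.2 (by nlinarith [sq_nonneg (r 1 - p 1)])
  have h1 : |r 1 - p 1| ≤ 1 := abs_le_one_iff_mul_self_le_one.2 (by nlinarith [sq_nonneg (r 0 - p 0)])
  have e : proj j r - proj j p = (r 0 - p 0) + j * (r 1 - p 1) := by simp only [proj]; ring
  rw [e]
  calc |(r 0 - p 0) + j * (r 1 - p 1)| ≤ |r 0 - p 0| + |(j : ℝ) * (r 1 - p 1)| := abs_add_le _ _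
    _ = |r 0 - p 0| + j * |r 1 - p 1| := by rw [abs_mul, Nat.abs_cast]
    _ ≤ 1 + j * 1 := by gcongr
    _ = _ := by ring

/-! ### Disjoint disks in strips -/

section Strips

variable {n : ℕ} {c : Fin n → Plane}

/-- Two disjoint disks are far apart in one of two directions. -/
theorem eq_of_proj_close
    (hc : Pairwise fun i j => Disjoint (unitDisk (c i)) (unitDisk (c j))) {k j j' : ℕ}
    (hj : j < k) (hjj : j ≠ j') {x y : Fin n}
    (h : |proj j (c x) - proj j (c y)| * (2 * k + 1) ≤ 1)
    (h' : |proj j' (c x) - proj j' (c y)| * (2 * k + 1) ≤ 1) : x = y := by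
  by_contra hxy
  have hk : (0 : ℝ) ≤ k := Nat.cast_nonneg _
  have hjk : (j : ℝ) + 1 ≤ k := by exact_mod_cast hj
  have hj0 : (0 : ℝ) ≤ j := Nat.cast_nonneg _
  -- The mesh for which `|dy| ≤ 2δ` and `|dx| ≤ δ + 2jδ` are both at most `1`.
  set δ := 1 / (2 * (k : ℝ) + 1) with hδ
  have hδ0 : 0 < δ := by positivity
  have hδk : δ * (2 * k + 1) = 1 := by rw [hδ]; field_simp
  have h1 : |proj j (c x) - proj j (c y)| ≤ δ := by rw [hδ, le_div_iff₀ (by positivity)]; exact h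
  have h2 : |proj j' (c x) - proj j' (c y)| ≤ δ := by rw [hδ, le_div_iff₀ (by positivity)]; exact h'
  rw [abs_le] at h1 h2
  set dx := c x 0 - c y 0 with hdx
  set dy := c x 1 - c y 1 with hdy
  have e1 : proj j (c x) - proj j (c y) = dx + j * dy := by simp only [proj, hdx, hdy]; ring
  have e2 : proj j' (c x) - proj j' (c y) = dx + j' * dy := by simp only [proj, hdx, hdy]; ring
  rw [e1] at h1
  rw [e2] at h2
  have hdy : |dy| ≤ 2 * δ := by
    have h3 : |((j : ℝ) - j') * dy| ≤ 2 * δ := by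
      rw [abs_le]; constructor <;> linarith
    have h4 : (1 : ℝ) ≤ |(j : ℝ) - j'| := by
      have : (1 : ℤ) ≤ |(j : ℤ) - j'| := Int.one_le_abs (by omega)
      exact_mod_cast this
    rw [abs_mul] at h3
    nlinarith [abs_nonneg dy]
  have hdx : |dx| ≤ 1 := by
    rw [abs_le] at hdy ⊢
    constructor <;> nlinarith
  have hdy1 : |dy| ≤ 1 := by
    refine hdy.trans ?_
    nlinarith
  -- The midpoint of the two centers lies in both disks.
  refine (hc hxy).ne_of_mem (a := lerp (1 / 2) (c x) (c y)) ?_ ?_ rfl <;>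
  · rw [mem_unitDisk]
    have g1 : dx ^ 2 ≤ 1 := (sq_le_one_iff_abs_le_one _).2 hdx
    have g2 : dy ^ 2 ≤ 1 := (sq_le_one_iff_abs_le_one _).2 hdy1
    simp only [lerp, PiLp.add_apply, PiLp.smul_apply, PiLp.sub_apply, smul_eq_mul]
    nlinarith

/-- A discrete area argument: cells of side `1/(2k+1)` in the two projections contain at most one
center each by `eq_of_proj_close`, and `(2k+1)² B` cells in each direction suffice. -/
theorem card_strip_inter_le
    (hc : Pairwise fun i j => Disjoint (unitDisk (c i)) (unitDisk (c j))) {k j j' B : ℕ}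
    (hj : j < k) (hjj : j ≠ j') (hB : 1 ≤ B) (a a' : ℝ) (S : Finset (Fin n))
    (hS : ∀ x ∈ S, a ≤ proj j (c x) ∧ proj j (c x) ≤ a + 2 * k * B)
    (hS' : ∀ x ∈ S, a' ≤ proj j' (c x) ∧ proj j' (c x) ≤ a' + 2 * k * B) :
    S.card ≤ (2 * k + 1) ^ 4 * B ^ 2 := by
  have hk : (0 : ℝ) ≤ k := Nat.cast_nonneg _
  let N := (2 * k + 1) ^ 2 * B
  have hfloor : ∀ z : ℝ, z ≤ 2 * k * B → ⌊z * (2 * k + 1)⌋₊ < N := by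
    intro z hz
    rcases le_or_gt z 0 with h | h
    · rw [Nat.floor_of_nonpos (by nlinarith)]; positivity
    · have h1 : z * (2 * k + 1) ≤ ((2 * k * (2 * k + 1) * B : ℕ) : ℝ) := by
        push_cast; nlinarith
      have h2 := Nat.floor_le_floor h1
      rw [Nat.floor_natCast] at h2
      refine h2.trans_lt ?_
      simp only [N]
      nlinarith
  have hclose : ∀ z z' : ℝ, 0 ≤ z → 0 ≤ z' → ⌊z * (2 * k + 1)⌋₊ = ⌊z' * (2 * k + 1)⌋₊ →
      |z - z'| * (2 * k + 1) ≤ 1 := by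
    intro z z' hz hz' h
    have h1 := Nat.floor_le (a := z * (2 * k + 1)) (by positivity)
    have h2 := Nat.lt_floor_add_one (z * (2 * k + 1))
    have h3 := Nat.floor_le (a := z' * (2 * k + 1)) (by positivity)
    have h4 := Nat.lt_floor_add_one (z' * (2 * k + 1))
    rw [h] at h1 h2
    have h5 : (2 * (k : ℝ) + 1) = |2 * (k : ℝ) + 1| := (abs_of_pos (by positivity)).symm
    rw [h5, ← abs_mul, abs_le]
    constructor <;> linarith
  have := Finset.card_le_card_of_injOn (t := Finset.range N ×ˢ Finset.range N)
    (s := S) (fun x => (⌊(proj j (c x) - a) * (2 * k + 1)⌋₊,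
      ⌊(proj j' (c x) - a') * (2 * k + 1)⌋₊)) ?_ ?_
  · rw [Finset.card_product, Finset.card_range] at this
    refine this.trans (le_of_eq ?_)
    simp only [N]; ring
  · intro x hx
    simp only [Finset.coe_product, Set.mem_prod, Finset.coe_range, Set.mem_Iio]
    exact ⟨hfloor _ (by linarith [(hS x hx).2]), hfloor _ (by linarith [(hS' x hx).2])⟩
  · intro x hx y hy hxy
    simp only [Prod.mk.injEq] at hxy
    have g1 := hclose _ _ (by linarith [(hS x hx).1]) (by linarith [(hS y hy).1]) hxy.1
    have g2 := hclose _ _ (by linarith [(hS' x hx).1]) (by linarith [(hS' y hy).1]) hxy.2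
    refine eq_of_proj_close hc hj hjj ?_ ?_
    · simpa using g1
    · simpa using g2

/-- A Bonferroni inequality: when the set of index `r` joins the union of the earlier ones, at most
`r * e` of its elements are already present. -/
theorem mul_card_le_of_inter_le {α : Type*} [DecidableEq α] (S : ℕ → Finset α) (H : Finset α)
    (s e k : ℕ) (hH : ∀ j < k, S j ⊆ H) (hs : ∀ j < k, s ≤ (S j).card)
    (he : ∀ j < k, ∀ j' < k, j ≠ j' → (S j ∩ S j').card ≤ e) : k * s ≤ H.card + k * k * e := by
  have key : ∀ r ≤ k, r * s ≤ ((Finset.range r).biUnion S).card + r * k * e := by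
    intro r
    induction r with
    | zero => simp
    | succ r ih =>
      intro hr
      have h1 := ih (by omega)
      rw [Finset.range_add_one, Finset.biUnion_insert]
      have h2 := Finset.card_union_add_card_inter (S r) ((Finset.range r).biUnion S)
      have h3 : (S r ∩ (Finset.range r).biUnion S).card ≤ r * e := by
        rw [Finset.inter_biUnion]
        refine Finset.card_biUnion_le.trans ((Finset.sum_le_card_nsmul _ _ e ?_).trans (by simp))
        intro x hx
        have := Finset.mem_range.1 hx
        exact he r (by omega) x (by omega) (by omega)
      have h4 := hs r (by omega)
      have h5 : r * e ≤ k * e := Nat.mul_le_mul_right _ (by omega)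
      nlinarith
  refine (key k le_rfl).trans (Nat.add_le_add_right (Finset.card_le_card ?_) _)
  exact Finset.biUnion_subset.2 fun j hj => hH j (Finset.mem_range.1 hj)

/-! ### Existence of a gap. -/

/-- The bound on the number of disks from which on the search for a line succeeds. -/
def gapBound (q : ℕ) : ℕ := (4 * ((4 * q) ^ 2 * (2 * (4 * q) + 1) ^ 4)) ^ q + (4 * q) ^ (2 * q)

/-- The exponent of `m` lies strictly between `1/2` and `1`. The second summand of `gapBound` makes
`m` small against `d`, and the first makes `m²` large against `d`. -/
theorem root_bounds {q d m : ℕ} (hq : 2 ≤ q) (hd : gapBound q < d)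
    (hm : m ^ (2 * q) ≤ d ^ (q + 1)) (hm' : d ^ (q + 1) < (m + 1) ^ (2 * q)) :
    1 ≤ m ∧ 4 * q * m ≤ d ∧ (4 * q) ^ 2 * (2 * (4 * q) + 1) ^ 4 * d < m ^ 2 := by
  have hd0 : 0 < d := by omega
  have hm1 : 1 ≤ m := by
    by_contra h
    have : m = 0 := by omega
    subst this
    have := Nat.one_le_pow (q + 1) d hd0
    simp at hm'
    omega
  refine ⟨hm1, ?_, ?_⟩
  · by_contra h
    push Not at h
    have h1 : d ^ (2 * q) < (4 * q * m) ^ (2 * q) := Nat.pow_lt_pow_left h (by omega)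
    rw [mul_pow] at h1
    have h2 : (4 * q) ^ (2 * q) * m ^ (2 * q) ≤ d * d ^ (q + 1) :=
      Nat.mul_le_mul (by unfold gapBound at hd; omega) hm
    -- Here `q + 2 ≤ 2q` is needed.
    have h3 : d * d ^ (q + 1) ≤ d ^ (2 * q) := by
      rw [← pow_succ']
      exact Nat.pow_le_pow_right hd0 (by omega)
    omega
  · by_contra h
    push Not at h
    set C := (4 * q) ^ 2 * (2 * (4 * q) + 1) ^ 4 with hC
    -- Since `m ≥ 1`, `(m + 1)² ≤ 4m²`; this is the factor `4` in `gapBound`.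
    have h1 : (m + 1) ^ (2 * q) ≤ (4 * C * d) ^ q := by
      rw [pow_mul]
      refine Nat.pow_le_pow_left ?_ _
      nlinarith
    rw [mul_pow] at h1
    have h2 : (4 * C) ^ q * d ^ q ≤ d * d ^ q :=
      Nat.mul_le_mul_right _ (by rw [gapBound, ← hC] at hd; omega)
    rw [pow_succ'] at hm'
    omega

/-- For sufficiently many disks, one of the directions has a gap. -/
theorem exists_isGap (hc : Pairwise fun i j => Disjoint (unitDisk (c i)) (unitDisk (c j)))
    {q d m : ℕ} (hq : 2 ≤ q) (hd : gapBound q < d)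
    (hm : m ^ (2 * q) ≤ d ^ (q + 1)) (hm' : d ^ (q + 1) < (m + 1) ^ (2 * q))
    (H : Finset (Fin n)) (hH : H.card = d) (bands : List (Band (Fin n)))
    (hs : bands.map Band.slope = List.range' 0 (4 * q))
    (hb : ∀ b ∈ bands, b.disks.length = d ∧ b.disks.Nodup ∧ (∀ i ∈ b.disks, i ∈ H) ∧
      b.disks.Pairwise fun i i' => proj b.slope (c i) ≤ proj b.slope (c i')) :
    ∃ b ∈ bands, ∃ s i i', IsGap q c d m b s i i' := by
  classical
  by_contra hno
  push Not at hno
  obtain ⟨hm1, hm2, hm3⟩ := root_bounds hq hd hm hm'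
  have hq0 : (2 : ℝ) ≤ q := by exact_mod_cast hq
  have hm1' : (1 : ℝ) ≤ m := by exact_mod_cast hm1
  have hm2' : 4 * (q : ℝ) * m ≤ d := by exact_mod_cast hm2
  have hd0 : (0 : ℝ) ≤ d := Nat.cast_nonneg _
  set r := 1 / (q : ℝ) * d - m - 1 with hr
  have hdq : 4 * (m : ℝ) ≤ 1 / q * d := by
    rw [one_div, inv_mul_eq_div, le_div_iff₀ (by linarith)]; linarith
  have hdq2 : 1 / (q : ℝ) * d ≤ d / 2 := by
    rw [one_div, inv_mul_eq_div]
    exact div_le_div_of_nonneg_left hd0 (by norm_num) hq0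
  have hr0 : 0 ≤ r := by rw [hr]; linarith
  -- The number of consecutive jumps by `m` positions that all start at an admissible offset `s ≤
  -- r`.
  set B := ⌊r / m⌋₊ + 1 with hB
  have hB1 : ((B : ℝ) - 1) * m ≤ r := by
    have := Nat.floor_le (a := r / m) (by positivity)
    rw [hB]; push_cast
    rw [add_sub_cancel_right]
    exact (le_div_iff₀ (by linarith)).1 this
  have hB2 : r < (B : ℝ) * m := by
    have := Nat.lt_floor_add_one (r / m)
    rw [hB]; push_cast
    exact (div_lt_iff₀ (by linarith)).1 this
  set i0 := ⌈(1 / 2 - 1 / (2 * q) : ℝ) * d⌉₊ with hi0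
  have hi0' : (i0 : ℝ) < (1 / 2 - 1 / (2 * q) : ℝ) * d + 1 := by
    refine Nat.ceil_lt_add_one (mul_nonneg ?_ hd0)
    rw [sub_nonneg]
    exact one_div_le_one_div_of_le (by norm_num) (by linarith)
  have hlen : i0 + B * m < d := by
    have h1 : (1 / 2 - 1 / (2 * q) : ℝ) * d = d / 2 - (1 / q * d) / 2 := by field_simp
    have : (i0 : ℝ) + B * m < d := by
      rw [h1] at hi0'
      linarith
    exact_mod_cast this
  -- The jumps span at least `d/(2q)` positions.
  have hBm : d ≤ 2 * q * (B * m) := by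
    have h1 : 1 / (q : ℝ) * d / 2 ≤ B * m := by rw [hr] at hB2; linarith
    have h2 : (d : ℝ) ≤ 2 * q * (B * m) := by
      calc (d : ℝ) = 2 * q * (1 / (q : ℝ) * d / 2) := by field_simp
        _ ≤ _ := by gcongr
    exact_mod_cast h2
  have hBd : B * m ≤ d := by omega
  -- Without gaps, a jump by `m` positions raises the key by at most `2(1 + j) ≤ 2k`, so the `B * m`
  -- disks from position `i0` on lie in a narrow strip.
  have hstrip : ∀ j < 4 * q, ∃ (a : ℝ) (S : Finset (Fin n)), S ⊆ H ∧ B * m ≤ S.card ∧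
      ∀ x ∈ S, a ≤ proj j (c x) ∧ proj j (c x) ≤ a + 2 * (4 * q : ℕ) * B := by
    intro j hj
    have hj' : j ∈ bands.map Band.slope := by
      rw [hs, List.mem_range'_1]; omega
    obtain ⟨b, hbb, rfl⟩ := List.mem_map.1 hj'
    obtain ⟨hl, hnd, hHb, hsort⟩ := hb b hbb
    have hget : ∀ p < d, ∃ x, b.disks[p]? = some x := fun p hp =>
      ⟨_, List.getElem?_eq_getElem (hl ▸ hp)⟩
    obtain ⟨x0, hx0⟩ := hget i0 (by omega)
    have hstep : ∀ l ≤ B, ∀ x, b.disks[i0 + l * m]? = some x →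
        proj b.slope (c x) ≤ proj b.slope (c x0) + 2 * (1 + b.slope) * l := by
      intro l
      induction l with
      | zero =>
        intro _ x hx
        rw [zero_mul, add_zero, hx0] at hx
        cases hx
        simp
      | succ l ih =>
        intro hlB x hx
        have hlm : l * m ≤ B * m := Nat.mul_le_mul_right _ (by omega)
        obtain ⟨y, hy⟩ := hget (i0 + l * m) (by omega)
        have h1 := ih (by omega) y hy
        have h2 := hno b hbb (l * m) y x
        rw [IsGap] at h2
        by_contra h3
        refine h2 ⟨?_, hy, ?_, ?_⟩
        · refine le_trans ?_ hB1
          push_cast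
          have : (l : ℝ) + 1 ≤ B := by exact_mod_cast hlB
          gcongr
          linarith
        · rw [← hx]; congr 1; ring
        · push_cast at h3; linarith
    obtain ⟨x1, hx1⟩ := hget (i0 + B * m) hlen
    refine ⟨proj b.slope (c x0), ((b.disks.drop i0).take (B * m)).toFinset, ?_, ?_, ?_⟩
    · intro x hx
      exact hHb x (List.mem_of_mem_drop (List.mem_of_mem_take (List.mem_toFinset.1 hx)))
    · rw [List.toFinset_card_of_nodup, List.length_take, List.length_drop, hl]
      · omega
      · exact hnd.sublist ((List.take_sublist _ _).trans (List.drop_sublist _ _))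
    · intro x hx
      obtain ⟨p, hp⟩ := List.mem_iff_getElem?.1 (List.mem_toFinset.1 hx)
      rw [List.getElem?_take] at hp
      split_ifs at hp with hpB
      rw [List.getElem?_drop] at hp
      refine ⟨key_mono (key := fun i => proj b.slope (c i)) hsort (by omega) hx0 hp, ?_⟩
      have h1 := key_mono (key := fun i => proj b.slope (c i)) hsort
        (show i0 + p ≤ i0 + B * m by omega) hp hx1
      have h2 := hstep B le_rfl x1 hx1
      have h3 : (b.slope : ℝ) + 1 ≤ (4 * q : ℕ) := by exact_mod_cast hj
      have h4 : 2 * (1 + (b.slope : ℝ)) * B ≤ 2 * (4 * q : ℕ) * B := by gcongr; linarith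
      linarith
  choose! a S hSH hSc hSp using hstrip
  -- The left side `4q · Bm` is at least `2d`, while the union has at most `d` elements; the
  -- intersections must account for the rest.
  have hmain := mul_card_le_of_inter_le S H (B * m) ((2 * (4 * q) + 1) ^ 4 * B ^ 2) (4 * q) hSH hSc
    (fun j hj j' hj' hjj => card_strip_inter_le hc hj hjj (by omega) (a j) (a j') _
      (fun x hx => hSp j hj x (Finset.mem_inter.1 hx).1)
      (fun x hx => hSp j' hj' x (Finset.mem_inter.1 hx).2))
  rw [hH] at hmain
  set C := (4 * q) ^ 2 * (2 * (4 * q) + 1) ^ 4 with hC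
  have h1 : d ≤ C * B ^ 2 := by
    have : 4 * q * (4 * q) * ((2 * (4 * q) + 1) ^ 4 * B ^ 2) = C * B ^ 2 := by rw [hC]; ring
    rw [this] at hmain
    have : 4 * q * (B * m) = 2 * (2 * q * (B * m)) := by ring
    omega
  -- With `Bm ≤ d` the bound on `d` contradicts the lower bound on `m²`.
  have h2 : d * m ^ 2 ≤ C * d * d := by
    calc d * m ^ 2 ≤ C * B ^ 2 * m ^ 2 := Nat.mul_le_mul_right _ h1
      _ = C * ((B * m) * (B * m)) := by ring
      _ ≤ C * (d * d) := Nat.mul_le_mul_left _ (Nat.mul_le_mul hBd hBd)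
      _ = _ := by ring
  have h3 : d * (C * d) < d * m ^ 2 := Nat.mul_lt_mul_of_pos_left hm3 (by omega)
  have h4 : d * (C * d) = C * d * d := by ring
  omega

end Strips


/-! ### Bounded regions -/

/-- The region cut out by a list of halfplanes `0 ≤ σ * (proj j - t)`. -/
def cutRegion (Cs : List (ℕ × ℝ × ℝ)) : Set Plane :=
  {p | ∀ h ∈ Cs, 0 ≤ h.2.2 * (proj h.1 p - h.2.1)}

theorem continuous_proj (j : ℕ) : Continuous (proj j) := by
  unfold proj; fun_prop

theorem isClosed_cutRegion (Cs : List (ℕ × ℝ × ℝ)) : IsClosed (cutRegion Cs) := by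
  have : cutRegion Cs = ⋂ h ∈ Cs, {p | 0 ≤ h.2.2 * (proj h.1 p - h.2.1)} := by
    ext p; simp [cutRegion]
  rw [this]
  refine isClosed_biInter fun h _ => isClosed_le continuous_const ?_
  exact continuous_const.mul ((continuous_proj _).sub continuous_const)

theorem proj_comb (j : ℕ) (x y : ℝ) (p r : Plane) :
    proj j (x • p + y • r) = x * proj j p + y * proj j r := by
  simp [proj]; ring

theorem convex_cutRegion (Cs : List (ℕ × ℝ × ℝ)) : Convex ℝ (cutRegion Cs) := by
  intro p hp r hr x y hx hy hxy h hh
  have h1 := mul_nonneg hx (hp h hh)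
  have h2 := mul_nonneg hy (hr h hh)
  rw [proj_comb]
  have : h.2.2 * (x * proj h.1 p + y * proj h.1 r - h.2.1) =
      x * (h.2.2 * (proj h.1 p - h.2.1)) + y * (h.2.2 * (proj h.1 r - h.2.1)) := by
    linear_combination (h.2.2 * h.2.1) * hxy
  rw [this]
  linarith

/-- An extreme point lies on two lines that are not parallel. -/
theorem exists_tight_of_extreme {Cs : List (ℕ × ℝ × ℝ)} (hσ : ∀ h ∈ Cs, h.2.2 ≠ 0) {x : Plane}
    (hx : x ∈ (cutRegion Cs).extremePoints ℝ) :
    ∃ h ∈ Cs, ∃ h' ∈ Cs, h.1 ≠ h'.1 ∧ proj h.1 x = h.2.1 ∧ proj h'.1 x = h'.2.1 := by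
  by_contra hno
  push Not at hno
  -- All constraints tight at `x` have one slope `j`; if none is tight, any slope will do.
  obtain ⟨j, hj⟩ : ∃ j : ℕ, ∀ h ∈ Cs, proj h.1 x = h.2.1 → h.1 = j := by
    by_cases hex : ∃ h ∈ Cs, proj h.1 x = h.2.1
    · obtain ⟨h, hh, he⟩ := hex
      refine ⟨h.1, fun h' hh' he' => ?_⟩
      by_contra hne
      exact hno h hh h' hh' (Ne.symm hne) he he'
    · push Not at hex
      exact ⟨0, fun h hh he => absurd he (hex h hh)⟩
  -- A direction along which `proj j` is constant. Small moves both ways keep tight constraints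
  -- tight and strict ones valid, so `x` is a proper midpoint and not extreme.
  let u : Plane := mkPoint (-j) 1
  have hu : ∀ s : ℝ, ∀ j', proj j' (x + s • u) = proj j' x + s * (j' - j) := by
    intro s j'
    simp [proj, u]; ring
  have hev : ∀ᶠ s : ℝ in nhds 0, x + s • u ∈ cutRegion Cs := by
    have : ∀ᶠ s : ℝ in nhds 0, ∀ h ∈ {h | h ∈ Cs}, 0 ≤ h.2.2 * (proj h.1 (x + s • u) - h.2.1) := by
      rw [Filter.eventually_all_finite (List.finite_toSet Cs)]
      intro h hh
      rcases (hx.1 h hh).eq_or_lt with he | hlt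
      · have he' : proj h.1 x = h.2.1 := by
          rcases mul_eq_zero.1 he.symm with h0 | h0
          · exact absurd h0 (hσ h hh)
          · linarith
        refine Filter.Eventually.of_forall fun s => ?_
        rw [hu, hj h hh he', sub_self, mul_zero, add_zero, ← hj h hh he', he', sub_self, mul_zero]
      · have hcont : Continuous fun s : ℝ => h.2.2 * (proj h.1 (x + s • u) - h.2.1) := by
          simp only [hu]; fun_prop
        have := hcont.continuousAt (x := 0) |>.eventually_const_lt (by simpa using hlt)
        exact this.mono fun _ h => h.le
    exact this
  obtain ⟨δ, hδ, hball⟩ := Metric.eventually_nhds_iff.1 hev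
  have h1 := hball (y := δ / 2) (by rw [Real.dist_eq, sub_zero, abs_of_pos] <;> linarith)
  have h2 := hball (y := -(δ / 2)) (by rw [Real.dist_eq, sub_zero, abs_neg, abs_of_pos] <;> linarith)
  have h3 : x ∈ openSegment ℝ (x + (δ / 2) • u) (x + (-(δ / 2)) • u) :=
    ⟨1 / 2, 1 / 2, by norm_num, by norm_num, by norm_num, by module⟩
  have h4 := hx.2 h1 h2 h3
  have h5 := congrArg (fun p : Plane => p 1) h4
  simp [u] at h5
  linarith

/-- Subtracting the two projections isolates `(j - j') * x 1`, and distinct integer slopes differ by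
at least one. -/
theorem abs_le_of_proj {k : ℕ} {τ : ℝ} {j j' : ℕ} (hj : j < k) (hne : j ≠ j')
    {x : Plane} (h : |proj j x| ≤ τ) (h' : |proj j' x| ≤ τ) :
    |x 0| ≤ (2 * k + 1) * τ ∧ |x 1| ≤ (2 * k + 1) * τ := by
  have hτ : 0 ≤ τ := (abs_nonneg _).trans h
  have h1 : (1 : ℝ) ≤ |(j : ℝ) - j'| := by
    have : (1 : ℤ) ≤ |(j : ℤ) - j'| := Int.one_le_abs (by omega)
    exact_mod_cast this
  have h2 : |((j : ℝ) - j') * x 1| ≤ 2 * τ := by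
    have e : ((j : ℝ) - j') * x 1 = proj j x - proj j' x := by simp only [proj]; ring
    rw [e]
    rw [abs_le] at *
    constructor <;> linarith
  rw [abs_mul] at h2
  have h3 : |x 1| ≤ 2 * τ := by nlinarith [abs_nonneg (x 1)]
  have hk : (j : ℝ) + 1 ≤ k := by exact_mod_cast hj
  have hj0 : (0 : ℝ) ≤ j := Nat.cast_nonneg _
  constructor
  · have e : x 0 = proj j x - j * x 1 := by simp only [proj]; ring
    rw [e]
    calc |proj j x - j * x 1| ≤ |proj j x| + |(j : ℝ) * x 1| := abs_sub _ _
      _ = |proj j x| + j * |x 1| := by rw [abs_mul, Nat.abs_cast]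
      _ ≤ τ + k * (2 * τ) := by gcongr
      _ = _ := by ring
  · nlinarith

theorem isClosed_square (M : ℝ) : IsClosed (square M) := by
  have : square M = {p : Plane | |p 0| ≤ M} ∩ {p : Plane | |p 1| ≤ M} := rfl
  rw [this]
  exact (isClosed_le (by fun_prop) continuous_const).inter
    (isClosed_le (by fun_prop) continuous_const)

theorem convex_square (M : ℝ) : Convex ℝ (square M) := by
  rintro p ⟨p0, p1⟩ r ⟨r0, r1⟩ x y hx hy hxy
  rw [abs_le] at p0 p1 r0 r1
  constructor <;>
  · simp only [PiLp.add_apply, PiLp.smul_apply, smul_eq_mul]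
    rw [abs_le]
    have hy' : y = 1 - x := by linarith
    subst hy'
    constructor <;> nlinarith

/-- The Krein–Milman theorem reduces the claim to extreme points, which are intersections of two
lines of different slopes. -/
theorem cutRegion_subset_square {Cs : List (ℕ × ℝ × ℝ)} {k : ℕ} {τ : ℝ}
    (hCs : ∀ h ∈ Cs, h.2.2 ≠ 0 ∧ h.1 < k ∧ |h.2.1| ≤ τ)
    (hb : Bornology.IsBounded (cutRegion Cs)) : cutRegion Cs ⊆ square ((2 * k + 1) * τ) := by
  have hcomp : IsCompact (cutRegion Cs) :=
    Metric.isCompact_of_isClosed_isBounded (isClosed_cutRegion Cs) hb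
  rw [← closure_convexHull_extremePoints hcomp (convex_cutRegion Cs)]
  refine closure_minimal (convexHull_min ?_ (convex_square _)) (isClosed_square _)
  intro x hx
  obtain ⟨h, hh, h', hh', hne, he, he'⟩ := exists_tight_of_extreme (fun h hh => (hCs h hh).1) hx
  exact abs_le_of_proj (hCs h hh).2.1 hne (he ▸ (hCs h hh).2.2)
    (he' ▸ (hCs h' hh').2.2)

/-- All lines of the tree have one of `k` slopes and bounded distance from the origin. -/
def LinesIn (k : ℕ) (τ : ℝ) : LineTree → Prop
  | .leaf => True
  | .node l u w => (∃ j < k, ∃ t, |t| ≤ τ ∧ l = bandLine j t) ∧ LinesIn k τ u ∧ LinesIn k τ w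

/-- The list `Cs` collects the halfplanes on the path from the root; it grows by one at each level
of the induction. -/
theorem leafRegions_subset_square {k : ℕ} {τ : ℝ} (T : LineTree) (hT : LinesIn k τ T)
    (Cs : List (ℕ × ℝ × ℝ)) (hCs : ∀ h ∈ Cs, h.2.2 ≠ 0 ∧ h.1 < k ∧ |h.2.1| ≤ τ) :
    ∀ R ∈ leafRegionsFrom T (cutRegion Cs), Bornology.IsBounded R →
      R ⊆ square ((2 * k + 1) * τ) := by
  induction T generalizing Cs with
  | leaf =>
    rintro R rfl hb
    exact cutRegion_subset_square hCs hb
  | node l u w iu iw =>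
    obtain ⟨⟨j, hj, t, ht, rfl⟩, hu, hw⟩ := hT
    have e1 : cutRegion Cs ∩ (bandLine j t).left = cutRegion ((j, t, 1) :: Cs) := by
      ext p
      simp only [cutRegion, DirLine.left, side_bandLine, List.forall_mem_cons, Set.mem_inter_iff,
        Set.mem_ofPred_eq, one_mul]
      tauto
    have e2 : cutRegion Cs ∩ (bandLine j t).right = cutRegion ((j, t, -1) :: Cs) := by
      ext p
      simp only [cutRegion, DirLine.right, side_bandLine, List.forall_mem_cons, Set.mem_inter_iff,
        Set.mem_ofPred_eq, neg_mul, one_mul, Left.nonneg_neg_iff]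
      tauto
    rintro R (hR | hR) hb
    · rw [e1] at hR
      refine iu hu _ ?_ R hR hb
      rintro h (_ | ⟨_, hh⟩)
      · exact ⟨one_ne_zero, hj, ht⟩
      · exact hCs h hh
    · rw [e2] at hR
      refine iw hw _ ?_ R hR hb
      rintro h (_ | ⟨_, hh⟩)
      · exact ⟨by norm_num, hj, ht⟩
      · exact hCs h hh


/-! ### States of the construction -/

section States

variable {n : ℕ} {c : Fin n → Plane} {q k K N d m : ℕ} {M τ : ℝ} {R R' : Set Plane}
  {bands bands' : List (Band (Fin n))} {ts : List Tri}

open Classical in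
/-- The disks that intersect a region. -/
def hitSet (c : Fin n → Plane) (R : Set Plane) : Finset (Fin n) :=
  Finset.univ.filter fun i => (unitDisk (c i) ∩ R).Nonempty

theorem mem_hitSet {i : Fin n} : i ∈ hitSet c R ↔ (unitDisk (c i) ∩ R).Nonempty := by
  simp [hitSet]

theorem diskCount_eq (c : Fin n → Plane) (R : Set Plane) : diskCount c R = (hitSet c R).card := by
  rw [diskCount, ← Set.ncard_coe_finset]
  congr 1
  ext i
  simp [mem_hitSet]

theorem ncard_le_length_filter {X : Set (Fin n)} {L : List (Fin n)} (Q : Fin n → Bool)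
    (h : ∀ x ∈ X, x ∈ L ∧ Q x) : X.ncard ≤ (L.filter Q).length := by
  refine le_trans ?_ (List.toFinset_card_le _)
  rw [← Set.ncard_coe_finset]
  refine Set.ncard_le_ncard (fun x hx => ?_) (Finset.finite_toSet _)
  simpa using h x hx

/-- The triangles form the part of the region inside the square. -/
structure IsCover (M : ℝ) (N : ℕ) (ts : List Tri) (R : Set Plane) : Prop where
  proper : ∀ t ∈ ts, t.Proper
  cover_eq : cover ts = R ∩ square M
  length_le : ts.length ≤ N

/-- The data that describe a node with the region `R`. -/
structure IsState (c : Fin n → Plane) (k N : ℕ) (M : ℝ) (R : Set Plane)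
    (bands : List (Band (Fin n))) (ts : List Tri) : Prop where
  isCover : IsCover M N ts R
  -- Equality is only asked inside the square: the bands are bounded, while `R` itself may be
  -- unbounded.
  region : R ∩ square M = square M ∩ bandSet bands
  -- The interior point that `cover_regionTris` requires.
  nonempty : (openSquare M ∩ openBandSet bands).Nonempty
  slopes : bands.map Band.slope = List.range' 0 k
  nodup : ∀ b ∈ bands, b.disks.Nodup
  mem_disks : ∀ b ∈ bands, ∀ i, i ∈ b.disks ↔ i ∈ hitSet c R
  sorted : ∀ b ∈ bands, b.disks.Pairwise fun i i' => proj b.slope (c i) ≤ proj b.slope (c i')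

theorem IsState.length_disks (h : IsState c k N M R bands ts) {b : Band (Fin n)} (hb : b ∈ bands) :
    b.disks.length = (hitSet c R).card := by
  rw [← List.toFinset_card_of_nodup (h.nodup b hb)]
  congr 1
  ext i
  rw [List.mem_toFinset, h.mem_disks b hb]

theorem hit_inter_square_iff (hsq : ∀ i, unitDisk (c i) ⊆ square M) {i : Fin n} :
    (unitDisk (c i) ∩ (R ∩ square M)).Nonempty ↔ (unitDisk (c i) ∩ R).Nonempty := by
  rw [← Set.inter_assoc, Set.inter_right_comm, Set.inter_eq_left.2 (hsq i)]

theorem length_regionTris_squareTris (bands : List (Band (Fin n))) (h : bands.length = k) :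
    (regionTris bands (squareTris M)).length ≤ 2 * 64 ^ k := by
  refine (length_regionTris_le _ _).trans (le_of_eq ?_)
  rw [h, squareTris, List.length_cons, List.length_cons, List.length_nil]
  ring

/-- The triangles of a child are clipped afresh from the square and not from the triangles of its
parent, so their number does not grow with the depth. Its disks are among those of the parent, as
`R' ⊆ R`. -/
theorem IsState.child (hM : 0 < M) (hsq : ∀ i, unitDisk (c i) ⊆ square M)
    (h : IsState c k (2 * 64 ^ k) M R bands ts) (hR : R' ⊆ R)
    (hreg : R' ∩ square M = square M ∩ bandSet bands')
    (hne : (openSquare M ∩ openBandSet bands').Nonempty)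
    (hslopes : bands'.map Band.slope = bands.map Band.slope)
    (hdisks : ∀ b' ∈ bands', ∃ b ∈ bands, b'.slope = b.slope ∧ b'.disks = b.disks) :
    IsState c k (2 * 64 ^ k) M R'
      (bands'.map (Band.restrict c (regionTris bands' (squareTris M))))
      (regionTris bands' (squareTris M)) := by
  have hlen : bands'.length = k := by
    have := congrArg List.length (hslopes.trans h.slopes)
    simpa using this
  have hcov : cover (regionTris bands' (squareTris M)) = R' ∩ square M := by
    rw [cover_regionTris hM _ hne, hreg]
  refine ⟨⟨proper_regionTris _ _ (proper_squareTris hM), hcov,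
    length_regionTris_squareTris _ hlen⟩, ?_, ?_, ?_, ?_, ?_, ?_⟩
  · rw [hreg]
    congr 1
    ext p
    simp [bandSet, Band.restrict]
  · convert hne using 2
    ext p
    simp [openBandSet, Band.restrict]
  · rw [List.map_map, ← h.slopes, ← hslopes]
    rfl
  · intro b'' hb''
    obtain ⟨b', hb', rfl⟩ := List.mem_map.1 hb''
    obtain ⟨b, hb, -, hbd⟩ := hdisks b' hb'
    exact (hbd ▸ h.nodup b hb).filter _
  · intro b'' hb'' i
    obtain ⟨b', hb', rfl⟩ := List.mem_map.1 hb''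
    obtain ⟨b, hb, -, hbd⟩ := hdisks b' hb'
    simp only [Band.restrict, List.mem_filter, decide_eq_true_eq]
    rw [hbd, h.mem_disks b hb, hcov, hit_inter_square_iff hsq, mem_hitSet, mem_hitSet]
    exact ⟨fun h => h.2, fun h => ⟨h.mono (Set.inter_subset_inter_right _ hR), h⟩⟩
  · intro b'' hb''
    obtain ⟨b', hb', rfl⟩ := List.mem_map.1 hb''
    obtain ⟨b, hb, hbs, hbd⟩ := hdisks b' hb'
    have := h.sorted b hb
    rw [← hbd, ← hbs] at this
    exact this.filter _

theorem bandSet_append_cons {pre post : List (Band (Fin n))} {b : Band (Fin n)} {p : Plane} :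
    p ∈ bandSet (pre ++ b :: post) ↔
      (b.lo ≤ proj b.slope p ∧ proj b.slope p ≤ b.hi) ∧ p ∈ bandSet (pre ++ post) := by
  simp only [bandSet, Set.mem_ofPred_eq, List.mem_append, List.mem_cons]
  grind

theorem openBandSet_append_cons {pre post : List (Band (Fin n))} {b : Band (Fin n)} {p : Plane} :
    p ∈ openBandSet (pre ++ b :: post) ↔
      (b.lo < proj b.slope p ∧ proj b.slope p < b.hi) ∧ p ∈ openBandSet (pre ++ post) := by
  simp only [openBandSet, Set.mem_ofPred_eq, List.mem_append, List.mem_cons]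
  grind

/-- A small step from `x` towards `y` preserves a strict inequality. -/
theorem exists_small_step {x y t : ℝ} (h : t < x) :
    ∃ s : ℝ, 0 < s ∧ s ≤ 1 ∧ t < (1 - s) * x + s * y := by
  have hcont : Continuous fun s : ℝ => (1 - s) * x + s * y := by fun_prop
  have h1 := (hcont.continuousAt (x := 0)).eventually_const_lt (u := t) (by simpa using h)
  obtain ⟨δ, hδ, hball⟩ := Metric.eventually_nhds_iff.1 h1
  refine ⟨min (δ / 2) 1, by positivity, min_le_right _ _, hball ?_⟩
  rw [Real.dist_eq, sub_zero, abs_of_pos (by positivity)]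
  exact (min_le_left _ _).trans_lt (by linarith)

/-! ### The line in a gap and its two children. -/

section Gap

variable {pre post : List (Band (Fin n))} {b : Band (Fin n)} {s : ℕ} {i i' : Fin n} {t : ℝ}

theorem IsState.hit_of_gap (h : IsState c k N M R bands ts) (hb : b ∈ bands)
    (hg : IsGap q c d m b s i i') :
    (unitDisk (c i) ∩ R).Nonempty ∧ (unitDisk (c i') ∩ R).Nonempty :=
  ⟨mem_hitSet.1 ((h.mem_disks b hb i).1 (List.mem_of_getElem? hg.2.1)),
    mem_hitSet.1 ((h.mem_disks b hb i').1 (List.mem_of_getElem? hg.2.2.1))⟩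

/-- Both disks of the gap meet the region, and the line is farther from their keys than `1 + j`; so
the region has points strictly on either side. -/
theorem IsState.points_of_gap (hsq : ∀ i, unitDisk (c i) ⊆ square M)
    (h : IsState c k N M R bands ts) (hb : b ∈ bands)
    (hg : IsGap q c d m b s i i') (ht : t = 1 / 2 * (proj b.slope (c i) + proj b.slope (c i'))) :
    ∃ x ∈ square M ∩ bandSet bands, ∃ y ∈ square M ∩ bandSet bands,
      proj b.slope x < t ∧ t < proj b.slope y := by
  obtain ⟨⟨x, hx, hxR⟩, y, hy, hyR⟩ := h.hit_of_gap hb hg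
  refine ⟨x, h.region ▸ ⟨hxR, hsq _ hx⟩, y, h.region ▸ ⟨hyR, hsq _ hy⟩, ?_, ?_⟩
  · have := (abs_le.1 (dist_proj_le (j := b.slope) hx)).2
    have := hg.2.2.2
    linarith
  · have := (abs_le.1 (dist_proj_le (j := b.slope) hy)).1
    have := hg.2.2.2
    linarith

/-- The point `x` of the region before the line shows that `t` exceeds the old lower end of the
band, so replacing that end loses no constraint. A small step from the point `y` beyond the line
towards an old interior point yields a new interior point. -/
theorem IsState.left (hM : 0 < M) (hsq : ∀ i, unitDisk (c i) ⊆ square M)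
    (h : IsState c k (2 * 64 ^ k) M R (pre ++ b :: post) ts) (hg : IsGap q c d m b s i i')
    (ht : t = 1 / 2 * (proj b.slope (c i) + proj b.slope (c i'))) :
    IsState c k (2 * 64 ^ k) M (R ∩ (bandLine b.slope t).left)
      ((pre ++ { b with lo := t } :: post).map (Band.restrict c
        (regionTris (pre ++ { b with lo := t } :: post) (squareTris M))))
      (regionTris (pre ++ { b with lo := t } :: post) (squareTris M)) := by
  obtain ⟨x, hx, y, hy, hxt, hty⟩ := h.points_of_gap hsq (by simp) hg ht
  refine h.child hM hsq Set.inter_subset_left ?_ ?_ (by simp) ?_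
  · rw [Set.inter_right_comm, h.region]
    ext p
    simp only [Set.mem_inter_iff, bandSet_append_cons, DirLine.left, Set.mem_ofPred_eq,
      side_bandLine]
    have := (bandSet_append_cons.1 hx.2).1.1
    constructor
    · rintro ⟨⟨h1, ⟨h2, h3⟩, h4⟩, h5⟩
      exact ⟨h1, ⟨by linarith, h3⟩, h4⟩
    · rintro ⟨h1, ⟨h2, h3⟩, h4⟩
      exact ⟨⟨h1, ⟨by linarith, h3⟩, h4⟩, by linarith⟩
  · obtain ⟨z, hz⟩ := h.nonempty
    obtain ⟨r, h0, h1, hr⟩ := exists_small_step (y := proj b.slope z) hty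
    obtain ⟨g1, g2⟩ := lerp_mem_open hy hz h0 h1
    rw [openBandSet_append_cons] at g2
    rw [← proj_lerp] at hr
    exact ⟨_, g1, openBandSet_append_cons.2 ⟨⟨hr, g2.1.2⟩, g2.2⟩⟩
  · intro b' hb'
    rcases List.mem_append.1 hb' with hb' | hb'
    · exact ⟨b', by simp [hb'], rfl, rfl⟩
    rcases List.mem_cons.1 hb' with rfl | hb'
    · exact ⟨b, by simp, rfl, rfl⟩
    · exact ⟨b', by simp [hb'], rfl, rfl⟩

theorem IsState.right (hM : 0 < M) (hsq : ∀ i, unitDisk (c i) ⊆ square M)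
    (h : IsState c k (2 * 64 ^ k) M R (pre ++ b :: post) ts) (hg : IsGap q c d m b s i i')
    (ht : t = 1 / 2 * (proj b.slope (c i) + proj b.slope (c i'))) :
    IsState c k (2 * 64 ^ k) M (R ∩ (bandLine b.slope t).right)
      ((pre ++ { b with hi := t } :: post).map (Band.restrict c
        (regionTris (pre ++ { b with hi := t } :: post) (squareTris M))))
      (regionTris (pre ++ { b with hi := t } :: post) (squareTris M)) := by
  obtain ⟨x, hx, y, hy, hxt, hty⟩ := h.points_of_gap hsq (by simp) hg ht
  refine h.child hM hsq Set.inter_subset_left ?_ ?_ (by simp) ?_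
  · rw [Set.inter_right_comm, h.region]
    ext p
    simp only [Set.mem_inter_iff, bandSet_append_cons, DirLine.right, Set.mem_ofPred_eq,
      side_bandLine]
    have := (bandSet_append_cons.1 hy.2).1.2
    constructor
    · rintro ⟨⟨h1, ⟨h2, h3⟩, h4⟩, h5⟩
      exact ⟨h1, ⟨h2, by linarith⟩, h4⟩
    · rintro ⟨h1, ⟨h2, h3⟩, h4⟩
      exact ⟨⟨h1, ⟨h2, by linarith⟩, h4⟩, by linarith⟩
  · obtain ⟨z, hz⟩ := h.nonempty
    -- The mirror image of the left child, with signs changed so that the same one-sided lemma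
    -- serves.
    obtain ⟨r, h0, h1, hr⟩ := exists_small_step (y := -proj b.slope z) (neg_lt_neg hxt)
    obtain ⟨g1, g2⟩ := lerp_mem_open hx hz h0 h1
    rw [openBandSet_append_cons] at g2
    have hr' : proj b.slope (lerp r x z) < t := by rw [proj_lerp]; linarith
    exact ⟨_, g1, openBandSet_append_cons.2 ⟨⟨g2.1.1, hr'⟩, g2.2⟩⟩
  · intro b' hb'
    rcases List.mem_append.1 hb' with hb' | hb'
    · exact ⟨b', by simp [hb'], rfl, rfl⟩
    rcases List.mem_cons.1 hb' with rfl | hb'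
    · exact ⟨b, by simp, rfl, rfl⟩
    · exact ⟨b', by simp [hb'], rfl, rfl⟩

/-- The counts for the line of a gap. -/
theorem IsState.counts (h : IsState c k N M R bands ts) (hb : b ∈ bands)
    (hg : IsGap q c (hitSet c R).card m b s i i') (hm : 1 ≤ m)
    (ht : t = 1 / 2 * (proj b.slope (c i) + proj b.slope (c i'))) :
    ∃ p : ℕ, ((1 / 2 - 1 / (2 * q) : ℝ) * (hitSet c R).card ≤ p) ∧
      ((p + m : ℕ) : ℝ) ≤ (1 / 2 + 1 / (2 * q) : ℝ) * (hitSet c R).card ∧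
      diskCount c (R ∩ (bandLine b.slope t).left) ≤ (hitSet c R).card - (p + 1) ∧
      diskCount c (R ∩ (bandLine b.slope t).right) ≤ p + m ∧
      crossCount c R (bandLine b.slope t) ≤ m - 1 := by
  classical
  set d := (hitSet c R).card with hd
  obtain ⟨g1, g2, g3, g4⟩ := hg
  have hr0 : (0 : ℝ) ≤ 1 / q * d - m - 1 := (Nat.cast_nonneg s).trans g1
  set i0 := ⌈(1 / 2 - 1 / (2 * q) : ℝ) * d⌉₊ with hi0
  have hi0' : (1 / 2 - 1 / (2 * q) : ℝ) * d ≤ i0 := Nat.le_ceil _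
  have e2 : (1 : ℝ) / (2 * q) = 1 / 2 * (1 / q) := by rw [one_div_mul_one_div]
  -- The upper bound for a ceiling requires a nonnegative argument, which a positive ceiling
  -- supplies; a zero ceiling is treated separately.
  have hi0'' : (i0 : ℝ) ≤ (1 / 2 - 1 / (2 * q) : ℝ) * d + 1 ∨ i0 = 0 := by
    rcases Nat.eq_zero_or_pos i0 with h0 | h0
    · exact Or.inr h0
    · refine Or.inl (Nat.ceil_lt_add_one ?_).le
      exact (Nat.ceil_pos.1 h0).le
  have hsorted := h.sorted b hb
  have hlen := h.length_disks hb
  have hmem : ∀ x, (unitDisk (c x) ∩ R).Nonempty → x ∈ b.disks := fun x hx =>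
    (h.mem_disks b hb x).2 (mem_hitSet.2 hx)
  have g3' : b.disks[i0 + s + m]? = some i' := by rw [← g3]; congr 1; ring
  -- The key of a disk that reaches the left side is more than `t - (1 + j)`, or equal to it, hence
  -- beyond the key of `i`. Thus all three counts become counts of positions in the sorted list.
  have hleft : ∀ x, (unitDisk (c x) ∩ (bandLine b.slope t).left).Nonempty →
      proj b.slope (c i) < proj b.slope (c x) := by
    rintro x ⟨r, hr, hr'⟩
    have h1 := (abs_le.1 (dist_proj_le (j := b.slope) hr)).2
    rw [DirLine.left, Set.mem_ofPred_eq, side_bandLine] at hr'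
    linarith
  have hright : ∀ x, (unitDisk (c x) ∩ (bandLine b.slope t).right).Nonempty →
      proj b.slope (c x) < proj b.slope (c i') := by
    rintro x ⟨r, hr, hr'⟩
    have h1 := (abs_le.1 (dist_proj_le (j := b.slope) hr)).1
    rw [DirLine.right, Set.mem_ofPred_eq, side_bandLine] at hr'
    linarith
  refine ⟨i0 + s, ?_, ?_, ?_, ?_, ?_⟩
  · push_cast; linarith [Nat.cast_nonneg (α := ℝ) s]
  · push_cast
    have hd0 : (0 : ℝ) ≤ d := Nat.cast_nonneg _
    have hlt : i0 + s + m < d := by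
      have := (List.getElem?_eq_some_iff.1 g3').1
      omega
    rw [e2] at *
    rcases hi0'' with h0 | h0
    · linarith
    · have hq1 : (1 : ℝ) / q * d - 1 ≤ (1 / 2 + 1 / 2 * (1 / q)) * d := by
        by_cases hq : q = 0
        · subst hq; simp; linarith
        · have : (1 : ℝ) / q ≤ 1 := by
            rw [div_le_one (by positivity)]
            exact_mod_cast Nat.one_le_iff_ne_zero.2 hq
          nlinarith
      rw [h0, Nat.cast_zero]
      linarith
  · have h1 := ncard_le_length_filter (L := b.disks)
      (X := {x | (unitDisk (c x) ∩ (R ∩ (bandLine b.slope t).left)).Nonempty})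
      (fun x => proj b.slope (c i) < proj b.slope (c x)) ?_
    · have h2 := (length_filter_gt_le hsorted g2
        (fun x => proj b.slope (c i) < proj b.slope (c x)) (by simp)).1
      rw [hlen] at h2
      exact h1.trans h2
    · intro x hx
      exact ⟨hmem x (hx.mono (Set.inter_subset_inter_right _ Set.inter_subset_left)),
        decide_eq_true (hleft x (hx.mono (Set.inter_subset_inter_right _ Set.inter_subset_right)))⟩
  · have h1 := ncard_le_length_filter (L := b.disks)
      (X := {x | (unitDisk (c x) ∩ (R ∩ (bandLine b.slope t).right)).Nonempty})
      (fun x => proj b.slope (c x) < proj b.slope (c i')) ?_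
    · exact h1.trans (length_filter_lt_le hsorted g3'
        (fun x => proj b.slope (c x) < proj b.slope (c i')) (by simp))
    · intro x hx
      exact ⟨hmem x (hx.mono (Set.inter_subset_inter_right _ Set.inter_subset_left)),
        decide_eq_true (hright x (hx.mono (Set.inter_subset_inter_right _ Set.inter_subset_right)))⟩
  · have h1 := ncard_le_length_filter (L := b.disks)
      (X := {x | (unitDisk (c x) ∩ R).Nonempty ∧
        (unitDisk (c x) ∩ (bandLine b.slope t).carrier).Nonempty})
      (fun x => proj b.slope (c i) < proj b.slope (c x) ∧
        proj b.slope (c x) < proj b.slope (c i')) ?_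
    · have h2 := length_filter_between_le hsorted g2 g3' (by omega)
        (fun x => proj b.slope (c i) < proj b.slope (c x) ∧
        proj b.slope (c x) < proj b.slope (c i')) (by simp)
      exact h1.trans (h2.trans (by omega))
    · rintro x ⟨hx, hx'⟩
      refine ⟨hmem x hx, decide_eq_true ⟨hleft x (hx'.mono ?_), hright x (hx'.mono ?_)⟩⟩
      · exact Set.inter_subset_inter_right _ fun r hr => (show _ = _ from hr).ge
      · exact Set.inter_subset_inter_right _ fun r hr => (show _ = _ from hr).le

end Gap

end States


/-! ### Building the tree -/

/-- A tree whose nodes hold the triangles of their regions. -/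
inductive AugTree : Type
  | leaf (ts : List Tri) : AugTree
  | node (ts : List Tri) (a b : AugTree) : AugTree

def encAug : AugTree → Val
  | .leaf ts => .pair (encTris ts) .nil
  | .node ts a b => .pair (encTris ts) (.pair (encAug a) (encAug b))

/-- The triangles in the augmented tree belong to the regions of the tree. -/
def Matches (M : ℝ) (N : ℕ) : AugTree → LineTree → Set Plane → Prop
  | .leaf ts, .leaf, R => IsCover M N ts R
  | .node ts a b, .node l u w, R =>
      IsCover M N ts R ∧ Matches M N a u (R ∩ l.left) ∧ Matches M N b w (R ∩ l.right)
  | _, _, _ => False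

section Build

variable {n : ℕ} {c : Fin n → Plane} {q k K N d m : ℕ} {M τ : ℝ} {R R' : Set Plane}
  {bands bands' : List (Band (Fin n))} {ts : List Tri}

/-! ### Counting the nodes visited by queries. -/

open Classical in
/-- The number of nodes that are visited by the query with a disk. -/
def visits (c : Fin n → Plane) (i : Fin n) : AugTree → ℕ
  | .leaf _ => 1
  | .node ts a b =>
      if (unitDisk (c i) ∩ cover ts).Nonempty then 1 + visits c i a + visits c i b else 1

/-- The number of nodes visited by the queries with the disks that intersect the region. -/
def totalVisits (c : Fin n → Plane) (A : AugTree) (R : Set Plane) : ℕ :=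
  ∑ i ∈ hitSet c R, visits c i A

theorem Matches.isCover {A : AugTree} {T : LineTree} (h : Matches M N A T R) :
    ∃ ts, IsCover M N ts R ∧ ((A = .leaf ts ∧ T = .leaf) ∨
      ∃ a b l u w, A = .node ts a b ∧ T = .node l u w ∧ Matches M N a u (R ∩ l.left) ∧
        Matches M N b w (R ∩ l.right)) := by
  cases A <;> cases T <;> simp only [Matches] at h
  · exact ⟨_, h, Or.inl ⟨rfl, rfl⟩⟩
  · exact ⟨_, h.1, Or.inr ⟨_, _, _, _, _, rfl, rfl, h.2⟩⟩

theorem visits_eq_one (hsq : ∀ i, unitDisk (c i) ⊆ square M) {A : AugTree} {T : LineTree}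
    (h : Matches M N A T R) {i : Fin n} (hi : i ∉ hitSet c R) : visits c i A = 1 := by
  obtain ⟨ts, hts, ⟨rfl, -⟩ | ⟨a, b, l, u, w, rfl, -⟩⟩ := h.isCover
  · rfl
  · rw [visits, if_neg]
    rwa [hts.cover_eq, hit_inter_square_iff hsq, ← mem_hitSet]

/-- A disk of the parent that misses the child stops there after a single visit. -/
theorem sum_visits_le (hsq : ∀ i, unitDisk (c i) ⊆ square M) {A : AugTree} {T : LineTree}
    (h : Matches M N A T R') (hR : R' ⊆ R) :
    ∑ i ∈ hitSet c R, visits c i A ≤ totalVisits c A R' + (hitSet c R).card := by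
  have hsub : hitSet c R' ⊆ hitSet c R := fun i hi =>
    mem_hitSet.2 ((mem_hitSet.1 hi).mono (Set.inter_subset_inter_right _ hR))
  rw [← Finset.sum_sdiff hsub, add_comm]
  refine Nat.add_le_add_left ?_ _
  rw [Finset.sum_congr rfl fun i hi => visits_eq_one hsq h (Finset.mem_sdiff.1 hi).2]
  simpa using Finset.card_le_card Finset.sdiff_subset

/-- The factor `3` counts the visit of the node itself and one possibly unsuccessful visit to each
child. -/
theorem totalVisits_node_le (hsq : ∀ i, unitDisk (c i) ⊆ square M) {a b : AugTree}
    {u w : LineTree} {l : DirLine} (ha : Matches M N a u (R ∩ l.left))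
    (hb : Matches M N b w (R ∩ l.right)) :
    totalVisits c (.node ts a b) R ≤ totalVisits c a (R ∩ l.left) + totalVisits c b (R ∩ l.right) +
      3 * (hitSet c R).card := by
  have h1 := sum_visits_le hsq ha Set.inter_subset_left
  have h2 := sum_visits_le hsq hb Set.inter_subset_left
  have h3 : totalVisits c (.node ts a b) R ≤
      ∑ i ∈ hitSet c R, (1 + visits c i a + visits c i b) := by
    refine Finset.sum_le_sum fun i _ => ?_
    rw [visits]
    split_ifs <;> omega
  rw [Finset.sum_add_distrib, Finset.sum_add_distrib, Finset.sum_const, smul_eq_mul, mul_one] at h3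
  omega

/-! ### Cost of the construction. -/

/-- The costs of the computation of a child. -/
def childCost (k : ℕ) (d : ℝ) : ℝ :=
  90000 * (k + 1) * 64 ^ k + ((500 * (2 * 64 ^ k) + 50) * d + 50) * k + 100

theorem fn_child (hM : 0 < M) (hlen : bands.length = k) (hd : ∀ b ∈ bands, b.disks.length = d)
    {v : Val} {t : ℝ}
    (h : Fn (prog q k K) fBuild (.pair (.num M)
      (.pair (encTris (regionTris bands (squareTris M)))
        (encBands c (bands.map (Band.restrict c (regionTris bands (squareTris M))))))) v t) :
    Fn (prog q k K) fChild (.pair (.num M) (encBands c bands)) v (t + childCost k d) := by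
  have hreg := fn_region (q := q) (k := k) (K := K) (c := c) bands (squareTris M)
  have hfil := fn_filterDirs (q := q) (k := k) (K := K) (c := c)
    (regionTris bands (squareTris M)) (proper_regionTris _ _ (proper_squareTris hM)) d bands hd
  refine ⟨_, rfl, Ev.mono (Ev.open rfl <| Ev.letIn (.call (.pair (.var rfl)
    (.call (.var rfl) (fn_box M))) hreg) <| .call (.pair (.var rfl) (.pair (.var rfl)
      (.call (.pair (.var rfl) (.var rfl)) hfil))) h) ?_⟩
  have h1 := length_regionTris_squareTris (M := M) bands hlen
  have h1' : ((regionTris bands (squareTris M)).length : ℝ) ≤ 2 * 64 ^ k := by exact_mod_cast h1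
  have h2 : ((500 * ((regionTris bands (squareTris M)).length : ℝ) + 50) * d + 50) * k ≤
      ((500 * (2 * 64 ^ k) + 50) * d + 50) * k := by gcongr
  have h3 : ((squareTris M).length : ℝ) = 2 := by simp [squareTris]
  rw [hlen, h3, childCost]
  rw [← hlen] at h2 ⊢
  linarith

/-- The cost of a node, as a multiple of the number of its disks. -/
def nodeCost (q k : ℕ) : ℝ :=
  1000 + 200 * q + 400 * k + 2 * (90000 * (k + 1) * 64 ^ k + (500 * (2 * 64 ^ k) + 100) * k + 100)

/-- The leaf constant is large enough. -/
structure IsLeafBound (q K : ℕ) : Prop where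
  two_le : 2 ≤ K
  gap_le : gapBound q ≤ K
  -- The hypothesis of `mul_log_add_mul_log_le` that makes it affordable to hand up to `m` disks to
  -- both children.
  log_le : ∀ d m : ℕ, K < d → m ^ (2 * q) ≤ d ^ (q + 1) →
    (m : ℝ) * Real.log d ≤ Real.log (1 / 2 + 1 / (2 * q) : ℝ)⁻¹ / 2 * d

/-- The cost of a leaf. -/
def leafCost (K : ℕ) : ℝ := 20 * K + 100

/-- The factor of `d * log d` in the cost of the construction. -/
def buildConst (q k K : ℕ) : ℝ :=
  2 * (nodeCost q k + leafCost K) / Real.log (1 / 2 + 1 / (2 * q) : ℝ)⁻¹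

theorem nodeCost_ge (q k : ℕ) : 1000 ≤ nodeCost q k := by
  have : (0 : ℝ) ≤ 200 * q + 400 * k +
    2 * (90000 * (k + 1) * 64 ^ k + (500 * (2 * 64 ^ k) + 100) * k + 100) := by positivity
  rw [nodeCost]; linarith

theorem leafCost_ge (K : ℕ) : 100 ≤ leafCost K := by
  rw [leafCost]; linarith [Nat.cast_nonneg (α := ℝ) K]

theorem ratio_bounds (hq : 2 ≤ q) : (1 / 2 : ℝ) < 1 / 2 + 1 / (2 * q) ∧
    (1 / 2 + 1 / (2 * q) : ℝ) ≤ 3 / 4 ∧ 0 < Real.log (1 / 2 + 1 / (2 * q) : ℝ)⁻¹ := by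
  have hq' : (2 : ℝ) ≤ q := by exact_mod_cast hq
  have h1 : (0 : ℝ) < 1 / (2 * q) := by positivity
  have h2 : (1 : ℝ) / (2 * q) ≤ 1 / 4 := one_div_le_one_div_of_le (by norm_num) (by linarith)
  refine ⟨by linarith, by linarith, Real.log_pos (one_lt_inv_iff₀.2 ⟨by linarith, by linarith⟩)⟩

theorem buildConst_nonneg (hq : 2 ≤ q) : 0 ≤ buildConst q k K :=
  div_nonneg (by linarith [nodeCost_ge q k, leafCost_ge K]) (ratio_bounds hq).2.2.le

/-- The potential drops by `(nodeCost + leafCost) * d`. This pays for the work at the node and for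
the second additive `leafCost`, as there are two children but one parent. -/
theorem buildConst_step (hq : 2 ≤ q) (hK : IsLeafBound q K) {d m x y : ℕ} (hd : K < d)
    (hm : m ^ (2 * q) ≤ d ^ (q + 1)) (hx : (x : ℝ) ≤ (1 / 2 + 1 / (2 * q) : ℝ) * d)
    (hy : (y : ℝ) ≤ (1 / 2 + 1 / (2 * q) : ℝ) * d) (hxy : x + y ≤ d + m) :
    (buildConst q k K * (x * Real.log x) + leafCost K) +
      (buildConst q k K * (y * Real.log y) + leafCost K) + nodeCost q k * d ≤
      buildConst q k K * (d * Real.log d) + leafCost K := by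
  obtain ⟨h1, h2, h3⟩ := ratio_bounds hq
  have hd2 : (2 : ℝ) ≤ d := by
    have := hK.two_le
    exact_mod_cast (by omega : 2 ≤ d)
  have := mul_log_add_mul_log_le (α := (1 / 2 + 1 / (2 * q) : ℝ)) (d := d) (x := x) (y := y)
    (m := m) (by linarith) (by nlinarith) (by linarith) (by positivity) (by positivity)
    (by positivity) hx hy (by exact_mod_cast hxy) (hK.log_le d m hd hm)
  have h4 := mul_le_mul_of_nonneg_left this (buildConst_nonneg (k := k) (K := K) hq)
  have h5 : buildConst q k K * Real.log (1 / 2 + 1 / (2 * q) : ℝ)⁻¹ =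
      2 * (nodeCost q k + leafCost K) := by
    rw [buildConst, div_mul_cancel₀ _ h3.ne']
  have h6 : leafCost K ≤ leafCost K * d := by
    nlinarith [leafCost_ge K]
  nlinarith

/-- The exponent `(q + 1)/(2q)` equals `1/2 + 1/(2q)`. -/
theorem root_le_rpow (hq : 2 ≤ q) {d m : ℕ} (hm : m ^ (2 * q) ≤ d ^ (q + 1)) :
    (m : ℝ) ≤ (d : ℝ) ^ (1 / 2 + 1 / (2 * q) : ℝ) := by
  have hq' : (0 : ℝ) < q := by exact_mod_cast (by omega : 0 < q)
  have h1 : (m : ℝ) = ((m : ℝ) ^ (2 * q)) ^ ((1 : ℝ) / (2 * q)) := by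
    rw [← Real.rpow_natCast, ← Real.rpow_mul (Nat.cast_nonneg _)]
    push_cast
    rw [mul_one_div_cancel (by positivity), Real.rpow_one]
  have h2 : (d : ℝ) ^ (1 / 2 + 1 / (2 * q) : ℝ) = ((d : ℝ) ^ (q + 1)) ^ ((1 : ℝ) / (2 * q)) := by
    rw [← Real.rpow_natCast, ← Real.rpow_mul (Nat.cast_nonneg _)]
    congr 1
    push_cast
    field_simp
  rw [h1, h2]
  refine Real.rpow_le_rpow (by positivity) ?_ (by positivity)
  exact_mod_cast hm

/-- Strong induction on the number of disks. Time and query visits are carried in one statement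
because both obey the recurrence of `buildConst_step`. -/
theorem fn_build (hq : 2 ≤ q) (hK : IsLeafBound q K) {α β : ℝ}
    (hα : (1 / 2 + 1 / (2 * q) : ℝ) ≤ α) (hβ : (1 / 2 + 1 / (2 * q) : ℝ) ≤ β)
    (hc : Pairwise fun i j => Disjoint (unitDisk (c i)) (unitDisk (c j))) (hM : 0 < M)
    (hsq : ∀ i, unitDisk (c i) ⊆ square M) (hτ : ∀ i, ∀ j < 4 * q, |proj j (c i)| ≤ τ) (d : ℕ) :
    ∀ (R : Set Plane) (bands : List (Band (Fin n))) (ts : List Tri),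
      IsState c (4 * q) (2 * 64 ^ (4 * q)) M R bands ts → (hitSet c R).card = d →
      ∃ T A, Fn (prog q (4 * q) K) fBuild (.pair (.num M) (.pair (encTris ts) (encBands c bands)))
          (.pair (encTree T) (encAug A))
          (buildConst q (4 * q) K * (d * Real.log d) + leafCost K) ∧
        IsSDTFrom α β K c T R ∧ LinesIn (4 * q) τ T ∧ Matches M (2 * 64 ^ (4 * q)) A T R ∧
        (totalVisits c A R : ℝ) ≤ buildConst q (4 * q) K * (d * Real.log d) + leafCost K := by
  induction d using Nat.strong_induction_on with
  | _ d ih =>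
  intro R bands ts hS hd
  have hlog : 0 ≤ buildConst q (4 * q) K * (d * Real.log d) :=
    mul_nonneg (buildConst_nonneg hq) (mul_nonneg (Nat.cast_nonneg _) (Real.log_natCast_nonneg d))
  have hblen : bands.length = 4 * q := by simpa using congrArg List.length hS.slopes
  have hbd : ∀ b ∈ bands, b.disks.length = d := fun b hb => (hS.length_disks hb).trans hd
  obtain ⟨b0, rest, hb0⟩ : ∃ b0 rest, bands = b0 :: rest := by
    cases bands with
    | nil => simp at hblen; omega
    | cons b0 rest => exact ⟨b0, rest, rfl⟩
  have hlenf := fn_len (q := q) (k := 4 * q) (K := K)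
    (b0.disks.map fun i => .pair (.num (proj b0.slope (c i))) (encPoint (c i)))
  rw [List.length_map, hbd b0 (by simp [hb0])] at hlenf
  rcases le_or_gt d K with hdK | hdK
  · refine ⟨.leaf, .leaf ts, ?_, ?_, trivial, hS.isCover, ?_⟩
    · rw [hb0]
      refine ⟨_, rfl, Ev.mono (Ev.open rfl <| Ev.open rfl <| Ev.open rfl <| Ev.open rfl <|
        Ev.open rfl <| Ev.open rfl <| Ev.letIn (.call (.var rfl) hlenf) <|
        Ev.ifLt_true (.var rfl) (.num _ rfl rfl) ?_ (.pair .nil (.pair (.var rfl) .nil))) ?_⟩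
      · push_cast
        exact_mod_cast Nat.lt_succ_of_le hdK
      · have : (d : ℝ) ≤ K := by exact_mod_cast hdK
        rw [leafCost]
        norm_num [arithCost]; linarith
    · rw [IsSDTFrom, diskCount_eq, hd]
      exact hdK
    · have : (d : ℝ) ≤ K := by exact_mod_cast hdK
      rw [totalVisits, leafCost]
      simp only [visits, Finset.sum_const, smul_eq_mul, mul_one, hd]
      linarith [Nat.cast_nonneg (α := ℝ) K]
  · obtain ⟨m, hm, hm', hroot⟩ := fn_root (k := 4 * q) (K := K) hq d
    have hd0 : 0 < d := by omega
    have hd1 : (1 : ℝ) ≤ d := by exact_mod_cast hd0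
    have hm1 := (root_bounds hq (lt_of_le_of_lt hK.gap_le hdK) hm hm').1
    obtain ⟨o, ho, hcase⟩ := fn_choose (q := q) (k := 4 * q) (K := K) (c := c) d m bands hbd
    -- The unsuccessful search, for which the program has no meaningful continuation, is impossible
    -- above the leaf constant by `exists_isGap`.
    rcases hcase with ⟨-, hno⟩ | ⟨pre, b, post, s, i, i', t, hbands, hg, ht, rfl⟩
    · obtain ⟨b, hb, s, i, i', hg⟩ := exists_isGap hc hq (lt_of_le_of_lt hK.gap_le hdK) hm hm'
        (hitSet c R) hd bands hS.slopes fun b hb =>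
          ⟨hbd b hb, hS.nodup b hb, fun i => (hS.mem_disks b hb i).1, hS.sorted b hb⟩
      exact absurd hg (hno b hb s i i')
    have hbmem : b ∈ bands := by simp [hbands]
    obtain ⟨p, hp1, hp2, hl, hr, hx⟩ := hS.counts hbmem (by rw [hd]; exact hg) hm1 ht
    rw [hd] at hp1 hp2 hl
    obtain ⟨r1, r2, -⟩ := ratio_bounds hq
    -- Both children have fewer disks than the node, which the induction needs.
    have hpd : p + m < d := by
      have : ((p + m : ℕ) : ℝ) < d := by nlinarith
      exact_mod_cast this
    rw [diskCount_eq] at hl hr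
    set du := (hitSet c (R ∩ (bandLine b.slope t).left)).card with hdu
    set dw := (hitSet c (R ∩ (bandLine b.slope t).right)).card with hdw
    have hdu' : (du : ℝ) ≤ (1 / 2 + 1 / (2 * q) : ℝ) * d := by
      have h1 : du + p ≤ d := by omega
      have h2 : (du : ℝ) + p ≤ d := by exact_mod_cast h1
      linarith
    have hdw' : (dw : ℝ) ≤ (1 / 2 + 1 / (2 * q) : ℝ) * d :=
      le_trans (by exact_mod_cast hr) hp2
    have hdud : du < d := by omega
    have hdwd : dw < d := by omega
    have hS' := hS
    rw [hbands] at hS'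
    have hL := hS'.left hM hsq hg ht
    have hRt := hS'.right hM hsq hg ht
    obtain ⟨Tu, Au, fu, su, lu, mu, vu⟩ := ih du hdud _ _ _ hL rfl
    obtain ⟨Tw, Aw, fw, sw, lw, mw, vw⟩ := ih dw hdwd _ _ _ hRt rfl
    have hlenL : (pre ++ { b with lo := t } :: post).length = 4 * q := by
      rw [← hblen, hbands]; simp
    have hlenR : (pre ++ { b with hi := t } :: post).length = 4 * q := by
      rw [← hblen, hbands]; simp
    have hbdL : ∀ b' ∈ pre ++ { b with lo := t } :: post, b'.disks.length = d := by
      intro b' hb'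
      rcases List.mem_append.1 hb' with hb' | hb'
      · exact hbd b' (by simp [hbands, hb'])
      rcases List.mem_cons.1 hb' with rfl | hb'
      · exact hbd b hbmem
      · exact hbd b' (by simp [hbands, hb'])
    have hbdR : ∀ b' ∈ pre ++ { b with hi := t } :: post, b'.disks.length = d := by
      intro b' hb'
      rcases List.mem_append.1 hb' with hb' | hb'
      · exact hbd b' (by simp [hbands, hb'])
      rcases List.mem_cons.1 hb' with rfl | hb'
      · exact hbd b hbmem
      · exact hbd b' (by simp [hbands, hb'])
    have cu := fn_child hM hlenL hbdL fu
    have cw := fn_child hM hlenR hbdR fw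
    have hstep := buildConst_step (k := 4 * q) (x := du) (y := dw) hq hK hdK hm hdu' hdw' (by omega)
    have hslope : b.slope < 4 * q := by
      have : b.slope ∈ bands.map Band.slope := List.mem_map_of_mem hbmem
      rw [hS.slopes, List.mem_range'_1] at this
      omega
    have htτ : |t| ≤ τ := by
      have h1 := hτ i b.slope hslope
      have h2 := hτ i' b.slope hslope
      rw [abs_le] at h1 h2 ⊢
      constructor <;> linarith
    refine ⟨.node (bandLine b.slope t) Tu Tw, .node ts Au Aw, ?_, ?_, ?_, ?_, ?_⟩
    · rw [hb0] at ho ⊢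
      refine ⟨_, rfl, Ev.mono (Ev.open rfl <| Ev.open rfl <| Ev.open rfl <| Ev.open rfl <|
        Ev.open rfl <| Ev.open rfl <| Ev.letIn (.call (.var rfl) hlenf) <|
        Ev.ifLt_false (.var rfl) (.num _ rfl rfl) ?_ <|
        Ev.split_pair (.call (.pair (.var rfl) (.pair (.call (.pair (.var rfl)
          (.num _ rfl (by simp))) hroot) (.var rfl))) ho) <| Ev.open rfl <|
        Ev.split_pair (.call (.pair (.var rfl) (.var rfl)) cu) <|
        Ev.split_pair (.call (.pair (.var rfl) (.var rfl)) cw) <|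
        .pair (.pair (.var rfl) (.pair (.var rfl) (.var rfl)))
          (.pair (.var rfl) (.pair (.var rfl) (.var rfl)))) ?_⟩
      · push_cast
        exact_mod_cast hdK
      · rw [hb0] at hblen
        rw [hblen]
        refine le_trans ?_ hstep
        have hcc : 2 * childCost (4 * q : ℕ) d + (100 * q + 100) * (d + 1) +
            ((110 * d + 200) * (4 * q : ℕ) + 10) + 20 * d + 200 ≤ nodeCost q (4 * q) * d := by
          rw [childCost, nodeCost]
          have e1 : (0 : ℝ) ≤ 90000 * ((4 * q : ℕ) + 1) * 64 ^ (4 * q) := by positivity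
          have e2 : (0 : ℝ) ≤ 50 * (4 * q : ℕ) := by positivity
          have e3 : (0 : ℝ) ≤ q := Nat.cast_nonneg _
          have e4 : (0 : ℝ) ≤ (4 * q : ℕ) := Nat.cast_nonneg _
          nlinarith
        norm_num [arithCost] at hcc ⊢
        linarith
    · refine ⟨?_, ?_, ?_, su, sw⟩
      · rw [diskCount_eq, hd]
        calc (crossCount c R (bandLine b.slope t) : ℝ) ≤ m := by
              exact_mod_cast hx.trans (Nat.sub_le _ _)
          _ ≤ _ := root_le_rpow hq hm
          _ ≤ _ := Real.rpow_le_rpow_of_exponent_le hd1 hβ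
      · rw [diskCount_eq, diskCount_eq, hd]
        exact hdu'.trans (by gcongr)
      · rw [diskCount_eq, diskCount_eq, hd]
        exact hdw'.trans (by gcongr)
    · exact ⟨⟨b.slope, hslope, t, htτ, rfl⟩, lu, lw⟩
    · exact ⟨hS.isCover, mu, mw⟩
    · have h1 := totalVisits_node_le (ts := ts) hsq mu mw
      have h2 : (totalVisits c (.node ts Au Aw) R : ℝ) ≤
          totalVisits c Au (R ∩ (bandLine b.slope t).left) +
            totalVisits c Aw (R ∩ (bandLine b.slope t).right) + 3 * d := by
        rw [← hd]; exact_mod_cast h1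
      have h3 : 3 * (d : ℝ) ≤ nodeCost q (4 * q) * d := by
        gcongr; linarith [nodeCost_ge q (4 * q)]
      linarith

/-! ### Queries -/

open Classical in
/-- The triangles of the leaf regions that meet a disk. -/
def answer (c : Fin n → Plane) (i : Fin n) : AugTree → List Tri
  | .leaf ts => if (unitDisk (c i) ∩ cover ts).Nonempty then ts else []
  | .node ts a b =>
      if (unitDisk (c i) ∩ cover ts).Nonempty then answer c i a ++ answer c i b else []

/-- The accumulator keeps concatenation cheap: the second child is queried first, and each leaf only
prepends its own triangles, at most `N` of them. -/
theorem fn_query (i : Fin n) {A : AugTree} {T : LineTree} (h : Matches M N A T R)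
    (acc : List Tri) :
    Fn (prog q k K) fQuery (.pair (encPoint (c i)) (.pair (encAug A) (encTris acc)))
      (encTris (answer c i A ++ acc)) ((600 * N + 100) * visits c i A) := by
  induction A generalizing T R acc with
  | leaf ts =>
    obtain ⟨ts', hts, ⟨h1, rfl⟩ | ⟨a, b, l, u, w, h1, -⟩⟩ := h.isCover
    · cases h1
      obtain ⟨x, hx, hx'⟩ := fn_hit (q := q) (k := k) (K := K) (c i) ts hts.proper
      have hlen : (ts.length : ℝ) ≤ N := by exact_mod_cast hts.length_le
      refine ⟨_, rfl, Ev.mono (Ev.open rfl <| Ev.open rfl <| Ev.open rfl <|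
        Ev.ifLt (.num _ rfl rfl) (.call (.pair (.var rfl) (.var rfl)) hx)
          (t₃ := 20 * ts.length + 20) (fun h0 => ?_) (fun h0 => ?_)) ?_⟩
      · have happ := fn_append (q := q) (k := k) (K := K) (ts.map encTri) (acc.map encTri)
        rw [← List.map_append, List.length_map] at happ
        rw [answer, if_pos (hx'.1 (by simpa using h0))]
        exact Ev.mono (Ev.empty rfl <| .call (.pair (.var rfl) (.var rfl)) happ)
          (by linarith)
      · rw [answer, if_neg fun h' => absurd (hx'.2 h') (by simpa using h0), List.nil_append]
        exact Ev.mono (.var rfl) (by linarith [Nat.cast_nonneg (α := ℝ) ts.length])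
      · norm_num [arithCost, visits]; linarith
    · cases h1
  | node ts a b iha ihb =>
    obtain ⟨ts', hts, ⟨h1, rfl⟩ | ⟨a', b', l, u, w, h1, rfl, ha, hb⟩⟩ := h.isCover
    · cases h1
    · cases h1
      obtain ⟨x, hx, hx'⟩ := fn_hit (q := q) (k := k) (K := K) (c i) ts hts.proper
      have hlen : (ts.length : ℝ) ≤ N := by exact_mod_cast hts.length_le
      by_cases h0 : 0 < x
      · have h2 := ihb hb acc
        have h3 := iha ha (answer c i b ++ acc)
        rw [answer, if_pos (hx'.1 h0), List.append_assoc, visits, if_pos (hx'.1 h0)]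
        refine ⟨_, rfl, Ev.mono (Ev.open rfl <| Ev.open rfl <| Ev.open rfl <|
          Ev.ifLt_true (.num _ rfl rfl) (.call (.pair (.var rfl) (.var rfl)) hx) (by simpa using h0)
          <| Ev.open rfl <| .call (.pair (.var rfl) (.pair (.var rfl)
            (.call (.pair (.var rfl) (.pair (.var rfl) (.var rfl))) h2))) h3) ?_⟩
        norm_num [arithCost]; linarith
      · have h0' := fun h' => h0 (hx'.2 h')
        rw [answer, if_neg h0', List.nil_append, visits, if_neg h0']
        refine ⟨_, rfl, Ev.mono (Ev.open rfl <| Ev.open rfl <| Ev.open rfl <|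
          Ev.ifLt_false (.num _ rfl rfl) (.call (.pair (.var rfl) (.var rfl)) hx)
            (by simpa using h0) <| .var rfl) ?_⟩
        norm_num [arithCost]; linarith

theorem fn_answers {A : AugTree} {T : LineTree} (h : Matches M N A T R) (L : List (Fin n)) :
    Fn (prog q k K) fAnswers (.pair (encAug A) (encList (L.map fun i => encPoint (c i))))
      (encList (L.map fun i => encTris (answer c i A)))
      ((600 * N + 200) * (L.map fun i => visits c i A + 1).sum + 10) := by
  induction L with
  | nil => exact ⟨_, rfl, Ev.mono (Ev.open rfl <| Ev.empty rfl .nil) (by norm_num)⟩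
  | cons i L ih =>
    have h1 := fn_query (q := q) (k := k) (K := K) (c := c) i h []
    rw [List.append_nil] at h1
    refine ⟨_, rfl, Ev.mono (Ev.open rfl <| Ev.open rfl <| .pair (.call (.pair (.var rfl)
      (.pair (.var rfl) .nil)) h1) (.call (.pair (.var rfl) (.var rfl)) ih)) ?_⟩
    have h2 : (0 : ℝ) ≤ visits c i A := Nat.cast_nonneg _
    have h3 : (0 : ℝ) ≤ N := Nat.cast_nonneg _
    rw [List.map_cons, List.sum_cons]
    push_cast
    linarith

/-! ### Correctness of the answers. -/

theorem answer_proper {A : AugTree} {T : LineTree} (h : Matches M N A T R) (i : Fin n) :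
    ∀ t ∈ answer c i A, t.Proper := by
  induction A generalizing T R with
  | leaf ts =>
    obtain ⟨ts', hts, ⟨h1, rfl⟩ | ⟨a, b, l, u, w, h1, -⟩⟩ := h.isCover <;> cases h1
    intro t ht
    rw [answer] at ht
    split_ifs at ht
    · exact hts.proper t ht
    · simp at ht
  | node ts a b iha ihb =>
    obtain ⟨ts', hts, ⟨h1, rfl⟩ | ⟨a', b', l, u, w, h1, rfl, ha, hb⟩⟩ := h.isCover <;> cases h1
    intro t ht
    rw [answer] at ht
    split_ifs at ht
    · rcases List.mem_append.1 ht with ht | ht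
      · exact iha ha t ht
      · exact ihb hb t ht
    · simp at ht

theorem answer_subset (hsq : ∀ i, unitDisk (c i) ⊆ square M) {A : AugTree} {T : LineTree}
    (h : Matches M N A T R) (i : Fin n) :
    ∀ t ∈ answer c i A, ∃ R' ∈ leafRegionsFrom T R, (unitDisk (c i) ∩ R').Nonempty ∧
      triSet t ⊆ R' ∩ square M := by
  induction A generalizing T R with
  | leaf ts =>
    obtain ⟨ts', hts, ⟨h1, rfl⟩ | ⟨a, b, l, u, w, h1, -⟩⟩ := h.isCover <;> cases h1
    intro t ht
    rw [answer] at ht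
    split_ifs at ht with hh
    · refine ⟨R, rfl, ?_, ?_⟩
      · rwa [hts.cover_eq, hit_inter_square_iff hsq] at hh
      · rw [← hts.cover_eq]
        exact fun p hp => ⟨t, ht, hp⟩
    · simp at ht
  | node ts a b iha ihb =>
    obtain ⟨ts', hts, ⟨h1, rfl⟩ | ⟨a', b', l, u, w, h1, rfl, ha, hb⟩⟩ := h.isCover <;> cases h1
    intro t ht
    rw [answer] at ht
    split_ifs at ht
    · rcases List.mem_append.1 ht with ht | ht
      · obtain ⟨R', h1, h2⟩ := iha ha t ht
        exact ⟨R', Or.inl h1, h2⟩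
      · obtain ⟨R', h1, h2⟩ := ihb hb t ht
        exact ⟨R', Or.inr h1, h2⟩
    · simp at ht

theorem leafRegionsFrom_subset (T : LineTree) (R : Set Plane) :
    ∀ R' ∈ leafRegionsFrom T R, R' ⊆ R := by
  induction T generalizing R with
  | leaf => rintro R' rfl; exact subset_rfl
  | node l u w iu iw =>
    rintro R' (h | h)
    · exact (iu _ R' h).trans Set.inter_subset_left
    · exact (iw _ R' h).trans Set.inter_subset_left

/-- The regions of all ancestors contain a leaf region, so a disk that meets the leaf region passes
every test on the way to it. -/
theorem subset_cover_answer (hsq : ∀ i, unitDisk (c i) ⊆ square M) {A : AugTree} {T : LineTree}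
    (h : Matches M N A T R) (i : Fin n) :
    ∀ R' ∈ leafRegionsFrom T R, (unitDisk (c i) ∩ R').Nonempty →
      R' ∩ square M ⊆ cover (answer c i A) := by
  induction A generalizing T R with
  | leaf ts =>
    obtain ⟨ts', hts, ⟨h1, rfl⟩ | ⟨a, b, l, u, w, h1, -⟩⟩ := h.isCover <;> cases h1
    rintro R' rfl hh
    rw [← hit_inter_square_iff hsq, ← hts.cover_eq] at hh
    rw [answer, if_pos hh, hts.cover_eq]
  | node ts a b iha ihb =>
    obtain ⟨ts', hts, ⟨h1, rfl⟩ | ⟨a', b', l, u, w, h1, rfl, ha, hb⟩⟩ := h.isCover <;> cases h1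
    intro R' hR' hh
    have hhit : (unitDisk (c i) ∩ cover ts).Nonempty := by
      rw [hts.cover_eq, hit_inter_square_iff hsq]
      exact hh.mono (Set.inter_subset_inter_right _ (leafRegionsFrom_subset _ _ R' hR'))
    rw [answer, if_pos hhit]
    rcases hR' with hR' | hR'
    · intro p hp
      obtain ⟨t, ht, hpt⟩ := iha ha R' hR' hh hp
      exact ⟨t, List.mem_append_left _ ht, hpt⟩
    · intro p hp
      obtain ⟨t, ht, hpt⟩ := ihb hb R' hR' hh hp
      exact ⟨t, List.mem_append_right _ ht, hpt⟩

end Build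


/-! ### The main function -/

/-- As `1/2 + 1/(2q) ≤ 3/4` and `log d ≤ 8 d^(1/8)`, the product `m log d` is at most `8 d^(7/8)`.
This is below `(w/2) d` once `d^(1/8) ≥ 16/w`. -/
theorem exists_isLeafBound {q : ℕ} (hq : 2 ≤ q) : ∃ K, IsLeafBound q K := by
  obtain ⟨-, r2, r3⟩ := ratio_bounds hq
  set w := Real.log (1 / 2 + 1 / (2 * q) : ℝ)⁻¹ with hw
  refine ⟨2 + gapBound q + ⌈(16 / w) ^ 8⌉₊, by omega, by omega, fun d m hd hm => ?_⟩
  have hd0 : 0 < d := by omega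
  have hd1 : (1 : ℝ) ≤ d := by exact_mod_cast hd0
  set y : ℝ := (d : ℝ) ^ (1 / 8 : ℝ) with hy
  have hy0 : 0 < y := by positivity
  have hy8 : y ^ 8 = d := by
    rw [hy, ← Real.rpow_natCast, ← Real.rpow_mul (by positivity)]
    norm_num
  have hy6 : y ^ 6 = (d : ℝ) ^ (3 / 4 : ℝ) := by
    rw [hy, ← Real.rpow_natCast, ← Real.rpow_mul (by positivity)]
    norm_num
  have h1 : (m : ℝ) ≤ y ^ 6 := by
    rw [hy6]
    exact (root_le_rpow hq hm).trans (Real.rpow_le_rpow_of_exponent_le hd1 r2)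
  have h2 : Real.log d ≤ 8 * y := by
    have := Real.log_le_rpow_div (x := (d : ℝ)) (by positivity) (ε := 1 / 8) (by norm_num)
    rw [← hy] at this
    linarith
  have h3 : 16 / w ≤ y := by
    refine le_of_pow_le_pow_left₀ (n := 8) (by norm_num) hy0.le ?_
    rw [hy8]
    refine (Nat.le_ceil _).trans ?_
    exact_mod_cast (by omega : ⌈(16 / w) ^ 8⌉₊ ≤ d)
  rw [div_le_iff₀ r3] at h3
  calc (m : ℝ) * Real.log d ≤ y ^ 6 * (8 * y) :=
        mul_le_mul h1 h2 (Real.log_natCast_nonneg d) (by positivity)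
    _ = y ^ 7 / 2 * 16 := by ring
    _ ≤ y ^ 7 / 2 * (y * w) := by gcongr
    _ = w / 2 * d := by rw [← hy8]; ring

section Main

variable {n : ℕ} {c : Fin n → Plane} {q k K N : ℕ} {M : ℝ}

/-- A bound on the absolute values of the coordinates of the centers. -/
def coordBound (c : Fin n → Plane) : ℝ :=
  ((List.finRange n).map fun i => c i 0 * c i 0 + c i 1 * c i 1).sum + 1

/-- From `2|x| ≤ x² + 1`; a sum of squares saves the program absolute values and maxima. -/
theorem coordBound_spec (c : Fin n → Plane) :
    1 ≤ coordBound c ∧ ∀ i, |c i 0| ≤ coordBound c ∧ |c i 1| ≤ coordBound c := by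
  have hnn : ∀ x ∈ (List.finRange n).map fun i => c i 0 * c i 0 + c i 1 * c i 1, 0 ≤ x := by
    intro x hx
    obtain ⟨i, -, rfl⟩ := List.mem_map.1 hx
    nlinarith [mul_self_nonneg (c i 0), mul_self_nonneg (c i 1)]
  refine ⟨by linarith [List.sum_nonneg hnn, coordBound.eq_1 c], fun i => ?_⟩
  have h1 : c i 0 * c i 0 + c i 1 * c i 1 ≤ coordBound c - 1 := by
    rw [coordBound, add_sub_cancel_right]
    exact List.single_le_sum hnn _ (List.mem_map_of_mem (List.mem_finRange i))
  constructor <;> rw [abs_le] <;> constructor <;> nlinarith [mul_self_nonneg (c i 0 - 1),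
    mul_self_nonneg (c i 0 + 1), mul_self_nonneg (c i 1 - 1), mul_self_nonneg (c i 1 + 1)]

/-- Half of the side length of the bounding box. -/
def boxSize (k : ℕ) (c : Fin n → Plane) : ℝ := 4 * (k + 1) ^ 2 * coordBound c

/-- The first bound puts the unit disks into the square, the second the bounded leaf regions, whose
lines have offsets at most `k * coordBound c`. -/
theorem boxSize_ge (k : ℕ) (c : Fin n → Plane) :
    4 * coordBound c ≤ boxSize k c ∧ (2 * k + 1) * (k * coordBound c) ≤ boxSize k c := by
  have h1 := (coordBound_spec c).1
  have hk : (0 : ℝ) ≤ k := Nat.cast_nonneg k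
  rw [boxSize, ← mul_assoc]
  constructor <;> refine mul_le_mul_of_nonneg_right ?_ (by linarith) <;> nlinarith

theorem unitDisk_subset_square (k : ℕ) (c : Fin n → Plane) (i : Fin n) :
    unitDisk (c i) ⊆ square (boxSize k c) := by
  intro p hp
  rw [mem_unitDisk] at hp
  have h0 := abs_le_of_sq_le_sq' (a := p 0 - c i 0) (b := 1) (by nlinarith [sq_nonneg (p 1 - c i 1)])
    zero_le_one
  have h1 := abs_le_of_sq_le_sq' (a := p 1 - c i 1) (b := 1) (by nlinarith [sq_nonneg (p 0 - c i 0)])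
    zero_le_one
  obtain ⟨hS, hc⟩ := coordBound_spec c
  obtain ⟨hc0, hc1⟩ := hc i
  have hM := (boxSize_ge k c).1
  rw [abs_le] at hc0 hc1
  constructor <;> rw [abs_le] <;> constructor <;> linarith

/-- The state at the root of the tree. -/
theorem isState_root (hM : 0 < M)
    {bands : List (Band (Fin n))} (hslopes : bands.map Band.slope = List.range' 0 k)
    (h : ∀ b ∈ bands, b.lo = -((k + 1) * M) ∧ b.hi = (k + 1) * M ∧
      b.disks.Perm (List.finRange n) ∧
      b.disks.Pairwise fun i i' => proj b.slope (c i) ≤ proj b.slope (c i')) :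
    IsState c k (2 * 64 ^ k) M univ bands (squareTris M) := by
  have hslope : ∀ b ∈ bands, (b.slope : ℝ) ≤ k := by
    intro b hb
    have : b.slope ∈ bands.map Band.slope := List.mem_map_of_mem hb
    rw [hslopes, List.mem_range'_1] at this
    exact_mod_cast (by omega : b.slope ≤ k)
  have hk : (0 : ℝ) ≤ k := Nat.cast_nonneg k
  refine ⟨⟨proper_squareTris hM, by rw [cover_squareTris hM, univ_inter], ?_⟩, ?_, ?_, hslopes,
    fun b hb => ?_, fun b hb i => ?_, fun b hb => (h b hb).2.2.2⟩
  · have : 1 ≤ 64 ^ k := Nat.one_le_pow _ _ (by norm_num)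
    simpa [squareTris] using this
  · rw [univ_inter, eq_comm, inter_eq_left]
    intro p hp b hb
    rw [(h b hb).1, (h b hb).2.1, ← abs_le]
    refine (proj_add_le hp.1 hp.2).trans ?_
    have := hslope b hb
    gcongr
  -- The origin is an interior point of the square and of all initial bands.
  · refine ⟨0, ⟨by simpa using hM, by simpa using hM⟩, fun b hb => ?_⟩
    rw [(h b hb).1, (h b hb).2.1, ← abs_lt]
    simp only [proj, PiLp.zero_apply, mul_zero, add_zero, abs_zero]
    positivity
  · exact (h b hb).2.2.1.nodup_iff.2 (List.nodup_finRange n)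
  · refine ⟨fun _ => mem_hitSet.2 ?_, fun _ => (h b hb).2.2.1.mem_iff.2 (List.mem_finRange i)⟩
    rw [inter_univ]
    exact ⟨c i, by simp [unitDisk]⟩

theorem hitSet_univ (c : Fin n → Plane) : hitSet c univ = Finset.univ := by
  ext i
  simp only [mem_hitSet, inter_univ, Finset.mem_univ, iff_true]
  exact ⟨c i, by simp [unitDisk]⟩

theorem encInput_eq (c : Fin n → Plane) :
    encInput c = encList ((List.finRange n).map fun i => encPoint (c i)) := by
  rw [encInput, List.ofFn_eq_map]

theorem sum_visits_finRange (c : Fin n → Plane) (A : AugTree) :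
    ((List.finRange n).map fun i => visits c i A + 1).sum = totalVisits c A univ + n := by
  rw [totalVisits, hitSet_univ, ← List.ofFn_eq_map, List.sum_ofFn, Finset.sum_add_distrib]
  simp

/-- A bound on the number of steps for `n` disks. -/
def mainCost (q K n : ℕ) : ℝ :=
  (sortConst * (n * Real.log n) + 30 * n + 70) * (4 * q : ℕ) +
    (buildConst q (4 * q) K * (n * Real.log n) + leafCost K) +
    (600 * (2 * 64 ^ (4 * q) : ℕ) + 200) *
      (buildConst q (4 * q) K * (n * Real.log n) + leafCost K + n) + 30 * n + 200

theorem fn_main (hq : 2 ≤ q) (hK : IsLeafBound q K) {α β : ℝ}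
    (hα : (1 / 2 + 1 / (2 * q) : ℝ) ≤ α) (hβ : (1 / 2 + 1 / (2 * q) : ℝ) ≤ β)
    (hc : Pairwise fun i j => Disjoint (unitDisk (c i)) (unitDisk (c j))) :
    ∃ T A, Fn (prog q (4 * q) K) fMain (encInput c) (.pair (encTree T)
        (encList ((List.finRange n).map fun i => encTris (answer c i A)))) (mainCost q K n) ∧
      IsSDT α β K c T ∧ LinesIn (4 * q) ((4 * q : ℕ) * coordBound c) T ∧
      Matches (boxSize (4 * q) c) (2 * 64 ^ (4 * q)) A T univ := by
  obtain ⟨hS, hcoord⟩ := coordBound_spec c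
  have hM : 0 < boxSize (4 * q) c := by linarith [(boxSize_ge (4 * q) c).1]
  have hsq := unitDisk_subset_square (4 * q) c
  have hτ : ∀ i, ∀ j < 4 * q, |proj j (c i)| ≤ (4 * q : ℕ) * coordBound c := by
    intro i j hj
    refine (proj_add_le (hcoord i).1 (hcoord i).2).trans ?_
    have : (j : ℝ) + 1 ≤ (4 * q : ℕ) := by exact_mod_cast hj
    gcongr
  obtain ⟨bands, hslopes, hbands, hinit⟩ := fn_init (q := q) (k := 4 * q) (K := K) (c := c)
    (((4 * q : ℕ) + 1) * boxSize (4 * q) c) (List.finRange n) (4 * q) 0 (zero_add _)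
  obtain ⟨T, A, hbuild, hsdt, hlines, hmatch, hvisits⟩ := fn_build hq hK hα hβ hc hM hsq hτ n univ
    bands _ (isState_root hM hslopes hbands) (by rw [hitSet_univ]; simp)
  refine ⟨T, A, ?_, hsdt, hlines, hmatch⟩
  have hans := fn_answers (q := q) (k := 4 * q) (K := K) (c := c) hmatch (List.finRange n)
  rw [sum_visits_finRange] at hans
  have hsum := fn_sum (q := q) (k := 4 * q) (K := K) c (List.finRange n)
  have hmul := Ev.mul (P := prog q (4 * q) K) 
    (env := [encList ((List.finRange n).map fun i => encPoint (c i))])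
    (Ev.const (q := 4 * ((4 * q : ℕ) + 1) ^ 2)) (.call (.var (k := 0) rfl) hsum)
  have hmul' : ((4 * ((4 * q : ℕ) + 1) ^ 2 : ℚ) : ℝ) * coordBound c = boxSize (4 * q) c := by
    rw [boxSize]; push_cast; ring
  rw [← coordBound, hmul'] at hmul
  rw [Nat.cast_zero] at hinit
  rw [encInput_eq]
  refine ⟨_, rfl, Ev.mono (Ev.letIn hmul <| Ev.letIn (.call (.pair (.var rfl) (.pair
    (.call (.var rfl) (fn_box _)) (.call (.pair (.num _ rfl (by simp)) (.pair
      (.num _ rfl (by simp)) (.var rfl))) hinit))) hbuild) <| Ev.open rfl <|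
    .pair (.var rfl) (.call (.pair (.var rfl) (.var rfl)) hans)) ?_⟩
  have h1 : (600 * (2 * 64 ^ (4 * q) : ℕ) + 200 : ℝ) * (totalVisits c A univ + n : ℕ) ≤
      (600 * (2 * 64 ^ (4 * q) : ℕ) + 200) *
      (buildConst q (4 * q) K * (n * Real.log n) + leafCost K + n) := by
    push_cast at hvisits ⊢
    gcongr
  rw [mainCost]
  simp only [List.length_finRange, arithCost] at h1 ⊢
  norm_num at h1 ⊢
  linarith

/-- The answers as lists of affine triangles. -/
def answerTriangles (c : Fin n → Plane) {A : AugTree} {T : LineTree} {R : Set Plane} (h : Matches M N A T R)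
    (i : Fin n) : List (Affine.Triangle ℝ Plane) :=
  (answer c i A).pmap Tri.toTriangle (answer_proper h i)

theorem encOutput_answerTriangles {A : AugTree} {T : LineTree} (h : Matches M N A T univ) :
    encOutput T (answerTriangles c h) = .pair (encTree T)
      (encList ((List.finRange n).map fun i => encTris (answer c i A))) := by
  rw [encOutput, List.ofFn_eq_map]
  congr 2
  refine List.map_congr_left fun i _ => ?_
  rw [answerTriangles, List.map_pmap, encTris]
  simp only [encTriangle_toTriangle]
  rw [List.pmap_eq_map]

theorem square_eq_box (M : ℝ) : square M = box (mkPoint (-M) (-M)) (mkPoint M M) := by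
  ext p
  simp [square, box, Fin.forall_fin_two, abs_le]

theorem isTriangleCover_answerTriangles (hsq : ∀ i, unitDisk (c i) ⊆ square M) {A : AugTree}
    {T : LineTree} (h : Matches M N A T univ)
    (hT : ∀ R ∈ leafRegions T, Bornology.IsBounded R → R ⊆ square M) :
    IsTriangleCover c T (answerTriangles c h) := by
  refine ⟨mkPoint (-M) (-M), mkPoint M M, ?_, ?_, fun i => ⟨fun t ht => ?_, fun R hR hi => ?_⟩⟩
  · rwa [← square_eq_box]
  · rwa [← square_eq_box]
  · obtain ⟨t', ht', rfl⟩ := List.mem_pmap.1 ht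
    rw [triangleSet_toTriangle, ← square_eq_box]
    exact answer_subset hsq h i t' ht'
  · rw [← square_eq_box]
    refine (subset_cover_answer hsq h i R hR hi).trans fun p hp => ?_
    obtain ⟨t, ht, hpt⟩ := hp
    have ht' := answer_proper h i t ht
    refine mem_biUnion (x := t.toTriangle ht') (List.mem_pmap.2 ⟨t, ht, rfl⟩) ?_
    rwa [triangleSet_toTriangle]

theorem subset_square_of_bounded {τ : ℝ} {T : LineTree} (hT : LinesIn k τ T)
    (hτ : (2 * k + 1) * τ ≤ M) :
    ∀ R ∈ leafRegions T, Bornology.IsBounded R → R ⊆ square M := by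
  intro R hR hb
  have h0 : cutRegion [] = univ := by ext; simp [cutRegion]
  have := leafRegions_subset_square T hT [] (by simp) R (by rwa [h0]) hb
  exact fun p hp => ⟨(this hp).1.trans hτ, (this hp).2.trans hτ⟩

end Main

/-! ### From the deterministic run to the expected time. -/

theorem Halts.unique {P : Program} {x : Val} {ω : ℕ → Bool} {v v' : Val} {t t' : ℕ}
    (h : Halts P x ω v t) (h' : Halts P x ω v' t') : v = v' ∧ t = t' := by
  obtain ⟨s, hs⟩ := h
  obtain ⟨s', hs'⟩ := h'
  obtain ⟨h1, -, h2⟩ := hs.unique hs'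
  exact ⟨h1, h2⟩

/-- The integrand is bounded by a constant and the coin measure is a probability measure, so no
measurability enters. -/
theorem expectedTime_le {P : Program} {x v : Val} {t : ℕ} (h : ∀ ω, Halts P x ω v t) :
    expectedTime P x ≤ t := by
  have : IsProbabilityMeasure coinMeasure := by unfold coinMeasure; infer_instance
  calc expectedTime P x ≤ ∫⁻ _, (t : ℝ≥0∞) ∂coinMeasure :=
        lintegral_mono fun ω => iInf_le_of_le v <| iInf_le_of_le t <| iInf_le_of_le (h ω) le_rfl
    _ = t := by simp

theorem natCast_le_mul_logb_add_one (n : ℕ) : (n : ℝ) ≤ n * Real.logb 2 n + 1 := by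
  rcases Nat.lt_or_ge n 2 with h | h
  · interval_cases n <;> simp
  · have h2 : (2 : ℝ) ≤ n := by exact_mod_cast h
    have : 1 ≤ Real.logb 2 n := by
      rw [Real.le_logb_iff_rpow_le (by norm_num) (by linarith), Real.rpow_one]
      exact h2
    nlinarith

theorem mul_log_le_mul_logb_add_one (n : ℕ) :
    (n : ℝ) * Real.log n ≤ n * Real.logb 2 n + 1 := by
  have h1 : Real.log n ≤ Real.logb 2 n := by
    rw [Real.logb, le_div_iff₀ (Real.log_pos one_lt_two)]
    have : Real.log 2 ≤ 1 := by linarith [Real.log_two_lt_d9]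
    nlinarith [Real.log_natCast_nonneg n]
  nlinarith [Nat.cast_nonneg (α := ℝ) n]

/-- With `X = n log₂ n + 1`, each of `1`, `n` and `n log n` is at most `X`, so every term of the
cost is a constant multiple of `X`. -/
theorem exists_mainCost_le {q : ℕ} (hq : 2 ≤ q) (K : ℕ) : ∃ C : ℝ, ∀ n : ℕ,
    mainCost q K n ≤ C * (n * Real.logb 2 n + 1) := by
  set b := buildConst q (4 * q) K with hb
  set r : ℝ := 600 * (2 * 64 ^ (4 * q) : ℕ) + 200 with hr
  have hb0 : 0 ≤ b := buildConst_nonneg hq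
  have hr0 : 0 ≤ r := by positivity
  have hl := leafCost_ge K
  refine ⟨(sortConst + 30 + 70) * (4 * q : ℕ) + (b + leafCost K) + r * (b + leafCost K + 1) + 30 +
    200, fun n => ?_⟩
  set X := (n : ℝ) * Real.logb 2 n + 1 with hX
  have h1 : (n : ℝ) ≤ X := natCast_le_mul_logb_add_one n
  have h2 : (n : ℝ) * Real.log n ≤ X := mul_log_le_mul_logb_add_one n
  have h3 : 1 ≤ X := by
    have : 0 ≤ Real.logb 2 n := by
      rw [Real.logb]
      exact div_nonneg (Real.log_natCast_nonneg n) (Real.log_nonneg one_le_two)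
    have : 0 ≤ (n : ℝ) * Real.logb 2 n := by positivity
    linarith
  have h4 : leafCost K ≤ leafCost K * X := le_mul_of_one_le_right (by linarith) h3
  have h5 : b * (n * Real.log n) ≤ b * X := by gcongr
  have h6 : sortConst * (n * Real.log n) ≤ sortConst * X :=
    mul_le_mul_of_nonneg_left h2 sortConst_nonneg
  have h7 : (sortConst * (n * Real.log n) + 30 * n + 70) * (4 * q : ℕ) ≤
      (sortConst * X + 30 * X + 70 * X) * (4 * q : ℕ) :=
    mul_le_mul_of_nonneg_right (by linarith) (Nat.cast_nonneg _)
  have h8 : r * (b * (n * Real.log n) + leafCost K + n) ≤ r * (b * X + leafCost K * X + X) :=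
    mul_le_mul_of_nonneg_left (by linarith) hr0
  rw [mainCost, ← hb, ← hr]
  linarith

end OnionSDT

end

theorem mainTheorem4 (ε : ℝ) (hε₀ : 0 < ε) (hε₁ : ε < 1 / 2) :
    ∃ (P : OnionSDT.Program) (K : ℕ) (C : ℝ),
      ∀ (n : ℕ) (c : Fin n → OnionSDT.Plane),
        Pairwise (fun i j => Disjoint (OnionSDT.unitDisk (c i)) (OnionSDT.unitDisk (c j))) →
        (∀ (ω : ℕ → Bool) (v : OnionSDT.Val) (t : ℕ),
          OnionSDT.Halts P (OnionSDT.encInput c) ω v t →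
          ∃ (T : OnionSDT.LineTree) (TD : Fin n → List (Affine.Triangle ℝ OnionSDT.Plane)),
            v = OnionSDT.encOutput T TD ∧
            OnionSDT.IsSDT (1 / 2 + ε) (1 / 2 + ε) K c T ∧
            OnionSDT.IsTriangleCover c T TD) ∧
        OnionSDT.expectedTime P (OnionSDT.encInput c) ≤
          ENNReal.ofReal (C * (n * Real.logb 2 n + 1)) := by
  -- The parameter that brings both the balance and the exponent within `ε` of `1/2`.
  obtain ⟨q, hq, hqε⟩ : ∃ q : ℕ, 2 ≤ q ∧ 1 / (2 * q : ℝ) ≤ ε := by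
    obtain ⟨q, hq⟩ := exists_nat_gt (1 / ε)
    refine ⟨q + 2, by omega, ?_⟩
    rw [div_lt_iff₀ hε₀] at hq
    push_cast
    rw [div_le_iff₀ (by positivity)]
    nlinarith
  obtain ⟨K, hK⟩ := OnionSDT.exists_isLeafBound hq
  obtain ⟨C, hC⟩ := OnionSDT.exists_mainCost_le hq K
  -- The extra `3` covers the steps of the initial call of the main function.
  refine ⟨OnionSDT.prog q (4 * q) K, K, C + 3, fun n c hc => ?_⟩
  obtain ⟨T, A, hfn, hsdt, hlines, hmatch⟩ := OnionSDT.fn_main hq hK (α := 1 / 2 + ε)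
    (β := 1 / 2 + ε) (by linarith) (by linarith) hc
  obtain ⟨t, ht, hrun⟩ := OnionSDT.Ev.call (env := [OnionSDT.encInput c])
    (OnionSDT.Ev.var (k := 0) rfl) hfn
  have hhalts : ∀ ω, OnionSDT.Halts (OnionSDT.prog q (4 * q) K) (OnionSDT.encInput c) ω
      (OnionSDT.encOutput T (OnionSDT.answerTriangles c hmatch)) t := by
    intro ω
    rw [OnionSDT.encOutput_answerTriangles]
    exact ⟨0, hrun ω 0⟩
  -- Evaluation is deterministic for given tosses, so any halting run is the one constructed.
  refine ⟨fun ω v t' hv => ⟨T, OnionSDT.answerTriangles c hmatch, (hv.unique (hhalts ω)).1, hsdt,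
    OnionSDT.isTriangleCover_answerTriangles (OnionSDT.unitDisk_subset_square _ c) hmatch
      (OnionSDT.subset_square_of_bounded hlines (OnionSDT.boxSize_ge _ c).2)⟩, ?_⟩
  refine (OnionSDT.expectedTime_le hhalts).trans ?_
  rw [← ENNReal.ofReal_natCast]
  refine ENNReal.ofReal_le_ofReal (ht.trans ?_)
  have h1 := hC n
  have h2 : 0 ≤ (n : ℝ) * Real.logb 2 n :=
    mul_nonneg (Nat.cast_nonneg n)
      (div_nonneg (Real.log_natCast_nonneg n) (Real.log_nonneg one_le_two))
  linarith
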